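/- Let $\Sigma$ be a finite alphabet. A *word sequence* is a finite or infinite sequence $\vec u=\langle u_0,u_1,\dots\rangle$ of finite words over $\Sigma$; $|\vec u|\in\mathbb N\cup\{\infty\}$ is its length, and $\langle\rangle$ is the word sequence of length $0$. For a finite or infinite non-decreasing sequence $g$ of natural numbers with all $g(i)\le|\vec u|$, let $$\vec u/g=\langle u_0\cdots u_{g(0)-1},\ u_{g(0)}\cdots u_{g(1)-1},\ \dots\rangle ,$$ a word sequence of the same length as $g$, and let $g'$ be the sequence of differences $g'(i)=g(i+1)-g(i)$ for $i+1<|g|$. For languages (sets) $K,L$ of word sequences define - $K\cdot L=\{\langle u_0v_0,u_1v_1,\dots\rangle : \vec u\in K,\ \vec v\in L,\ |\vec u|=|\vec v|\}$; - the mix $K+L$: the set of all $\vec w$ for which there are $\vec u\in K$, $\vec v\in L$ with $|\vec w|=\max(|\vec u|,|\vec v|)$ such that for every $i<|\vec w|$ either $i<|\vec u|$ and $w_i=u_i$, or $i<|\vec v|$ and $w_i=v_i$; - $L^*=\{\vec u/g\}$, where $\vec u$ ranges over $L$ and $g$ over all finite or infinite non-decreasing sequences of natural numbers with values at most $|\vec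 u|$; - $L^B$: the same, restricted to those $g$ for which $g'$ is finite or bounded; - $L^S$: the same, restricted to those $g$ for which $g'$ is finite or tends to $+\infty$. *$BS$-regular expressions* are given by the grammar $$e ::= \emptyset \mid \varepsilon \mid \bar\varepsilon \mid a \mid e\cdot e\mid e+e\mid e^*\mid e^B\mid e^S\qquad(a\in\Sigma).$$ Such an expression denotes a language $[\![e]\!]$ of word sequences: $[\![\emptyset]\!]=\{\langle\rangle\}$; $[\![\varepsilon]\!]$ is the set of all finite and infinite word sequences all of whose words are empty; $[\![\bar\varepsilon]\!]$ is the set of all finite sequences in $[\![\varepsilon]\!]$; $[\![a]\!]$ is the set of all finite and infinite word sequences all of whose words are the one-letter word $a$; the remaining operators are interpreted by the operations above. An expression is *$B$-regular* if the exponent $S$ does not occur in it, and *$S$-regular* if the exponent $B$ does not occur in it. The *$\omega$-power* $L^\omega$ of a language $L$ of word sequences is the set of $\omega$-words $u_0u_1u_2\cdots$, where $\vec u$ ranges over the infinite word sequences in $L$ that have infinitely many nonempty words. A language of $\omega$-words over $\Sigma$ is *$\omega BS$-regular* (respectively *$\omega B$-regular*, *$\omega S$-regular*) if it equals a finite union $\bigcup_{i=1}^n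 M_i\cdot[\![f_i]\!]^\omega$, where each $M_i\subseteq\Sigma^*$ is the language of finite words denoted by an ordinary regular expression and each $f_i$ is a $BS$-regular (respectively $B$-regular, $S$-regular) expression. **Corollary.** Let $K,L\subseteq\Sigma^\omega$. If $K$ and $L$ are both $\omega BS$-regular, then so is $K\cap L$. If $K$ and $L$ are both $\omega B$-regular, then so is $K\cap L$. If $K$ and $L$ are both $\omega S$-regular, then so is $K\cap L$. -/

import Mathlib

namespace OmegaBS

/-! ### Finite or infinite sequences

`Stream'.Seq X` is the type of finite or infinite sequences of elements of `X`; `s.get? i` is the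
`i`-th element (`none` if `i` is not smaller than the length) and `s.length' : ℕ∞` the length. -/

/-- A word sequence: a finite or infinite sequence of finite words. -/
abbrev WordSeq (α : Type*) := Stream'.Seq (List α)

/-- A finite or infinite sequence of natural numbers. -/
abbrev NatSeq := Stream'.Seq ℕ

/-- The sequence has a global upper bound. Finite sequences always have one. -/
def NatSeq.Bounded (s : NatSeq) : Prop :=
  ∃ M : ℕ, ∀ i n : ℕ, s.get? i = some n → n ≤ M

/-- The sequence is finite or tends to infinity. -/
def NatSeq.FiniteOrToInfinity (s : NatSeq) : Prop :=
  ∀ M : ℕ, ∃ N : ℕ, ∀ i n : ℕ, N ≤ i → s.get? i = some n → M ≤ n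

/-- `g i ≤ g j` for all `i ≤ j < |g|`. -/
def NatSeq.NonDecreasing (g : NatSeq) : Prop :=
  ∀ i j m n : ℕ, i ≤ j → g.get? i = some m → g.get? j = some n → m ≤ n

/-- The sequence of differences `g (i + 1) - g i`, for `i + 1 < |g|`. -/
def NatSeq.diff (g : NatSeq) : NatSeq :=
  Stream'.Seq.zipWith (fun m n => n - m) g g.tail

variable {α : Type*}

/-- The finite word `u_a u_{a+1} ⋯ u_{b-1}` (used for `a ≤ b ≤ |u|`). -/
def WordSeq.block (u : WordSeq α) (a b : ℕ) : List α :=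
  ((List.range' a (b - a)).filterMap u.get?).flatten

/-- `⟨u_0 ⋯ u_{g(0)-1}, u_{g(0)} ⋯ u_{g(1)-1}, …⟩`, a word sequence of the same length as `g`
(used for non-decreasing `g` with all values at most `|u|`). The blocks start at `0, g(0), g(1), …`
and end at `g(0), g(1), g(2), …`. -/
def WordSeq.group (u : WordSeq α) (g : NatSeq) : WordSeq α :=
  Stream'.Seq.zipWith (fun a b => u.block a b) (Stream'.Seq.cons 0 g) g

/-- `g` is non-decreasing and `g ≤ |u|`. -/
def NatSeq.Groups (g : NatSeq) (u : WordSeq α) : Prop :=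
  g.NonDecreasing ∧ ∀ i n : ℕ, g.get? i = some n → (n : ℕ∞) ≤ u.length'

/-! ### Operations on languages of word sequences -/

/-- `⟨u_0 v_0, u_1 v_1, …⟩` for `u ∈ K`, `v ∈ L` of the same length. -/
def concat (K L : Set (WordSeq α)) : Set (WordSeq α) :=
  {w | ∃ u ∈ K, ∃ v ∈ L, u.length' = v.length' ∧
    w = Stream'.Seq.zipWith (fun x y => x ++ y) u v}

/-- The mix: each word of `w` is the word of `u` or the word of `v` at the same position; where
only one of `u`, `v` is defined, the word is taken from that one. -/
def mix (K L : Set (WordSeq α)) : Set (WordSeq α) :=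
  {w | ∃ u ∈ K, ∃ v ∈ L, w.length' = max u.length' v.length' ∧
    ∀ i x, w.get? i = some x → u.get? i = some x ∨ v.get? i = some x}

/-- The exponent `*`. -/
def starExp (L : Set (WordSeq α)) : Set (WordSeq α) :=
  {w | ∃ u ∈ L, ∃ g : NatSeq, g.Groups u ∧ w = u.group g}

/-- The exponent `B`: groupings of bounded difference. -/
def boundedExp (L : Set (WordSeq α)) : Set (WordSeq α) :=
  {w | ∃ u ∈ L, ∃ g : NatSeq, g.Groups u ∧ g.diff.Bounded ∧ w = u.group g}

/-- The exponent `S`: groupings of strongly unbounded difference. -/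
def unboundedExp (L : Set (WordSeq α)) : Set (WordSeq α) :=
  {w | ∃ u ∈ L, ∃ g : NatSeq, g.Groups u ∧ g.diff.FiniteOrToInfinity ∧ w = u.group g}

/-- All finite and infinite word sequences whose words are all equal to `x`. -/
def constSeqs (x : List α) : Set (WordSeq α) :=
  {w | ∀ i y, w.get? i = some y → y = x}

/-! ### Expressions -/

/-- The syntax of `BS`-regular expressions over the alphabet `α`. -/
inductive BSExpr (α : Type*) where
  | empty : BSExpr α
  | eps : BSExpr α
  | finEps : BSExpr α
  | letter (a : α) : BSExpr α
  | comp (e f : BSExpr α) : BSExpr α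
  | plus (e f : BSExpr α) : BSExpr α
  | star (e : BSExpr α) : BSExpr α
  | expB (e : BSExpr α) : BSExpr α
  | expS (e : BSExpr α) : BSExpr α

/-- The language of word sequences of a `BS`-regular expression. -/
def BSExpr.sem : BSExpr α → Set (WordSeq α)
  | .empty => {Stream'.Seq.nil}
  | .eps => constSeqs []
  | .finEps => {w | w ∈ constSeqs [] ∧ w.Terminates}
  | .letter a => constSeqs [a]
  | .comp e f => concat e.sem f.sem
  | .plus e f => mix e.sem f.sem
  | .star e => starExp e.sem
  | .expB e => boundedExp e.sem
  | .expS e => unboundedExp e.sem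

/-- The exponent `B` does not occur in the expression. -/
def BSExpr.AvoidsB : BSExpr α → Prop
  | .empty | .eps | .finEps | .letter _ => True
  | .comp e f | .plus e f => e.AvoidsB ∧ f.AvoidsB
  | .star e | .expS e => e.AvoidsB
  | .expB _ => False

/-- The exponent `S` does not occur in the expression. -/
def BSExpr.AvoidsS : BSExpr α → Prop
  | .empty | .eps | .finEps | .letter _ => True
  | .comp e f | .plus e f => e.AvoidsS ∧ f.AvoidsS
  | .star e | .expB e => e.AvoidsS
  | .expS _ => False

/-- The ω-word `w` is the concatenation `u_0 u_1 u_2 ⋯` of a word sequence `u` that has infinitely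
many nonempty words. -/
def IsOmegaConcat (u : WordSeq α) (w : Stream' α) : Prop :=
  (∀ n : ℕ, ∃ i ≥ n, ∃ x, u.get? i = some x ∧ x ≠ []) ∧
    ∀ n : ℕ, w.take (u.block 0 n).length = u.block 0 n

/-- The ω-power of a language of word sequences. -/
def omegaPower (L : Set (WordSeq α)) : Set (Stream' α) :=
  {w | ∃ u ∈ L, IsOmegaConcat u w}

/-- An `ωBS`-regular expression: a finite formal sum of terms `e · f^ω` with `e` a regular
expression and `f` a `BS`-regular expression. -/
abbrev OmegaExpr (α : Type*) := List (RegularExpression α × BSExpr α)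

/-- The language of ω-words of an `ωBS`-regular expression. -/
def OmegaExpr.sem (e : OmegaExpr α) : Set (Stream' α) :=
  {w | ∃ p ∈ e, ∃ x ∈ p.1.matches', ∃ y ∈ omegaPower p.2.sem, w = x ++ₛ y}

/-- `L` is an `ωBS`-regular language. -/
def IsOmegaBSRegular (L : Set (Stream' α)) : Prop :=
  ∃ e : OmegaExpr α, e.sem = L

/-- `L` is an `ωB`-regular language. -/
def IsOmegaBRegular (L : Set (Stream' α)) : Prop :=
  ∃ e : OmegaExpr α, (∀ p ∈ e, p.2.AvoidsS) ∧ e.sem = L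

/-- `L` is an `ωS`-regular language. -/
def IsOmegaSRegular (L : Set (Stream' α)) : Prop :=
  ∃ e : OmegaExpr α, (∀ p ∈ e, p.2.AvoidsB) ∧ e.sem = L

end OmegaBS

/-! A word sequence denoted by an expression is constrained position by position, up to two
thresholds. The exponent B bounds numbers of factors by one `N` for the whole sequence; the exponent
S asks for at least `m` factors, where `m` depends on the position and tends to infinity. So an
expression `e` is replaced by a family `e.fam N m` of languages of finite words, and a sequence lies
in `e.sem` iff, for some `N` and some `f` tending to infinity, its `i`-th word lies in `e.fam N (f
i)` (`BSExpr.sem_eq_seqs`). Inclusion of families matters only up to enlarging `N` and lowering `m`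
by a function that still tends to infinity (`Dom`).

The core is that the intersection of the families of two expressions is equivalent to the family of
an expression with the same permitted exponents (`compatible_of_allowed`). The proof is a double
structural induction, strengthened from whole words to pieces: every expression has a finite set
`fac` of families that is closed under cutting words in two (`BSExpr.fac_spec`). If one side is a
product, cutting the words of the other side reduces to the two factors.

The hard case is `a · e^x · b` against `f^y` (`definable_inf_pw`). Read a word along both
factorizations. A typical step starts inside a factor of `e` whose unread rest lies in `r`: one
factor of `f` covers this rest, passes `i` whole factors of `e` and ends inside the next one; then
`j` whole factors of `f` follow within that one. Steps are the edges of a finite graph whose labels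
involve only simpler intersections, and Kleene's algorithm makes the words along its paths definable
(`definable_pathFam`). The total number of factors is the sum of the counts of the steps, up to the
number of steps. It is bounded iff the number of steps and every single count are; it is large iff
there are many steps or one count is large, at the price of a square root. A large single count is
remembered by a Boolean in the vertex (`stepsFam_dom`, `dom_stepsFam`).

For ω-words, the cut positions of the second factorization fall into words of the first and cut them
into pieces from finitely many pairs `(l, r)`. By the pigeonhole principle one pair recurs forever,
so the ω-word is a prefix followed by words of `(r · p^* · l) ∩ q^*`
(`exists_of_mem_inter_omegaLang`). Conversely, an ω-power absorbs the star inside it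
(`IsCut.of_star`), so regrouping `l · r` into words of `p` recovers both factorizations. -/

open Filter
open scoped Computability

namespace OmegaBS

variable {α : Type*}

/-! ### Families of languages with two thresholds -/

/-- A family of languages indexed by an upper threshold and a lower threshold. -/
abbrev Fam (α : Type*) := ℕ → ℕ → Language α

/-- The family grows with the upper threshold and shrinks with the lower one. -/
def Fam.Mono (q : Fam α) : Prop :=
  ∀ ⦃N N' m m' : ℕ⦄, N ≤ N' → m' ≤ m → q N m ≤ q N' m'

/-- A change of thresholds. -/
structure Par where
  N : ℕ
  φ : ℕ → ℕ
  tendsto : Tendsto φ atTop atTop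

/-- Larger means more permissive. Thus `∀ᶠ p in atTop` speaks of all sufficiently permissive
changes, and since the order is directed, finitely many such demands can be met by one change. -/
instance : Preorder Par where
  le p p' := p.N ≤ p'.N ∧ ∀ m, p'.φ m ≤ p.φ m
  le_refl p := ⟨le_rfl, fun _ => le_rfl⟩
  le_trans p q r h h' := ⟨h.1.trans h'.1, fun m => (h'.2 m).trans (h.2 m)⟩

instance : Nonempty Par := ⟨⟨0, id, tendsto_id⟩⟩

theorem tendsto_min {f g : ℕ → ℕ} (hf : Tendsto f atTop atTop) (hg : Tendsto g atTop atTop) :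
    Tendsto (fun m => min (f m) (g m)) atTop atTop := by
  rw [tendsto_atTop] at *
  intro b
  filter_upwards [hf b, hg b] with m h h' using le_min h h'

instance : IsDirectedOrder Par where
  directed p q := ⟨⟨max p.N q.N, fun m => min (p.φ m) (q.φ m), tendsto_min p.tendsto q.tendsto⟩,
    ⟨le_max_left _ _, fun _ => min_le_left _ _⟩, ⟨le_max_right _ _, fun _ => min_le_right _ _⟩⟩

theorem Par.eventually_le (N : ℕ) {ψ : ℕ → ℕ} (hψ : Tendsto ψ atTop atTop) :
    ∀ᶠ p : Par in atTop, N ≤ p.N ∧ ∀ m, p.φ m ≤ ψ m :=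
  eventually_ge_atTop (⟨N, ψ, hψ⟩ : Par)

theorem Par.eventually_id (N : ℕ) : ∀ᶠ p : Par in atTop, N ≤ p.N ∧ ∀ m, p.φ m ≤ m :=
  Par.eventually_le N tendsto_id

/-- `q` is contained in `q'` up to a change of thresholds. -/
def Dom (q q' : Fam α) : Prop :=
  ∀ N, ∀ᶠ p : Par in atTop, ∀ m, q N m ≤ q' p.N (p.φ m)

/-- By monotonicity of `q'`, one change that works makes every more permissive one work. -/
theorem Dom.of_le {q q' : Fam α} (hq' : q'.Mono)
    (h : ∀ N, ∃ N' ψ, Tendsto ψ atTop atTop ∧ ∀ m, q N m ≤ q' N' (ψ m)) : Dom q q' := by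
  intro N
  obtain ⟨N', ψ, hψ, h⟩ := h N
  filter_upwards [Par.eventually_le N' hψ] with p hp m
  exact (h m).trans (hq' hp.1 (hp.2 m))

theorem Dom.of_le' {q q' : Fam α} (hq' : q'.Mono) (h : ∀ N m, q N m ≤ q' N m) : Dom q q' :=
  Dom.of_le hq' fun N => ⟨N, id, tendsto_id, h N⟩

theorem Dom.refl {q : Fam α} (hq : q.Mono) : Dom q q := Dom.of_le' hq fun _ _ => le_rfl

theorem Dom.exists {q q' : Fam α} (h : Dom q q') (N : ℕ) :
    ∃ N' ψ, Tendsto ψ atTop atTop ∧ ∀ m, q N m ≤ q' N' (ψ m) := by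
  obtain ⟨p, hp⟩ := (h N).exists
  exact ⟨p.N, p.φ, p.tendsto, hp⟩

theorem Dom.trans {q q' q'' : Fam α} (h : Dom q q') (h' : Dom q' q'') (hq : q''.Mono) :
    Dom q q'' := by
  refine Dom.of_le hq fun N => ?_
  obtain ⟨N', ψ, hψ, h1⟩ := h.exists N
  obtain ⟨N'', ψ', hψ', h2⟩ := h'.exists N'
  exact ⟨N'', ψ' ∘ ψ, hψ'.comp hψ, fun m => (h1 m).trans (h2 _)⟩

theorem Dom.add_le {p q r : Fam α} (h : Dom p r) (h' : Dom q r) : Dom (p + q) r := by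
  intro N
  filter_upwards [h N, h' N] with P h1 h2 m
  exact sup_le (h1 m) (h2 m)

theorem Dom.iSup_le {ι : Type*} [Finite ι] {p : ι → Fam α} {r : Fam α} (h : ∀ i, Dom (p i) r) :
    Dom (⨆ i, p i) r := by
  intro N
  filter_upwards [eventually_all.2 fun i => h i N] with P h1 m
  rw [iSup_apply, iSup_apply]
  exact _root_.iSup_le fun i => h1 i m

theorem Dom.mul {p q p' q' : Fam α} (h : Dom p p') (h' : Dom q q') : Dom (p * q) (p' * q') := by
  intro N
  filter_upwards [h N, h' N] with P h1 h2 m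
  exact mul_le_mul' (h1 m) (h2 m)

theorem mono_const (L : Language α) : Fam.Mono fun _ _ => L := fun _ _ _ _ _ _ => le_rfl

theorem mono_zero : Fam.Mono (0 : Fam α) := mono_const 0

theorem mono_one : Fam.Mono (1 : Fam α) := mono_const 1

theorem Fam.Mono.add {p q : Fam α} (h : p.Mono) (h' : q.Mono) : (p + q).Mono :=
  fun _ _ _ _ h1 h2 => sup_le_sup (h h1 h2) (h' h1 h2)

theorem Fam.Mono.mul {p q : Fam α} (h : p.Mono) (h' : q.Mono) : (p * q).Mono :=
  fun _ _ _ _ h1 h2 => mul_le_mul' (h h1 h2) (h' h1 h2)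

theorem Fam.Mono.inf {p q : Fam α} (h : p.Mono) (h' : q.Mono) : (p ⊓ q).Mono :=
  fun _ _ _ _ h1 h2 => inf_le_inf (h h1 h2) (h' h1 h2)

theorem Fam.Mono.iSup {ι : Sort*} {p : ι → Fam α} (h : ∀ i, (p i).Mono) : (⨆ i, p i).Mono := by
  intro N N' m m' h1 h2
  simp only [iSup_apply]
  exact iSup_mono fun i => h i h1 h2

theorem mem_iSup_fam {ι : Sort*} {p : ι → Fam α} {N m : ℕ} {z : List α} :
    z ∈ (⨆ i, p i) N m ↔ ∃ i, z ∈ p i N m := by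
  simp only [iSup_apply, Language.mem_iSup]

/-! ### Exponents -/

/-- The exponents: any number of factors, at least one factor, boundedly many factors, and a number
of factors tending to infinity. -/
inductive Exp where
  | star | pos | bdd | unb

/-- Numbers of factors admitted by an exponent under given thresholds. -/
def Exp.adm : Exp → ℕ → ℕ → ℕ → Prop
  | .star, _, _, _ => True
  | .pos, _, _, k => 1 ≤ k
  | .bdd, N, _, k => k ≤ N
  | .unb, _, m, k => m ≤ k

theorem Exp.adm.mono {x : Exp} {N N' m m' k : ℕ} (h : x.adm N m k) (hN : N ≤ N') (hm : m' ≤ m) :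
    x.adm N' m' k := by
  cases x
  · trivial
  · exact h
  · exact le_trans h hN
  · exact le_trans hm h

/-- The ways in which an exponent distributes over a sum of two numbers of factors. -/
inductive Exp.Splits : Exp → Exp → Exp → Prop
  | star : Splits .star .star .star
  | bdd : Splits .bdd .bdd .bdd
  | pos_left : Splits .pos .pos .star
  | pos_right : Splits .pos .star .pos
  | unb_left : Splits .unb .unb .star
  | unb_right : Splits .unb .star .unb

/-- If a sum is at least `m`, one of the two summands is at least `m / 2`; the other one is then
left free. -/
theorem Exp.adm.split {x : Exp} {N m i j : ℕ} (h : x.adm N m (i + j)) :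
    ∃ x1 x2, x.Splits x1 x2 ∧ x1.adm N (m / 2) i ∧ x2.adm N (m / 2) j := by
  cases x <;> simp only [Exp.adm] at h
  · exact ⟨_, _, .star, trivial, trivial⟩
  · rcases (by omega : 1 ≤ i ∨ 1 ≤ j) with h | h
    · exact ⟨_, _, .pos_left, h, trivial⟩
    · exact ⟨_, _, .pos_right, trivial, h⟩
  · exact ⟨_, _, .bdd, by simp only [Exp.adm]; omega, by simp only [Exp.adm]; omega⟩
  · rcases (by omega : m / 2 ≤ i ∨ m / 2 ≤ j) with h | h
    · exact ⟨_, _, .unb_left, h, trivial⟩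
    · exact ⟨_, _, .unb_right, trivial, h⟩

/-- The optional summand `c` counts the factor that a cut goes through, whence `2 * N + 1`. -/
theorem Exp.Splits.adm_add {x x1 x2 : Exp} (h : x.Splits x1 x2) {N m i j : ℕ}
    (hi : x1.adm N m i) (hj : x2.adm N m j) (c : ℕ) (hc : c ≤ 1) :
    x.adm (2 * N + 1) m (i + c + j) := by
  cases h <;> simp only [Exp.adm] at * <;> omega

/-- Concatenations of an admissible number of factors. -/
def Fam.pw (q : Fam α) (x : Exp) : Fam α := fun N m => {z | ∃ k, x.adm N m k ∧ z ∈ q N m ^ k}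

theorem Fam.Mono.pw {q : Fam α} (h : q.Mono) (x : Exp) : (q.pw x).Mono := by
  rintro N N' m m' h1 h2 z ⟨k, hk, hz⟩
  exact ⟨k, hk.mono h1 h2, pow_le_pow_left' (h h1 h2) k hz⟩

theorem Dom.pw {q q' : Fam α} (h : Dom q q') (x : Exp) : Dom (q.pw x) (q'.pw x) := by
  intro N
  filter_upwards [h N, Par.eventually_id N] with p h1 h2 m
  rintro z ⟨k, hk, hz⟩
  exact ⟨k, hk.mono h2.1 (h2.2 m), pow_le_pow_left' (h1 m) k hz⟩

theorem dom_pw_mul_pw {q : Fam α} (hq : q.Mono) {x x1 x2 : Exp} (h : x.Splits x1 x2) :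
    Dom (q.pw x1 * q.pw x2) (q.pw x) := by
  refine Dom.of_le (hq.pw x) fun N => ⟨2 * N + 1, id, tendsto_id, fun m => ?_⟩
  rintro z ⟨u, ⟨i, hi, hu⟩, v, ⟨j, hj, hv⟩, rfl⟩
  refine ⟨i + 0 + j, h.adm_add hi hj 0 (by omega), ?_⟩
  rw [Nat.add_zero, pow_add]
  exact Language.append_mem_mul (pow_le_pow_left' (hq (by omega) le_rfl) i hu)
    (pow_le_pow_left' (hq (by omega) le_rfl) j hv)

theorem dom_pw_mul_self_mul_pw {q : Fam α} (hq : q.Mono) {x x1 x2 : Exp} (h : x.Splits x1 x2) :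
    Dom (q.pw x1 * (q * q.pw x2)) (q.pw x) := by
  refine Dom.of_le (hq.pw x) fun N => ⟨2 * N + 1, id, tendsto_id, fun m => ?_⟩
  rintro z ⟨u, ⟨i, hi, hu⟩, _, ⟨w, hw, v, ⟨j, hj, hv⟩, rfl⟩, rfl⟩
  refine ⟨i + 1 + j, h.adm_add hi hj 1 le_rfl, ?_⟩
  rw [add_assoc, pow_add, pow_add, pow_one]
  have hle : q N m ≤ q (2 * N + 1) m := hq (by omega) le_rfl
  exact Language.append_mem_mul (pow_le_pow_left' hle i hu)
    (Language.append_mem_mul (hle hw) (pow_le_pow_left' hle j hv))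

/-! ### Definable families -/

/-- The family of a `BS`-regular expression. -/
def BSExpr.fam : BSExpr α → Fam α
  | .empty => 0
  | .eps => 1
  | .finEps => fun _ m => if m = 0 then 1 else 0
  | .letter a => fun _ _ => {[a]}
  | .comp e f => e.fam * f.fam
  | .plus e f => e.fam + f.fam
  | .star e => e.fam.pw .star
  | .expB e => e.fam.pw .bdd
  | .expS e => e.fam.pw .unb

theorem mono_finEps : (BSExpr.finEps : BSExpr α).fam.Mono := by
  intro N N' m m' h1 h2
  simp only [BSExpr.fam]
  split_ifs with h h'
  · exact le_rfl
  · omega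
  · exact bot_le
  · exact le_rfl

theorem BSExpr.mono_fam : ∀ e : BSExpr α, e.fam.Mono
  | .empty => mono_zero
  | .eps => mono_one
  | .finEps => mono_finEps
  | .letter _ => mono_const _
  | .comp e f => e.mono_fam.mul f.mono_fam
  | .plus e f => e.mono_fam.add f.mono_fam
  | .star e => e.mono_fam.pw _
  | .expB e => e.mono_fam.pw _
  | .expS e => e.mono_fam.pw _

/-- The expression uses only the exponents permitted by `hB` and `hS`. -/
def BSExpr.Allowed (hB hS : Prop) (e : BSExpr α) : Prop := (hB ∨ e.AvoidsB) ∧ (hS ∨ e.AvoidsS)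

/-- The exponent is permitted by `hB` and `hS`. -/
def Exp.Ok (hB hS : Prop) : Exp → Prop
  | .star | .pos => True
  | .bdd => hB
  | .unb => hS

theorem Exp.Splits.ok {hB hS : Prop} {x x1 x2 : Exp} (h : x.Splits x1 x2) (hx : x.Ok hB hS) :
    x1.Ok hB hS ∧ x2.Ok hB hS := by
  cases h <;> simp_all [Exp.Ok]

theorem BSExpr.Allowed.comp {hB hS : Prop} {e f : BSExpr α} (h : e.Allowed hB hS)
    (h' : f.Allowed hB hS) : (BSExpr.comp e f).Allowed hB hS := by
  simp only [BSExpr.Allowed, BSExpr.AvoidsB, BSExpr.AvoidsS] at *; tauto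

theorem BSExpr.Allowed.plus {hB hS : Prop} {e f : BSExpr α} (h : e.Allowed hB hS)
    (h' : f.Allowed hB hS) : (BSExpr.plus e f).Allowed hB hS := by
  simp only [BSExpr.Allowed, BSExpr.AvoidsB, BSExpr.AvoidsS] at *; tauto

/-- The family is equivalent to that of a permitted expression. -/
def Definable (hB hS : Prop) (q : Fam α) : Prop :=
  q.Mono ∧ ∃ e : BSExpr α, e.Allowed hB hS ∧ Dom q e.fam ∧ Dom e.fam q

section Definable

variable {hB hS : Prop} {p q : Fam α}

theorem BSExpr.Allowed.definable {e : BSExpr α} (h : e.Allowed hB hS) : Definable hB hS e.fam :=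
  ⟨e.mono_fam, e, h, .refl e.mono_fam, .refl e.mono_fam⟩

theorem Definable.congr (h : Definable hB hS p) (hq : q.Mono) (h1 : Dom p q) (h2 : Dom q p) :
    Definable hB hS q := by
  obtain ⟨-, e, he, h3, h4⟩ := h
  exact ⟨hq, e, he, h2.trans h3 e.mono_fam, h4.trans h1 hq⟩

theorem definable_zero : Definable hB hS (0 : Fam α) :=
  BSExpr.Allowed.definable (e := .empty) ⟨.inr trivial, .inr trivial⟩

theorem definable_one : Definable hB hS (1 : Fam α) :=
  BSExpr.Allowed.definable (e := .eps) ⟨.inr trivial, .inr trivial⟩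

theorem Definable.mul (h : Definable hB hS p) (h' : Definable hB hS q) :
    Definable hB hS (p * q) := by
  obtain ⟨hp, e, he, h1, h2⟩ := h
  obtain ⟨hq, f, hf, h3, h4⟩ := h'
  exact ⟨hp.mul hq, .comp e f, he.comp hf, h1.mul h3, h2.mul h4⟩

theorem Dom.add {p q p' q' : Fam α} (h : Dom p p') (h' : Dom q q') : Dom (p + q) (p' + q') := by
  intro N
  filter_upwards [h N, h' N] with P h1 h2 m
  exact sup_le_sup (h1 m) (h2 m)

theorem Definable.add (h : Definable hB hS p) (h' : Definable hB hS q) :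
    Definable hB hS (p + q) := by
  obtain ⟨hp, e, he, h1, h2⟩ := h
  obtain ⟨hq, f, hf, h3, h4⟩ := h'
  exact ⟨hp.add hq, .plus e f, he.plus hf, h1.add h3, h2.add h4⟩

theorem pw_pos_eq (q : Fam α) : q.pw .pos = q * q.pw .star := by
  funext N m
  ext z
  constructor
  · rintro ⟨k, hk, hz⟩
    obtain ⟨k, rfl⟩ : ∃ j, k = j + 1 := ⟨k - 1, by simp only [Exp.adm] at hk; omega⟩
    rw [pow_succ'] at hz
    obtain ⟨u, hu, v, hv, rfl⟩ := hz
    exact ⟨u, hu, v, ⟨k, trivial, hv⟩, rfl⟩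
  · rintro ⟨u, hu, v, ⟨k, -, hv⟩, rfl⟩
    refine ⟨k + 1, by simp [Exp.adm], ?_⟩
    rw [pow_succ']
    exact ⟨u, hu, v, hv, rfl⟩

theorem Definable.pw (h : Definable hB hS q) {x : Exp} (hx : x.Ok hB hS) :
    Definable hB hS (q.pw x) := by
  have key : ∀ y : Exp, (∀ e : BSExpr α, e.Allowed hB hS → ∃ e' : BSExpr α,
      e'.Allowed hB hS ∧ e'.fam = e.fam.pw y) → Definable hB hS (q.pw y) := by
    intro y hy
    obtain ⟨hq, e, he, h1, h2⟩ := h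
    obtain ⟨e', he', h'⟩ := hy e he
    exact ⟨hq.pw y, e', he', h' ▸ h1.pw y, h' ▸ h2.pw y⟩
  have hstar : Definable hB hS (q.pw .star) := key .star fun e he => ⟨.star e, by
    simpa only [BSExpr.Allowed, BSExpr.AvoidsB, BSExpr.AvoidsS] using he, rfl⟩
  cases x with
  | star => exact hstar
  | pos => rw [pw_pos_eq]; exact h.mul hstar
  | bdd => exact key .bdd fun e he =>
    ⟨.expB e, ⟨.inl hx, by simpa only [BSExpr.AvoidsS] using he.2⟩, rfl⟩
  | unb => exact key .unb fun e he =>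
    ⟨.expS e, ⟨by simpa only [BSExpr.AvoidsB] using he.1, .inl hx⟩, rfl⟩

theorem Definable.iSup {ι : Type*} [Finite ι] {p : ι → Fam α} (h : ∀ i, Definable hB hS (p i)) :
    Definable hB hS (⨆ i, p i) := by
  have key : ∀ s : Set ι, s.Finite → Definable hB hS (⨆ i ∈ s, p i) := by
    intro s hs
    induction s, hs using Set.Finite.induction_on with
    | empty => simpa using! definable_zero
    | @insert a s _ _ ih =>
      rw [iSup_insert]
      exact (h a).add ih
  simpa using key Set.univ Set.finite_univ

theorem Definable.iSup_prop {c : Prop} (h : c → Definable hB hS p) :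
    Definable hB hS (⨆ _ : c, p) := by
  by_cases hc : c
  · simpa [hc] using h hc
  · simpa [hc] using! definable_zero

theorem Definable.iSup_mem {ι : Type*} {s : Set ι} (hs : s.Finite) {p : ι → Fam α}
    (h : ∀ i ∈ s, Definable hB hS (p i)) : Definable hB hS (⨆ i ∈ s, p i) := by
  have := hs.to_subtype
  rw [iSup_subtype']
  exact Definable.iSup fun i => h i i.2

theorem definable_word (x : List α) : Definable hB hS (fun _ _ => ({x} : Language α)) := by
  induction x with
  | nil => exact definable_one
  | cons a x ih =>
    have h := (BSExpr.Allowed.definable (hB := hB) (hS := hS) (e := .letter a)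
      ⟨.inr trivial, .inr trivial⟩).mul ih
    have h1 : ({a :: x} : Language α) = {[a]} * {x} := by
      ext z
      simp only [Language.mem_mul]
      constructor
      · rintro rfl; exact ⟨[a], rfl, x, rfl, rfl⟩
      · rintro ⟨_, rfl, _, rfl, rfl⟩; rfl
    rw [h1]
    exact h

/-- Only the set of thresholds at which `x` is present matters, and up to `Dom` there are three
possibilities: some `N` admits all `m`, which gives the word `x`; every `N` admits only boundedly
many `m`, but some `N` admits one, which gives `x` followed by `finEps`; no threshold is admitted,
which gives `∅`. -/
theorem definable_of_le_word (hq : q.Mono) (x : List α) (h : ∀ N m, q N m ≤ {x}) :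
    Definable hB hS q := by
  by_cases h1 : ∃ N, ∀ m, x ∈ q N m
  · obtain ⟨N, hN⟩ := h1
    refine (definable_word x).congr hq ?_ (Dom.of_le' (mono_const _) h)
    refine Dom.of_le hq fun _ => ⟨N, id, tendsto_id, fun m => ?_⟩
    rintro _ rfl
    exact hN _
  push Not at h1
  by_cases h2 : ∃ N, x ∈ q N 0
  · obtain ⟨N, hN⟩ := h2
    refine ((definable_word x).mul (BSExpr.Allowed.definable (e := .finEps)
      ⟨.inr trivial, .inr trivial⟩)).congr hq ?_ ?_
    · refine Dom.of_le hq fun _ => ⟨N, id, tendsto_id, fun m => ?_⟩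
      rintro _ ⟨_, rfl, v, hv, rfl⟩
      simp only [BSExpr.fam] at hv
      split_ifs at hv with h0
      · obtain rfl := hv
        subst h0
        change _ ++ [] ∈ q N 0
        rw [List.append_nil]
        exact hN
      · exact hv.elim
    · refine Dom.of_le ((mono_const _).mul mono_finEps) fun K => ?_
      obtain ⟨M, hM⟩ := h1 K
      -- Wherever `x` is present we have `m < M`, and there the lower threshold must drop to 0, the
      -- only one at which `finEps` has a word. From `M` on it only has to tend to infinity.
      refine ⟨0, fun m => if m < M then 0 else m, ?_, fun m z hz => ?_⟩
      · rw [tendsto_atTop]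
        intro b
        filter_upwards [eventually_ge_atTop (max b M)] with m hm
        rw [if_neg (by omega)]
        omega
      · obtain rfl := h K m hz
        have : m < M := by
          by_contra hlt
          exact hM (hq le_rfl (not_lt.1 hlt) hz)
        refine ⟨z, rfl, [], ?_, by simp⟩
        simp only [BSExpr.fam, this, if_true]
        rfl
  · push Not at h2
    refine definable_zero.congr hq (Dom.of_le' hq fun _ _ => bot_le) (Dom.of_le' mono_zero fun N m z hz => ?_)
    obtain rfl := h N m hz
    exact (h2 N (hq le_rfl (Nat.zero_le m) hz)).elim

end Definable

/-! ### Cutting words into two pieces -/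

/-- Cutting a word of `q` into two pieces yields, up to a change of thresholds, words of two
families related by `P`, and conversely. -/
structure IsSplit (q : Fam α) (P : Fam α → Fam α → Prop) : Prop where
  sound : ∀ l r, P l r → Dom (l * r) q
  complete : ∀ N, ∀ᶠ p : Par in atTop, ∀ m u v, u ++ v ∈ q N m →
    ∃ l r, P l r ∧ u ∈ l p.N (p.φ m) ∧ v ∈ r p.N (p.φ m)

theorem IsSplit.mul {q q' : Fam α} {P P' : Fam α → Fam α → Prop} (hq : q.Mono) (hq' : q'.Mono)
    (h : IsSplit q P) (h' : IsSplit q' P') :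
    IsSplit (q * q') fun l r => (∃ r0, P l r0 ∧ r = r0 * q') ∨ ∃ l0, P' l0 r ∧ l = q * l0 where
  sound := by
    rintro l r (⟨r0, hP, rfl⟩ | ⟨l0, hP, rfl⟩)
    · rw [← mul_assoc]
      exact (h.sound _ _ hP).mul (.refl hq')
    · rw [mul_assoc]
      exact (Dom.refl hq).mul (h'.sound _ _ hP)
  complete := by
    intro N
    filter_upwards [h.complete N, h'.complete N, Par.eventually_id N] with p h1 h2 h3 m u v huv
    obtain ⟨y, hy, z, hz, hyz⟩ := huv
    obtain ⟨c, hc1, hc2⟩ | ⟨c, hc1, hc2⟩ := List.append_eq_append_iff.1 hyz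
    · obtain ⟨l, r, hP, hl, hr⟩ := h2 m c v (hc2 ▸ hz)
      exact ⟨q * l, r, .inr ⟨l, hP, rfl⟩, ⟨y, hq h3.1 (h3.2 m) hy, c, hl, hc1.symm⟩, hr⟩
    · obtain ⟨l, r, hP, hl, hr⟩ := h1 m u c (hc1 ▸ hy)
      exact ⟨l, r * q', .inl ⟨r, hP, rfl⟩, hl, ⟨c, hr, z, hq' h3.1 (h3.2 m) hz, hc2.symm⟩⟩

theorem IsSplit.add {q q' : Fam α} {P P' : Fam α → Fam α → Prop} (hq : q.Mono) (hq' : q'.Mono)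
    (h : IsSplit q P) (h' : IsSplit q' P') :
    IsSplit (q + q') fun l r => P l r ∨ P' l r where
  sound := by
    rintro l r (hP | hP)
    · exact (h.sound _ _ hP).trans (Dom.of_le' (hq.add hq') fun _ _ => le_sup_left) (hq.add hq')
    · exact (h'.sound _ _ hP).trans (Dom.of_le' (hq.add hq') fun _ _ => le_sup_right) (hq.add hq')
  complete := by
    intro N
    filter_upwards [h.complete N, h'.complete N] with p h1 h2 m u v huv
    rcases huv with huv | huv
    · obtain ⟨l, r, hP, h⟩ := h1 m u v huv
      exact ⟨l, r, .inl hP, h⟩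
    · obtain ⟨l, r, hP, h⟩ := h2 m u v huv
      exact ⟨l, r, .inr hP, h⟩

/-- A cut between two factors counts as a cut through one of them with an empty piece, so the
absence of factors is the only exceptional case. -/
theorem append_mem_pow {L : Language α} {k : ℕ} {u v : List α} (h : u ++ v ∈ L ^ k) :
    (u = [] ∧ v = [] ∧ k = 0) ∨ ∃ i j u0 s t v0, i + 1 + j = k ∧ u = u0 ++ s ∧ v = t ++ v0 ∧
      u0 ∈ L ^ i ∧ s ++ t ∈ L ∧ v0 ∈ L ^ j := by
  induction k generalizing u with
  | zero =>
    rw [pow_zero] at h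
    obtain ⟨rfl, rfl⟩ := List.append_eq_nil_iff.1 h
    exact .inl ⟨rfl, rfl, rfl⟩
  | succ k ih =>
    right
    rw [pow_succ'] at h
    obtain ⟨y, hy, w, hw, hyw⟩ := h
    obtain ⟨c, rfl, hc2⟩ | ⟨c, rfl, rfl⟩ := List.append_eq_append_iff.1 hyw
    · change w = c ++ v at hc2
      subst hc2
      rcases ih hw with ⟨rfl, rfl, rfl⟩ | ⟨i, j, u0, s, t, v0, rfl, rfl, rfl, h1, h2, h3⟩
      · refine ⟨0, 0, [], y, [], [], rfl, ?_, rfl, by rw [pow_zero]; rfl, ?_, by rw [pow_zero]; rfl⟩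
        · simp
        · rw [List.append_nil]; exact hy
      · refine ⟨i + 1, j, y ++ u0, s, t, v0, by omega, by simp, rfl, ?_, h2, h3⟩
        rw [pow_succ']
        exact Language.append_mem_mul hy h1
    · exact ⟨0, k, [], u, c, w, by omega, rfl, rfl, by rw [pow_zero]; rfl, hy, hw⟩

/-- The cut goes through one factor and the exponent is distributed over the factors on its two
sides. The alternative without a cut factor serves the empty product. The exponent `pos` is excluded
because its only factor may be the one that is cut, which leaves none on either side. -/
theorem IsSplit.pw {q : Fam α} {P : Fam α → Fam α → Prop} (hq : q.Mono)
    (h : IsSplit q P) {x : Exp} (hx : x ≠ .pos) :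
    IsSplit (q.pw x) fun l r => ∃ x1 x2, x.Splits x1 x2 ∧ ((l = q.pw x1 ∧ r = q.pw x2) ∨
      ∃ l0 r0, P l0 r0 ∧ l = q.pw x1 * l0 ∧ r = r0 * q.pw x2) where
  sound := by
    rintro l r ⟨x1, x2, hs, ⟨rfl, rfl⟩ | ⟨l0, r0, hP, rfl, rfl⟩⟩
    · exact dom_pw_mul_pw hq hs
    · rw [mul_assoc, ← mul_assoc l0]
      exact ((Dom.refl (hq.pw x1)).mul ((h.sound _ _ hP).mul (.refl (hq.pw x2)))).trans
        (dom_pw_mul_self_mul_pw hq hs) (hq.pw x)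
  complete := by
    intro N
    -- One factor is lost to the cut, and the better of the two sides keeps half of the rest.
    have hψ : Tendsto (fun m => (m - 1) / 2) atTop atTop := by
      rw [tendsto_atTop]
      intro b
      filter_upwards [eventually_ge_atTop (2 * b + 1)] with m hm
      omega
    filter_upwards [h.complete N, Par.eventually_id N, Par.eventually_le N hψ]
      with p h1 h2 h3 m u v huv
    obtain ⟨k, hk, hz⟩ := huv
    have hle : q N m ≤ q p.N (p.φ m) := hq h2.1 (h2.2 m)
    rcases append_mem_pow hz with ⟨rfl, rfl, rfl⟩ | ⟨i, j, u0, s, t, v0, rfl, rfl, rfl, g1, g2, g3⟩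
    · obtain ⟨x1, x2, hs, a1, a2⟩ := Exp.adm.split (i := 0) (j := 0) hk
      have h4 : p.φ m ≤ m / 2 := (h3.2 m).trans (by omega)
      exact ⟨_, _, ⟨x1, x2, hs, .inl ⟨rfl, rfl⟩⟩, ⟨0, a1.mono h2.1 h4, by rw [pow_zero]; rfl⟩,
        ⟨0, a2.mono h2.1 h4, by rw [pow_zero]; rfl⟩⟩
    · have hk' : x.adm N (m - 1) (i + j) := by
        cases x <;> simp only [Exp.adm] at * <;> first | omega | exact (hx rfl).elim
      obtain ⟨x1, x2, hs, a1, a2⟩ := hk'.split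
      obtain ⟨l0, r0, hP, hl, hr⟩ := h1 m s t g2
      exact ⟨_, _, ⟨x1, x2, hs, .inr ⟨l0, r0, hP, rfl, rfl⟩⟩,
        Language.append_mem_mul ⟨i, a1.mono h2.1 (h3.2 m), pow_le_pow_left' hle i g1⟩ hl,
        Language.append_mem_mul hr ⟨j, a2.mono h2.1 (h3.2 m), pow_le_pow_left' hle j g3⟩⟩

/-! ### Finite sets of families closed under cutting -/

/-- A finite set of families such that cutting a word of one of them yields words of members. -/
structure SplitClosed (F : Set (Fam α)) : Prop where
  finite : F.Finite
  one_mem : 1 ∈ F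
  mono : ∀ q ∈ F, q.Mono
  split : ∀ q ∈ F, ∃ P, IsSplit q P ∧ ∀ l r, P l r → l ∈ F ∧ r ∈ F

/-- Members of `F` and products of such with a power of `q` in between. -/
def facPw (F : Set (Fam α)) (q : Fam α) (x : Exp) : Set (Fam α) :=
  F ∪ {t | ∃ a ∈ F, ∃ y, (y = .star ∨ y = x) ∧ ∃ b ∈ F, t = a * (q.pw y * b)}

/-- The families of the pieces of words of an expression. -/
def BSExpr.fac : BSExpr α → Set (Fam α)
  | .empty => {0, 1}
  | .eps => {1}
  | .finEps => {BSExpr.finEps.fam, 1}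
  | .letter a => {(BSExpr.letter a).fam, 1}
  | .comp e f => Set.image2 (· * ·) e.fac f.fac
  | .plus e f => insert (e.fam + f.fam) (e.fac ∪ f.fac)
  | .star e => facPw e.fac e.fam .star
  | .expB e => facPw e.fac e.fam .bdd
  | .expS e => facPw e.fac e.fam .unb

theorem isSplit_const (L : Language α) (P : Fam α → Fam α → Prop)
    (h : ∀ l r, P l r → ∀ N m, l N m * r N m ≤ L)
    (h' : ∀ u v, u ++ v ∈ L → ∃ l r, P l r ∧ ∀ N m, u ∈ l N m ∧ v ∈ r N m) :
    IsSplit (fun _ _ => L) P where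
  sound l r hP := Dom.of_le' (mono_const _) (h l r hP)
  complete N := Eventually.of_forall fun p m u v huv => by
    obtain ⟨l, r, hP, h⟩ := h' u v huv
    exact ⟨l, r, hP, h _ _⟩

theorem isSplit_one : IsSplit (1 : Fam α) fun l r => l = 1 ∧ r = 1 := by
  refine isSplit_const _ _ ?_ ?_
  · rintro _ _ ⟨rfl, rfl⟩ N m
    exact le_of_eq (one_mul _)
  · intro u v h
    obtain ⟨rfl, rfl⟩ := List.append_eq_nil_iff.1 h
    exact ⟨1, 1, ⟨rfl, rfl⟩, fun _ _ => ⟨rfl, rfl⟩⟩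

theorem isSplit_zero : IsSplit (0 : Fam α) fun _ _ => False :=
  isSplit_const _ _ (fun _ _ h => h.elim) fun _ _ h => (Language.notMem_zero _ h).elim

theorem isSplit_letter (a : α) : IsSplit (BSExpr.letter a).fam
    fun l r => (l = 1 ∧ r = (BSExpr.letter a).fam) ∨ (l = (BSExpr.letter a).fam ∧ r = 1) := by
  refine isSplit_const _ _ ?_ ?_
  · rintro _ _ (⟨rfl, rfl⟩ | ⟨rfl, rfl⟩) N m
    · exact le_of_eq (one_mul _)
    · exact le_of_eq (mul_one _)
  · intro u v h
    obtain ⟨rfl, rfl⟩ | ⟨rfl, rfl⟩ := List.append_eq_singleton_iff.1 h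
    · exact ⟨1, _, .inl ⟨rfl, rfl⟩, fun _ _ => ⟨rfl, rfl⟩⟩
    · exact ⟨_, 1, .inr ⟨rfl, rfl⟩, fun _ _ => ⟨rfl, rfl⟩⟩

theorem isSplit_finEps : IsSplit (BSExpr.finEps : BSExpr α).fam
    fun l r => l = BSExpr.finEps.fam ∧ r = BSExpr.finEps.fam where
  sound := by
    rintro _ _ ⟨rfl, rfl⟩
    refine Dom.of_le' mono_finEps fun N m => ?_
    simp only [BSExpr.fam, Pi.mul_apply]
    split_ifs
    · exact le_of_eq (one_mul _)
    · exact le_of_eq (zero_mul _)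
  complete := by
    intro N
    filter_upwards [Par.eventually_id N] with p hp m u v huv
    refine ⟨_, _, ⟨rfl, rfl⟩, ?_⟩
    simp only [BSExpr.fam] at huv ⊢
    split_ifs at huv with hm
    · obtain ⟨rfl, rfl⟩ := List.append_eq_nil_iff.1 huv
      have := hp.2 m
      rw [if_pos (by omega)]
      exact ⟨rfl, rfl⟩
    · exact (Language.notMem_zero _ huv).elim

/-- A cut inside the power leaves powers with exponent `x` or `star` only, and the two pieces of the
cut factor take the places of the outer members `a` and `b`. Hence repeated cutting never leaves
this finite set. -/
theorem SplitClosed.facPw {F : Set (Fam α)} (h : SplitClosed F) {q : Fam α} (hq : q ∈ F) {x : Exp}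
    (hx : x ≠ .pos) : SplitClosed (facPw F q x) where
  finite := by
    refine h.finite.union ((((h.finite.prod (Set.finite_insert.2 (Set.finite_singleton x) :
      ({.star, x} : Set Exp).Finite)).prod h.finite).image
      fun t => t.1.1 * (q.pw t.1.2 * t.2)).subset ?_)
    rintro _ ⟨a, ha, y, hy, b, hb, rfl⟩
    exact ⟨((a, y), b), ⟨⟨ha, hy⟩, hb⟩, rfl⟩
  one_mem := .inl h.one_mem
  mono := by
    rintro _ (hm | ⟨a, ha, y, hy, b, hb, rfl⟩)
    · exact h.mono _ hm
    · exact (h.mono _ ha).mul (((h.mono _ hq).pw _).mul (h.mono _ hb))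
  split := by
    rintro _ (hm | ⟨a, ha, y, hy, b, hb, rfl⟩)
    · obtain ⟨P, hP, hF⟩ := h.split _ hm
      exact ⟨P, hP, fun l r hlr => ⟨.inl (hF l r hlr).1, .inl (hF l r hlr).2⟩⟩
    · obtain ⟨P, hP, hF⟩ := h.split _ ha
      obtain ⟨P', hP', hF'⟩ := h.split _ hb
      obtain ⟨Q, hQ, hFQ⟩ := h.split _ hq
      have hmq := (h.mono _ hq).pw y
      have hy' : y ≠ .pos := by
        rintro rfl
        obtain h | h := hy
        · cases h
        · exact hx h.symm
      refine ⟨_, hP.mul (h.mono _ ha) (hmq.mul (h.mono _ hb))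
        ((hQ.pw (h.mono _ hq) hy').mul hmq (h.mono _ hb) hP'), ?_⟩
      have key : ∀ x1 x2, y.Splits x1 x2 → (x1 = .star ∨ x1 = x) ∧ (x2 = .star ∨ x2 = x) := by
        intro x1 x2 hs
        rcases hy with rfl | rfl <;> cases hs <;> simp
      rintro l r (⟨r0, hlr, rfl⟩ | ⟨l0, ⟨r0, ⟨x1, x2, hs, ⟨rfl, rfl⟩ |
        ⟨l1, r1, hlr, rfl, rfl⟩⟩, rfl⟩ | ⟨l1, hlr, rfl⟩, rfl⟩)
      · exact ⟨.inl (hF _ _ hlr).1, .inr ⟨r0, (hF _ _ hlr).2, y, hy, b, hb, rfl⟩⟩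
      · exact ⟨.inr ⟨a, ha, x1, (key _ _ hs).1, 1, h.one_mem, by rw [mul_one]⟩,
          .inr ⟨1, h.one_mem, x2, (key _ _ hs).2, b, hb, by rw [one_mul]⟩⟩
      · exact ⟨.inr ⟨a, ha, x1, (key _ _ hs).1, l1, (hFQ _ _ hlr).1, rfl⟩,
          .inr ⟨r1, (hFQ _ _ hlr).2, x2, (key _ _ hs).2, b, hb, by rw [mul_assoc]⟩⟩
      · exact ⟨.inr ⟨a, ha, y, hy, l1, (hF' _ _ hlr).1, rfl⟩, .inl (hF' _ _ hlr).2⟩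

theorem BSExpr.fac_spec (e : BSExpr α) : SplitClosed e.fac ∧ e.fam ∈ e.fac := by
  have pair : ∀ (q : Fam α) P, q.Mono → IsSplit q P →
      (∀ l r, P l r → (l = q ∨ l = 1) ∧ (r = q ∨ r = 1)) → SplitClosed {q, 1} := by
    intro q P hq h h'
    refine ⟨by simp, by simp, ?_, ?_⟩
    · rintro _ (rfl | rfl)
      exacts [hq, mono_one]
    · rintro _ (rfl | rfl)
      · exact ⟨P, h, h'⟩
      · exact ⟨_, isSplit_one, fun l r hlr => ⟨.inr hlr.1, .inr hlr.2⟩⟩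
  have pow : ∀ (e : BSExpr α) (x : Exp), x ≠ .pos → SplitClosed e.fac ∧ e.fam ∈ e.fac →
      SplitClosed (facPw e.fac e.fam x) ∧ e.fam.pw x ∈ facPw e.fac e.fam x := fun e x hx h =>
    ⟨h.1.facPw h.2 hx, .inr ⟨1, h.1.one_mem, x, .inr rfl, 1, h.1.one_mem, by simp⟩⟩
  induction e with
  | empty => exact ⟨pair _ _ mono_zero isSplit_zero (by simp), .inl rfl⟩
  | eps =>
    refine ⟨?_, rfl⟩
    have := pair _ _ (mono_one (α := α)) isSplit_one (by simp +contextual)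
    rw [Set.pair_eq_singleton] at this
    exact this
  | finEps => exact ⟨pair _ _ mono_finEps isSplit_finEps (by simp +contextual), .inl rfl⟩
  | letter a =>
    refine ⟨pair _ _ (mono_const _) (isSplit_letter a) ?_, .inl rfl⟩
    rintro l r (⟨rfl, rfl⟩ | ⟨rfl, rfl⟩) <;> simp
  | comp e f he hf =>
    refine ⟨⟨he.1.finite.image2 _ hf.1.finite, ⟨1, he.1.one_mem, 1, hf.1.one_mem, one_mul _⟩,
      ?_, ?_⟩, ⟨_, he.2, _, hf.2, rfl⟩⟩
    · rintro _ ⟨a, ha, b, hb, rfl⟩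
      exact (he.1.mono _ ha).mul (hf.1.mono _ hb)
    · rintro _ ⟨a, ha, b, hb, rfl⟩
      obtain ⟨P, hP, hF⟩ := he.1.split _ ha
      obtain ⟨P', hP', hF'⟩ := hf.1.split _ hb
      refine ⟨_, hP.mul (he.1.mono _ ha) (hf.1.mono _ hb) hP', ?_⟩
      rintro l r (⟨r0, hlr, rfl⟩ | ⟨l0, hlr, rfl⟩)
      · exact ⟨⟨l, (hF _ _ hlr).1, 1, hf.1.one_mem, mul_one _⟩, ⟨r0, (hF _ _ hlr).2, b, hb, rfl⟩⟩
      · exact ⟨⟨a, ha, l0, (hF' _ _ hlr).1, rfl⟩, ⟨1, he.1.one_mem, r, (hF' _ _ hlr).2, one_mul _⟩⟩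
  | plus e f he hf =>
    refine ⟨⟨(he.1.finite.union hf.1.finite).insert _, .inr (.inl he.1.one_mem), ?_, ?_⟩, .inl rfl⟩
    · rintro _ (rfl | ha | ha)
      exacts [e.mono_fam.add f.mono_fam, he.1.mono _ ha, hf.1.mono _ ha]
    · rintro _ (rfl | ha | ha)
      · obtain ⟨P, hP, hF⟩ := he.1.split _ he.2
        obtain ⟨P', hP', hF'⟩ := hf.1.split _ hf.2
        refine ⟨_, hP.add e.mono_fam f.mono_fam hP', ?_⟩
        rintro l r (h | h)
        · exact ⟨.inr (.inl (hF _ _ h).1), .inr (.inl (hF _ _ h).2)⟩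
        · exact ⟨.inr (.inr (hF' _ _ h).1), .inr (.inr (hF' _ _ h).2)⟩
      · obtain ⟨P, hP, hF⟩ := he.1.split _ ha
        exact ⟨P, hP, fun l r h => ⟨.inr (.inl (hF _ _ h).1), .inr (.inl (hF _ _ h).2)⟩⟩
      · obtain ⟨P, hP, hF⟩ := hf.1.split _ ha
        exact ⟨P, hP, fun l r h => ⟨.inr (.inr (hF _ _ h).1), .inr (.inr (hF _ _ h).2)⟩⟩
  | star e he => exact pow e _ (by simp) he
  | expB e he => exact pow e _ (by simp) he
  | expS e he => exact pow e _ (by simp) he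

theorem SplitClosed.complete {F : Set (Fam α)} (h : SplitClosed F) (N : ℕ) :
    ∀ᶠ p : Par in atTop, ∀ q ∈ F, ∀ m u v, u ++ v ∈ q N m → ∃ l ∈ F, ∃ r ∈ F, Dom (l * r) q ∧
      u ∈ l p.N (p.φ m) ∧ v ∈ r p.N (p.φ m) := by
  refine (eventually_all_finite h.finite).2 fun q hq => ?_
  obtain ⟨P, hP, hF⟩ := h.split q hq
  filter_upwards [hP.complete N] with p hp m u v huv
  obtain ⟨l, r, hlr, h1, h2⟩ := hp m u v huv
  exact ⟨l, (hF l r hlr).1, r, (hF l r hlr).2, hP.sound l r hlr, h1, h2⟩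

/-- Two successive cuts; the second one is made at the thresholds produced by the first, so the
changes are composed. -/
theorem SplitClosed.complete₃ {F : Set (Fam α)} (h : SplitClosed F) (N : ℕ) :
    ∀ᶠ p : Par in atTop, ∀ q ∈ F, ∀ m u v w, u ++ (v ++ w) ∈ q N m →
      ∃ l ∈ F, ∃ c ∈ F, ∃ r ∈ F, Dom (l * (c * r)) q ∧
        u ∈ l p.N (p.φ m) ∧ v ∈ c p.N (p.φ m) ∧ w ∈ r p.N (p.φ m) := by
  obtain ⟨p1, hp1⟩ := (h.complete N).exists
  obtain ⟨p2, hp2, hp2'⟩ := ((h.complete p1.N).and (Par.eventually_id p1.N)).exists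
  filter_upwards [Par.eventually_le p2.N (p2.tendsto.comp p1.tendsto)] with p hp q hq m u v w huvw
  obtain ⟨l, hl, t, ht, hlt, hu, hvw⟩ := hp1 q hq m _ _ huvw
  obtain ⟨c, hc, r, hr, hcr, hv, hw⟩ := hp2 t ht _ _ _ hvw
  refine ⟨l, hl, c, hc, r, hr, ((Dom.refl (h.mono _ hl)).mul hcr).trans hlt (h.mono _ hq),
    h.mono l hl (hp2'.1.trans hp.1) ((hp.2 m).trans (hp2'.2 _)) hu, h.mono c hc hp.1 (hp.2 m) hv,
    h.mono r hr hp.1 (hp.2 m) hw⟩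

/-- The boundary between `q` and `q'` cuts the word of `p` into pieces from `F`. So the intersection
is the finite sum of `(q ⊓ l) * (q' ⊓ r)` over the pairs in `F` with `l * r` dominated by `p`. -/
theorem SplitClosed.definable_mul_inf {hB hS : Prop} {F : Set (Fam α)} (h : SplitClosed F)
    {p q q' : Fam α} (hp : p ∈ F) (hq : q.Mono) (hq' : q'.Mono)
    (h1 : ∀ l ∈ F, Definable hB hS (q ⊓ l)) (h2 : ∀ l ∈ F, Definable hB hS (q' ⊓ l)) :
    Definable hB hS ((q * q') ⊓ p) := by
  have hm : ((q * q') ⊓ p).Mono := (hq.mul hq').inf (h.mono _ hp)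
  refine (Definable.iSup_mem h.finite fun l hl => Definable.iSup_mem h.finite fun r hr =>
    Definable.iSup_prop (c := Dom (l * r) p) fun _ => (h1 l hl).mul (h2 r hr)).congr hm ?_ ?_
  · have := h.finite.to_subtype
    rw [iSup_subtype']
    refine Dom.iSup_le fun l => ?_
    rw [iSup_subtype']
    refine Dom.iSup_le fun r => ?_
    by_cases hlr : Dom (l.1 * r.1) p
    · simp only [hlr, iSup_pos]
      intro N
      filter_upwards [hlr N, Par.eventually_id N] with P g1 g2 m
      rintro _ ⟨u, hu, v, hv, rfl⟩
      exact ⟨Language.append_mem_mul (hq g2.1 (g2.2 m) hu.1) (hq' g2.1 (g2.2 m) hv.1),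
        g1 m (Language.append_mem_mul hu.2 hv.2)⟩
    · simp only [hlr, iSup_false]
      exact Dom.of_le' hm fun _ _ => bot_le
  · intro N
    filter_upwards [h.complete N, Par.eventually_id N] with P g1 g2 m
    rintro _ ⟨⟨u, hu, v, hv, rfl⟩, hz⟩
    obtain ⟨l, hl, r, hr, hlr, g3, g4⟩ := g1 p hp m u v hz
    exact mem_iSup_fam.2 ⟨l, mem_iSup_fam.2 ⟨hl, mem_iSup_fam.2 ⟨r, mem_iSup_fam.2 ⟨hr,
      mem_iSup_fam.2 ⟨hlr, u, ⟨hq g2.1 (g2.2 m) hu, g3⟩, v, ⟨hq' g2.1 (g2.2 m) hv, g4⟩, rfl⟩⟩⟩⟩⟩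

/-! ### Substituting families for letters -/

section Subst

variable {T : Type*} {hB hS : Prop}

/-- The words obtained from a word of `R` with an admissible number of letters by replacing every
letter with a word of its family. -/
def subst (x : Exp) (R : Language T) (A : T → Fam α) : Fam α := fun N m =>
  {z | ∃ t ∈ R, x.adm N m t.length ∧ z ∈ (t.map fun i => A i N m).prod}

theorem prod_map_mono {f g : T → Language α} (h : ∀ i, f i ≤ g i) (t : List T) :
    (t.map f).prod ≤ (t.map g).prod := by
  induction t with
  | nil => exact le_rfl
  | cons i t ih =>
    simp only [List.map_cons, List.prod_cons]
    exact mul_le_mul' (h i) ih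

theorem mono_subst {A : T → Fam α} (hA : ∀ t, (A t).Mono) (x : Exp) (R : Language T) :
    (subst x R A).Mono := by
  rintro N N' m m' h1 h2 z ⟨t, ht, ha, hz⟩
  exact ⟨t, ht, ha.mono h1 h2, prod_map_mono (fun i => hA i h1 h2) t hz⟩

/-- The relation `Q` carries whatever comparison between the number `k` of blocks and the number of
letters follows from the constraint `P` on every block. -/
theorem exists_of_mem_pow {R : Language T} {B : T → Language α} {L : Language α} {P : ℕ → Prop}
    {Q : ℕ → ℕ → Prop} (hL : ∀ z ∈ L, ∃ t ∈ R, P t.length ∧ z ∈ (t.map B).prod) (h0 : Q 0 0)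
    (hs : ∀ i k n, P i → Q k n → Q (k + 1) (i + n)) {k : ℕ} {z : List α} (hz : z ∈ L ^ k) :
    ∃ t ∈ R∗, Q k t.length ∧ z ∈ (t.map B).prod := by
  induction k generalizing z with
  | zero =>
    rw [pow_zero] at hz
    exact ⟨[], Language.nil_mem_kstar R, h0, hz⟩
  | succ k ih =>
    rw [pow_succ'] at hz
    obtain ⟨u, hu, v, hv, rfl⟩ := hz
    obtain ⟨t, ht, hP, htu⟩ := hL u hu
    obtain ⟨s, hs', hQ, hsv⟩ := ih hv
    refine ⟨t ++ s, ?_, ?_, ?_⟩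
    · have : R * R∗ ≤ R∗ := mul_kstar_le_kstar
      exact this (Language.append_mem_mul ht hs')
    · rw [List.length_append]; exact hs _ _ _ hP hQ
    · rw [List.map_append, List.prod_append]
      exact Language.append_mem_mul htu hsv

theorem mem_pow_of_flatten {B : T → Language α} {L : Language α} {S : List (List T)}
    (h : ∀ y ∈ S, (y.map B).prod ≤ L) : (S.flatten.map B).prod ≤ L ^ S.length := by
  induction S with
  | nil => exact le_rfl
  | cons y S ih =>
    simp only [List.flatten_cons, List.map_append, List.prod_append, List.length_cons, pow_succ']
    exact mul_le_mul' (h y (by simp)) (ih fun y hy => h y (by simp [hy]))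

/-- Used in contraposed form: among `m` letters there are at least `√m` blocks, or some block has at
least `√m` letters. -/
theorem length_flatten_lt {S : List (List T)} {n : ℕ} (hn : S.length < n)
    (h : ∀ y ∈ S, y.length < n) : S.flatten.length < n * n := by
  have : ∀ S : List (List T), (∀ y ∈ S, y.length < n) → S.flatten.length ≤ S.length * n := by
    intro S hS
    induction S with
    | nil => simp
    | cons y S ih =>
      have h1 := ih fun y hy => hS y (by simp [hy])
      have h2 := hS y (by simp)
      simp only [List.flatten_cons, List.length_append, List.length_cons, Nat.add_mul]
      omega
  exact (this S h).trans_lt (Nat.mul_lt_mul_of_pos_right hn (by omega))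

theorem length_le_length_flatten {S : List (List T)} (h : ∀ y ∈ S, y ≠ []) :
    S.length ≤ S.flatten.length := by
  induction S with
  | nil => simp
  | cons y S ih =>
    have h1 := ih fun y hy => h y (by simp [hy])
    have h2 := List.length_pos_of_ne_nil (h y (by simp))
    simp only [List.flatten_cons, List.length_append, List.length_cons]
    omega

theorem tendsto_sqrt : Tendsto Nat.sqrt atTop atTop := by
  rw [tendsto_atTop]
  intro b
  filter_upwards [eventually_ge_atTop (b * b)] with m hm using Nat.le_sqrt.2 hm

theorem subst_zero (x : Exp) (A : T → Fam α) : subst x 0 A = 0 := by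
  funext N m
  ext z
  exact ⟨fun ⟨_, h, _⟩ => h.elim, fun h => h.elim⟩

theorem subst_add (x : Exp) (R S : Language T) (A : T → Fam α) :
    subst x (R + S) A = subst x R A + subst x S A := by
  funext N m
  ext z
  constructor
  · rintro ⟨t, h | h, h'⟩
    exacts [.inl ⟨t, h, h'⟩, .inr ⟨t, h, h'⟩]
  · rintro (⟨t, h, h'⟩ | ⟨t, h, h'⟩)
    exacts [⟨t, .inl h, h'⟩, ⟨t, .inr h, h'⟩]

theorem definable_subst_one (x : Exp) {A : T → Fam α} (hA : ∀ t, (A t).Mono) :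
    Definable hB hS (subst x 1 A) := by
  refine definable_of_le_word (mono_subst hA _ _) [] ?_
  rintro N m z ⟨t, ht, -, hz⟩
  obtain rfl := ht
  exact hz

theorem definable_subst_char (x : Exp) {A : T → Fam α} (hA : ∀ t, Definable hB hS (A t)) (t : T) :
    Definable hB hS (subst x {[t]} A) := by
  -- The admissibility of a single letter depends on the thresholds; it is moved into a family below
  -- the empty word, multiplied to `A t`.
  have h1 : Definable hB hS (fun N m => ({z | z = [] ∧ x.adm N m 1} : Language α)) :=
    definable_of_le_word (fun N N' m m' h1 h2 z hz => ⟨hz.1, hz.2.mono h1 h2⟩) []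
      fun N m z hz => hz.1
  convert! (hA t).mul h1 using 1
  funext N m
  ext z
  constructor
  · rintro ⟨_, rfl, ha, hz⟩
    simp only [List.map_cons, List.map_nil, List.prod_cons, List.prod_nil, mul_one] at hz
    exact ⟨z, hz, [], ⟨rfl, ha⟩, List.append_nil z⟩
  · rintro ⟨z, hz, _, ⟨rfl, ha⟩, rfl⟩
    refine ⟨_, rfl, ha, ?_⟩
    simp only [List.map_cons, List.map_nil, List.prod_cons, List.prod_nil, mul_one]
    rw [List.append_nil]
    exact hz

instance : Finite Exp :=
  Finite.of_surjective (fun i : Fin 4 => ![Exp.star, .pos, .bdd, .unb] i) fun x => by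
    cases x
    exacts [⟨0, rfl⟩, ⟨1, rfl⟩, ⟨2, rfl⟩, ⟨3, rfl⟩]

/-- Lengths add up along a product, so this is the finite sum over the ways in which `x` splits. -/
theorem definable_subst_mul {x : Exp} (hx : x.Ok hB hS) {A : T → Fam α} (hA : ∀ t, (A t).Mono)
    {R S : Language T} (hR : ∀ y : Exp, y.Ok hB hS → Definable hB hS (subst y R A))
    (hS' : ∀ y : Exp, y.Ok hB hS → Definable hB hS (subst y S A)) :
    Definable hB hS (subst x (R * S) A) := by
  have hm := mono_subst hA x (R * S)
  refine (Definable.iSup fun x1 => Definable.iSup fun x2 => Definable.iSup_prop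
    (c := x.Splits x1 x2) fun hs => (hR x1 (hs.ok hx).1).mul (hS' x2 (hs.ok hx).2)).congr hm ?_ ?_
  · refine Dom.iSup_le fun x1 => Dom.iSup_le fun x2 => ?_
    by_cases hs : x.Splits x1 x2
    · simp only [hs, iSup_pos]
      refine Dom.of_le hm fun N => ⟨2 * N + 1, id, tendsto_id, fun m => ?_⟩
      rintro _ ⟨u, ⟨t, ht, ha, hu⟩, v, ⟨s, hs', ha', hv⟩, rfl⟩
      refine ⟨t ++ s, Language.append_mem_mul ht hs', ?_, ?_⟩
      · rw [List.length_append]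
        exact hs.adm_add ha ha' 0 (by omega)
      · rw [List.map_append, List.prod_append]
        exact Language.append_mem_mul (prod_map_mono (fun i => hA i (by omega) le_rfl) t hu)
          (prod_map_mono (fun i => hA i (by omega) le_rfl) s hv)
    · simp only [hs, iSup_false]
      exact Dom.of_le' hm fun _ _ => bot_le
  · refine Dom.of_le (.iSup fun x1 => .iSup fun x2 => .iSup fun _ =>
      (mono_subst hA x1 R).mul (mono_subst hA x2 S)) fun N => ⟨N, (· / 2), ?_, fun m => ?_⟩
    · exact Nat.tendsto_div_const_atTop (by omega)
    · rintro z ⟨_, ⟨t, ht, s, hs, rfl⟩, ha, hz⟩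
      change x.adm N m (t ++ s).length at ha
      rw [List.length_append] at ha
      change z ∈ ((t ++ s).map _).prod at hz
      rw [List.map_append, List.prod_append] at hz
      obtain ⟨u, hu, v, hv, rfl⟩ := hz
      obtain ⟨x1, x2, hx', a1, a2⟩ := ha.split
      have hm' : m / 2 ≤ m := by omega
      exact mem_iSup_fam.2 ⟨x1, mem_iSup_fam.2 ⟨x2, mem_iSup_fam.2 ⟨hx',
        u, ⟨t, ht, a1, prod_map_mono (fun i => hA i le_rfl hm') t hu⟩,
        v, ⟨s, hs, a2, prod_map_mono (fun i => hA i le_rfl hm') s hv⟩, rfl⟩⟩⟩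

/-- With nonempty blocks, the number of letters is bounded iff the number of blocks and the length
of every block are; hence the exponent is applied both inside and outside. -/
theorem definable_subst_kstar_upper {x : Exp} (hx' : x = .star ∨ x = .bdd) (hx : x.Ok hB hS)
    {A : T → Fam α} (hA : ∀ t, (A t).Mono)
    {R : Language T} (hR : Definable hB hS (subst x R A)) :
    Definable hB hS (subst x R∗ A) := by
  have hm := mono_subst hA x R∗
  refine (hR.pw hx).congr hm ?_ ?_
  -- At most `N` blocks of at most `N` letters give `N * N`; the summand `N` keeps the new threshold
  -- above the old one.
  · refine Dom.of_le hm fun N => ⟨N * N + N, id, tendsto_id, fun m => ?_⟩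
    rintro z ⟨k, hk, hz⟩
    obtain ⟨t, ht, hq, hz⟩ := exists_of_mem_pow (L := subst x R A N m) (R := R)
      (B := fun i => A i N m) (P := fun n => x.adm N m n)
      (Q := fun k n => x = .bdd → n ≤ k * N) (fun z hz => hz) (by simp) (by
        rintro i k n h1 h2 rfl
        have := h2 rfl
        simp only [Exp.adm] at h1
        rw [Nat.add_mul]
        omega) hz
    refine ⟨t, ht, ?_, prod_map_mono (fun i => hA i (by omega) le_rfl) t hz⟩
    rcases hx' with rfl | rfl
    · trivial
    · simp only [Exp.adm] at hk ⊢
      exact (hq rfl).trans ((Nat.mul_le_mul_right N hk).trans (by omega))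
  · refine Dom.of_le' ((mono_subst hA x R).pw x) fun N m => ?_
    rintro z ⟨t, ht, ha, hz⟩
    obtain ⟨S, rfl, hS⟩ := Language.mem_kstar_iff_exists_nonempty.1 ht
    refine ⟨S.length, ?_, mem_pow_of_flatten (L := subst x R A N m) (fun y hy z hz => ⟨y, (hS y hy).1, ?_, hz⟩) hz⟩
    · have := length_le_length_flatten fun y hy => (hS y hy).2
      rcases hx' with rfl | rfl <;> simp only [Exp.adm] at *
      omega
    · have := (List.sublist_flatten_of_mem hy).length_le
      rcases hx' with rfl | rfl <;> simp only [Exp.adm] at *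
      omega

/-- Many letters mean one block with many letters, or many nonempty blocks. The second case is the
reason for the exponent `pos`: without it empty blocks would be counted. -/
theorem definable_subst_kstar_lower {x : Exp} (hx' : x = .pos ∨ x = .unb) (hx : x.Ok hB hS)
    {A : T → Fam α} (hA : ∀ t, (A t).Mono)
    {R : Language T} (hR : ∀ y : Exp, y.Ok hB hS → Definable hB hS (subst y R A)) :
    Definable hB hS (subst x R∗ A) := by
  have hm := mono_subst hA x R∗
  have h1 := (hR .star trivial).pw (x := .star) trivial
  refine ((h1.mul ((hR x hx).mul h1)).add ((hR .pos trivial).pw hx)).congr hm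
    (Dom.add_le ?_ ?_) ?_
  · have key : ∀ N m z, z ∈ (subst .star R A).pw .star N m → ∃ t ∈ R∗,
        z ∈ (t.map fun i => A i N m).prod := by
      rintro N m z ⟨k, -, hz⟩
      obtain ⟨t, ht, -, hz⟩ := exists_of_mem_pow (L := subst .star R A N m) (R := R)
        (B := fun i => A i N m) (P := fun _ => True)
        (Q := fun k n => True) (fun z ⟨t, h, _, h'⟩ => ⟨t, h, trivial, h'⟩) trivial
        (fun _ _ _ _ _ => trivial) hz
      exact ⟨t, ht, hz⟩
    refine Dom.of_le' hm fun N m => ?_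
    rintro _ ⟨u, hu, _, ⟨v, ⟨s, hs, ha, hv⟩, w, hw, rfl⟩, rfl⟩
    obtain ⟨t, ht, hu⟩ := key N m u hu
    obtain ⟨r, hr, hw⟩ := key N m w hw
    refine ⟨t ++ (s ++ r), ?_, ?_, ?_⟩
    · have e1 : R∗ * (R * R∗) ≤ R∗ :=
        (mul_le_mul_right mul_kstar_le_kstar _).trans (kstar_mul_kstar R).le
      exact e1 (Language.append_mem_mul ht (Language.append_mem_mul hs hr))
    · rcases hx' with rfl | rfl <;> simp only [Exp.adm, List.length_append] at * <;> omega
    · simp only [List.map_append, List.prod_append]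
      exact Language.append_mem_mul hu (Language.append_mem_mul hv hw)
  · refine Dom.of_le' hm fun N m => ?_
    rintro z ⟨k, hk, hz⟩
    obtain ⟨t, ht, hq, hz⟩ := exists_of_mem_pow (L := subst .pos R A N m) (R := R)
      (B := fun i => A i N m) (P := fun n => 1 ≤ n)
      (Q := fun k n => k ≤ n) (fun z hz => hz) le_rfl (fun i k n h1 h2 => by omega) hz
    refine ⟨t, ht, ?_, hz⟩
    rcases hx' with rfl | rfl <;> simp only [Exp.adm] at * <;> omega
  · refine Dom.of_le ((((mono_subst hA _ R).pw _).mul ((mono_subst hA _ R).mul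
      ((mono_subst hA _ R).pw _))).add ((mono_subst hA _ R).pw x))
      fun N => ⟨N, Nat.sqrt, tendsto_sqrt, fun m => ?_⟩
    have hmm : Nat.sqrt m ≤ m := Nat.sqrt_le_self m
    rintro z ⟨t, ht, ha, hz⟩
    obtain ⟨S, rfl, hS⟩ := Language.mem_kstar_iff_exists_nonempty.1 ht
    replace hz := prod_map_mono (fun i => hA i (le_refl N) hmm) S.flatten hz
    have hcase : x.adm N (Nat.sqrt m) S.length ∨ ∃ y ∈ S, x.adm N (Nat.sqrt m) y.length := by
      rcases hx' with rfl | rfl <;> simp only [Exp.adm] at *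
      · left
        by_contra h
        have : S = [] := List.length_eq_zero_iff.1 (by omega)
        simp [this] at ha
      · by_contra! h
        have h2 := length_flatten_lt h.1 h.2
        have h3 := Nat.sqrt_le m
        omega
    rcases hcase with hc | ⟨y, hy, hc⟩
    · right
      exact ⟨S.length, hc, mem_pow_of_flatten (L := subst .pos R A N (Nat.sqrt m)) (fun y hy z hz => ⟨y, (hS y hy).1,
        List.length_pos_of_ne_nil (hS y hy).2, hz⟩) hz⟩
    · left
      obtain ⟨S1, S2, rfl⟩ := List.append_of_mem hy
      simp only [List.flatten_append, List.flatten_cons, List.map_append, List.prod_append] at hz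
      obtain ⟨u, hu, _, ⟨v, hv, w, hw, rfl⟩, rfl⟩ := hz
      exact ⟨u, ⟨S1.length, trivial, mem_pow_of_flatten (L := subst .star R A N (Nat.sqrt m)) (fun y hy z hz => ⟨y,
        (hS y (by simp [hy])).1, trivial, hz⟩) hu⟩, _, ⟨v, ⟨y, (hS y (by simp)).1, hc, hv⟩,
        w, ⟨S2.length, trivial, mem_pow_of_flatten (L := subst .star R A N (Nat.sqrt m)) (fun y hy z hz => ⟨y,
        (hS y (by simp [hy])).1, trivial, hz⟩) hw⟩, rfl⟩, rfl⟩

/-- The induction treats all permitted exponents at once, because products and stars under one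
exponent call for others. -/
theorem definable_subst (r : RegularExpression T) {A : T → Fam α}
    (hA : ∀ t, Definable hB hS (A t)) {x : Exp} (hx : x.Ok hB hS) :
    Definable hB hS (subst x r.matches' A) := by
  have hm := fun t => (hA t).1
  induction r generalizing x with
  | zero => rw [show (RegularExpression.zero : RegularExpression T).matches' = 0 from rfl, subst_zero]; exact definable_zero
  | epsilon => exact definable_subst_one x hm
  | char t => exact definable_subst_char x hA t
  | plus r s hr hs =>
    rw [show (r.plus s).matches' = r.matches' + s.matches' from rfl, subst_add]
    exact (hr hx).add (hs hx)
  | comp r s hr hs => exact definable_subst_mul hx hm (fun _ => hr) (fun _ => hs)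
  | star r hr =>
    cases x with
    | star => exact definable_subst_kstar_upper (.inl rfl) hx hm (hr hx)
    | bdd => exact definable_subst_kstar_upper (.inr rfl) hx hm (hr hx)
    | pos => exact definable_subst_kstar_lower (.inl rfl) hx hm (fun _ => hr)
    | unb => exact definable_subst_kstar_lower (.inr rfl) hx hm (fun _ => hr)

end Subst

/-! ### Paths in finite graphs -/

section Paths

variable {V : Type*}

/-- The list of edges is a path from `v` to `w` with all intermediate vertices in `S`. -/
def IsPathIn (S : Set V) : V → List (V × V) → V → Prop
  | v, [], w => v = w
  | v, a :: t, w => a.1 = v ∧ (t = [] ∨ a.2 ∈ S) ∧ IsPathIn S a.2 t w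

/-- The list of edges is a path from `v` to `w`. -/
def IsPath : V → List (V × V) → V → Prop
  | v, [], w => v = w
  | v, a :: t, w => a.1 = v ∧ IsPath a.2 t w

/-- The paths from `q` to `q` with all intermediate vertices in `S`. -/
def loops (S : Set V) (q : V) : Language (V × V) := {l | IsPathIn S q l q}

theorem IsPathIn.mono {S S' : Set V} (h : S ⊆ S') {v w : V} {t : List (V × V)}
    (ht : IsPathIn S v t w) : IsPathIn S' v t w := by
  induction t generalizing v with
  | nil => exact ht
  | cons a t ih => exact ⟨ht.1, ht.2.1.imp_right (h ·), ih ht.2.2⟩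

theorem IsPathIn.append {S : Set V} {u v w : V} {s t : List (V × V)} (hs : IsPathIn S u s v)
    (ht : IsPathIn S v t w) (hv : v ∈ S) : IsPathIn S u (s ++ t) w := by
  induction s generalizing u with
  | nil => obtain rfl := hs; exact ht
  | cons a s ih =>
    refine ⟨hs.1, ?_, ih hs.2.2⟩
    rcases hs.2.1 with rfl | h
    · obtain rfl : a.2 = v := hs.2.2
      exact .inr hv
    · exact .inr h

theorem isPathIn_univ {v w : V} {t : List (V × V)} : IsPathIn Set.univ v t w ↔ IsPath v t w := by
  induction t generalizing v with
  | nil => rfl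
  | cons a t ih => simp [IsPathIn, IsPath, ih]

/-- Split the path at its visits to `q`. -/
theorem isPathIn_insert {S : Set V} {q v w : V} {t : List (V × V)} :
    IsPathIn (insert q S) v t w ↔ IsPathIn S v t w ∨ ∃ s u r, t = s ++ (u ++ r) ∧
      IsPathIn S v s q ∧ u ∈ (loops S q)∗ ∧
      IsPathIn S q r w := by
  have hsub : S ⊆ insert q S := Set.subset_insert _ _
  constructor
  · intro h
    induction t generalizing v with
    | nil => exact .inl h
    | cons a t ih =>
      obtain ⟨rfl, h1, h2⟩ := h
      rcases h1 with rfl | h1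
      · exact .inl ⟨rfl, .inl rfl, h2⟩
      rcases ih h2 with h3 | ⟨s, u, r, rfl, h3, h4, h5⟩
      · rcases h1 with h1 | h1
        · right
          refine ⟨[a], [], t, rfl, ⟨rfl, .inl rfl, h1⟩, Language.nil_mem_kstar _, ?_⟩
          rw [← h1]; exact h3
        · exact .inl ⟨rfl, .inr h1, h3⟩
      · right
        rcases h1 with h1 | h1
        · refine ⟨[a], s ++ u, r, by simp, ⟨rfl, .inl rfl, h1⟩, ?_, h5⟩
          rw [h1] at h3
          exact (mul_kstar_le_kstar (a := loops S q))
            (Language.append_mem_mul h3 h4)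
        · exact ⟨a :: s, u, r, rfl, ⟨rfl, .inr h1, h3⟩, h4, h5⟩
  · rintro (h | ⟨s, u, r, rfl, h1, ⟨L, rfl, h2⟩, h3⟩)
    · exact h.mono hsub
    · refine (h1.mono hsub).append ?_ (Set.mem_insert _ _)
      induction L with
      | nil => exact h3.mono hsub
      | cons l L ih =>
        rw [List.flatten_cons, List.append_assoc]
        exact (IsPathIn.mono hsub (h2 l (by simp))).append (ih fun y hy => h2 y (by simp [hy]))
          (Set.mem_insert _ _)

theorem exists_regularExpression_isPath [Finite V] (v w : V) :
    ∃ r : RegularExpression (V × V), r.matches' = {t | IsPath v t w} := by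
  have key : ∀ S : Set V, S.Finite → ∀ v w, ∃ r : RegularExpression (V × V),
      r.matches' = {t | IsPathIn S v t w} := by
    intro S hS
    induction S, hS using Set.Finite.induction_on with
    | empty =>
      intro v w
      have h1 : ∀ t, IsPathIn ∅ v t w ↔ t = [(v, w)] ∨ (t = [] ∧ v = w) := by
        rintro (_ | ⟨⟨a, b⟩, t⟩)
        · simp [IsPathIn]
        · simp only [IsPathIn, Set.mem_empty_iff_false, or_false]
          constructor
          · rintro ⟨rfl, rfl, rfl⟩; exact .inl rfl
          · rintro (h | ⟨h, -⟩)
            · simp only [List.cons.injEq, Prod.mk.injEq] at h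
              obtain ⟨⟨rfl, rfl⟩, rfl⟩ := h
              exact ⟨rfl, rfl, rfl⟩
            · cases h
      by_cases hvw : v = w
      · refine ⟨.char (v, w) + 1, ?_⟩
        ext t
        exact (show _ ↔ t = [(v, w)] ∨ t = [] from Iff.rfl).trans
          (((h1 t).trans (by simp [hvw])).symm)
      · refine ⟨.char (v, w), ?_⟩
        ext t
        exact (show _ ↔ t = [(v, w)] from Iff.rfl).trans
          (((h1 t).trans (by simp [hvw])).symm)
    | @insert q S _ _ ih =>
      intro v w
      obtain ⟨a, ha⟩ := ih v w
      obtain ⟨b, hb⟩ := ih v q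
      obtain ⟨c, hc⟩ := ih q q
      obtain ⟨d, hd⟩ := ih q w
      refine ⟨a + b * (c.star * d), ?_⟩
      rw [RegularExpression.matches'_add, RegularExpression.matches'_mul,
        RegularExpression.matches'_mul, RegularExpression.matches'_star, ha, hb, hc, hd]
      ext t
      refine Iff.trans ?_ isPathIn_insert.symm
      constructor
      · rintro (h | ⟨s, hs, _, ⟨u, hu, r, hr, rfl⟩, rfl⟩)
        · exact .inl h
        · exact .inr ⟨s, u, r, rfl, hs, hu, hr⟩
      · rintro (h | ⟨s, u, r, rfl, hs, hu, hr⟩)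
        · exact .inl h
        · exact .inr ⟨s, hs, _, ⟨u, hu, r, hr, rfl⟩, rfl⟩
  obtain ⟨r, hr⟩ := key Set.univ Set.finite_univ v w
  exact ⟨r, hr.trans (Set.ext fun t => isPathIn_univ)⟩

/-- The words along paths from `v` to `w` with an admissible number of edges. -/
def pathFam (x : Exp) (A : V → V → Fam α) (v w : V) : Fam α :=
  subst x {t | IsPath v t w} fun a => A a.1 a.2

theorem definable_pathFam {hB hS : Prop} [Finite V] {A : V → V → Fam α}
    (hA : ∀ v w, Definable hB hS (A v w)) {x : Exp} (hx : x.Ok hB hS) (v w : V) :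
    Definable hB hS (pathFam x A v w) := by
  obtain ⟨r, hr⟩ := exists_regularExpression_isPath v w
  rw [pathFam, ← hr]
  exact definable_subst r (fun t => hA t.1 t.2) hx

end Paths

/-! ### Intersection of two powers -/

section Powers

/-- Vertices of the graph of steps: the unread rest of the current factor lies in `r`. -/
inductive Node (F : Set (Fam α)) where
  | init
  | st (r : F)
  | fin

theorem Node.finite {F : Set (Fam α)} (hF : F.Finite) : Finite (Node F) := by
  have := hF.to_subtype
  refine Finite.of_surjective
    (fun o : Option (Option F) => match o with
      | none => Node.init
      | some none => Node.fin
      | some (some r) => Node.st r) fun v => ?_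
  cases v with
  | init => exact ⟨none, rfl⟩
  | st r => exact ⟨some (some r), rfl⟩
  | fin => exact ⟨some none, rfl⟩

variable {F : Set (Fam α)} {e f a b : Fam α}

/-- The words read in one step, `Ep` and `Fp` being the families of the factors of the two powers
that are passed completely. -/
def step (e f a b : Fam α) : Node F → Node F → Fam α → Fam α → Fam α
  | .init, .st r, Ep, Fp => ⨆ c : F, ⨆ _ : Dom (c.1 * r.1) a, (c.1 ⊓ Fp) * (1 ⊓ Ep)
  | .st r, .st s, Ep, Fp => ⨆ l : F, ⨆ c : F, ⨆ _ : Dom (l.1 * (c.1 * s.1)) e,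
      ((r.1 * (Ep * l.1)) ⊓ f) * (c.1 ⊓ Fp)
  | .st r, .fin, Ep, Fp => (⨆ l : F, ⨆ c : F, ⨆ _ : Dom (l.1 * c.1) b,
      ((r.1 * (Ep * l.1)) ⊓ f) * (c.1 ⊓ Fp)) + ((r.1 * (Ep * b)) ⊓ 1) * (1 ⊓ Fp)
  | _, _, _, _ => 0

theorem step_mem_imp {Ep Fp Ep' Fp' : Fam α} {N m : ℕ} {v w : Node F} {z : List α}
    (hE : Ep N m ≤ Ep' N m) (hF : Fp N m ≤ Fp' N m)
    (hz : z ∈ step e f a b v w Ep Fp N m) : z ∈ step e f a b v w Ep' Fp' N m := by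
  revert hz
  suffices step e f a b v w Ep Fp N m ≤ step e f a b v w Ep' Fp' N m from fun hz => this hz
  cases v with
  | init =>
    cases w with
    | st r =>
      simp only [step, iSup_apply]
      exact iSup_mono fun c => iSup_mono fun _ =>
        mul_le_mul' (inf_le_inf le_rfl hF) (inf_le_inf le_rfl hE)
    | _ => exact le_rfl
  | st r =>
    cases w with
    | st s =>
      simp only [step, iSup_apply]
      exact iSup_mono fun l => iSup_mono fun c => iSup_mono fun _ =>
        mul_le_mul' (inf_le_inf (mul_le_mul' le_rfl (mul_le_mul' hE le_rfl)) le_rfl)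
          (inf_le_inf le_rfl hF)
    | fin =>
      simp only [step, Pi.add_apply, iSup_apply]
      exact sup_le_sup (iSup_mono fun l => iSup_mono fun c => iSup_mono fun _ =>
        mul_le_mul' (inf_le_inf (mul_le_mul' le_rfl (mul_le_mul' hE le_rfl)) le_rfl)
          (inf_le_inf le_rfl hF))
        (mul_le_mul' (inf_le_inf (mul_le_mul' le_rfl (mul_le_mul' hE le_rfl)) le_rfl)
          (inf_le_inf le_rfl hF))
    | init => exact le_rfl
  | fin => cases w <;> exact le_rfl

/-- Each summand of a step contains each of the two powers once, so a word read in the step fixes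
one count for either power. The factors `1 ⊓ Ep` and `1 ⊓ Fp` read nothing and are there so that
these counts always exist. -/
theorem exists_of_mem_step {x y : Exp} {N m : ℕ} {v w : Node F} {z : List α}
    (hz : z ∈ step e f a b v w (e.pw x) (f.pw y) N m) :
    ∃ i j, x.adm N m i ∧ y.adm N m j ∧ z ∈ step e f a b v w (e ^ i) (f ^ j) N m := by
  have key : ∀ {r l c g : Fam α}, z ∈ (((r * (e.pw x * l)) ⊓ g) * (c ⊓ f.pw y)) N m →
      ∃ i j, x.adm N m i ∧ y.adm N m j ∧ z ∈ (((r * (e ^ i * l)) ⊓ g) * (c ⊓ f ^ j)) N m := by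
    rintro r l c g ⟨_, ⟨⟨u, hu, _, ⟨v, ⟨i, hi, hv⟩, w, hw, rfl⟩, rfl⟩, hg⟩, t,
      ⟨hc, ⟨j, hj, ht⟩⟩, rfl⟩
    exact ⟨i, j, hi, hj, _, ⟨⟨u, hu, _, ⟨v, hv, w, hw, rfl⟩, rfl⟩, hg⟩, t, ⟨hc, ht⟩, rfl⟩
  cases v with
  | init =>
    cases w with
    | st r =>
      obtain ⟨c, hz⟩ := mem_iSup_fam.1 hz
      obtain ⟨hc, u, ⟨hu, j, hj, hu'⟩, v, ⟨hv, i, hi, hv'⟩, rfl⟩ := mem_iSup_fam.1 hz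
      exact ⟨i, j, hi, hj, mem_iSup_fam.2 ⟨c, mem_iSup_fam.2
        ⟨hc, u, ⟨hu, hu'⟩, v, ⟨hv, hv'⟩, rfl⟩⟩⟩
    | _ => exact hz.elim
  | st r =>
    cases w with
    | st s =>
      obtain ⟨l, hz⟩ := mem_iSup_fam.1 hz
      obtain ⟨c, hz⟩ := mem_iSup_fam.1 hz
      obtain ⟨hd, hz⟩ := mem_iSup_fam.1 hz
      obtain ⟨i, j, hi, hj, hz⟩ := key hz
      exact ⟨i, j, hi, hj, mem_iSup_fam.2 ⟨l, mem_iSup_fam.2 ⟨c, mem_iSup_fam.2 ⟨hd, hz⟩⟩⟩⟩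
    | fin =>
      rcases hz with hz | hz
      · obtain ⟨l, hz⟩ := mem_iSup_fam.1 hz
        obtain ⟨c, hz⟩ := mem_iSup_fam.1 hz
        obtain ⟨hd, hz⟩ := mem_iSup_fam.1 hz
        obtain ⟨i, j, hi, hj, hz⟩ := key hz
        exact ⟨i, j, hi, hj, .inl (mem_iSup_fam.2 ⟨l, mem_iSup_fam.2
          ⟨c, mem_iSup_fam.2 ⟨hd, hz⟩⟩⟩)⟩
      · obtain ⟨i, j, hi, hj, hz⟩ := key hz
        exact ⟨i, j, hi, hj, .inr hz⟩
    | init => exact hz.elim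
  | fin => cases w <;> exact hz.elim

/-! ### Pairs of factorizations as chains of steps -/

/-- Words along paths to the final vertex, with the numbers of factors passed in every step. -/
inductive Chain (e f a b : Fam α) (N m : ℕ) : Node F → List (ℕ × ℕ) → List α → Prop
  | nil : Chain e f a b N m .fin [] []
  | cons {v w : Node F} {i j : ℕ} {cs : List (ℕ × ℕ)} {y z : List α}
      (hy : y ∈ step e f a b v w (e ^ i) (f ^ j) N m) (hz : Chain e f a b N m w cs z) :
      Chain e f a b N m v ((i, j) :: cs) (y ++ z)

/-- Totals compatible with the numbers of factors passed in every step, up to one factor in every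
step. -/
structure Counts (l : List ℕ) (n : ℕ) : Prop where
  sum_le : l.sum ≤ n
  le_sum : n ≤ l.sum + l.length

/-- The words that remain to be read at a vertex, with given numbers of factors. -/
def Remains (A B E G : Language α) (N m : ℕ) : Node F → ℕ → ℕ → List α → Prop
  | .init, i, j, z => z ∈ A * (E ^ i * B) ∧ z ∈ G ^ j
  | .st r, i, j, z => z ∈ r.1 N m * (E ^ i * B) ∧ z ∈ G ^ j
  | .fin, i, j, z => i = 0 ∧ j = 0 ∧ z = []

/-- The number of steps to be made besides those that complete a factor. -/
def Node.extra : Node F → ℕ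
  | .init => 2
  | .st _ => 1
  | .fin => 0

/-- Gluing the pieces of a cut factor back together needs looser thresholds; `A`, `B`, `E`, `G`
stand for `a`, `b`, `e`, `f` at these. A step between two inner vertices contributes, besides its
counts, one reassembled factor of `e` and one factor of `f` that crosses a boundary. This is the
slack of one per step in `Counts`, and it bounds the number of steps by the number of factors. -/
theorem Chain.sound {A B E G : Language α} {N m : ℕ} (hE : e N m ≤ E) (hG : f N m ≤ G)
    (hB : b N m ≤ B)
    (he : ∀ l c r : F, Dom (l.1 * (c.1 * r.1)) e → l.1 N m * (c.1 N m * r.1 N m) ≤ E)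
    (hb : ∀ l c : F, Dom (l.1 * c.1) b → l.1 N m * c.1 N m ≤ B)
    (ha : ∀ c r : F, Dom (c.1 * r.1) a → c.1 N m * r.1 N m ≤ A)
    {v : Node F} {cs : List (ℕ × ℕ)} {z : List α} (h : Chain e f a b N m v cs z) :
    ∃ i j, Counts (cs.map Prod.fst) i ∧ Counts (cs.map Prod.snd) j ∧
      cs.length ≤ i + v.extra ∧ cs.length ≤ j + v.extra ∧ Remains A B E G N m v i j z := by
  have hEp : ∀ i, e N m ^ i ≤ E ^ i := fun i => pow_le_pow_left' hE i
  have hGp : ∀ i, f N m ^ i ≤ G ^ i := fun i => pow_le_pow_left' hG i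
  induction h with
  | nil => exact ⟨0, 0, ⟨le_rfl, le_rfl⟩, ⟨le_rfl, le_rfl⟩, le_rfl, le_rfl, rfl, rfl, rfl⟩
  | @cons v w i j cs y z hy hz ih =>
    obtain ⟨i', j', ⟨ci1, ci2⟩, ⟨cj1, cj2⟩, ni, nj, hr⟩ := ih
    cases v with
    | init =>
      cases w with
      | st r =>
        obtain ⟨c, hy⟩ := mem_iSup_fam.1 hy
        obtain ⟨hc, u, ⟨hu, hu'⟩, v, ⟨hv, hv'⟩, rfl⟩ := mem_iSup_fam.1 hy
        obtain rfl : v = [] := hv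
        obtain ⟨⟨s, hs, t, ht, rfl⟩, hr2⟩ := hr
        refine ⟨i + i', j + j', ⟨?_, ?_⟩, ⟨?_, ?_⟩, ?_, ?_, ?_, ?_⟩
        iterate 6 simp only [List.map_cons, List.sum_cons, List.length_cons, Node.extra] at *; omega
        · have h1 := Language.append_mem_mul (ha c r hc (Language.append_mem_mul hu hs))
            (Language.append_mem_mul (hEp i hv') ht)
          rw [← mul_assoc (E ^ i), ← pow_add] at h1
          simpa using h1
        · have h1 := Language.append_mem_mul (hGp j hu') hr2
          rw [← pow_add] at h1
          simpa using h1
      | _ => exact hy.elim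
    | st r =>
      cases w with
      | st s =>
        obtain ⟨l, hy⟩ := mem_iSup_fam.1 hy
        obtain ⟨c, hy⟩ := mem_iSup_fam.1 hy
        obtain ⟨hd, hy⟩ := mem_iSup_fam.1 hy
        obtain ⟨_, ⟨⟨u1, h1, _, ⟨u2, h2, u3, h3, rfl⟩, rfl⟩, hg⟩, t, ⟨hc, ht⟩, rfl⟩ := hy
        obtain ⟨⟨s', hs, t', ht', rfl⟩, hr2⟩ := hr
        refine ⟨i + 1 + i', 1 + j + j', ⟨?_, ?_⟩, ⟨?_, ?_⟩, ?_, ?_, ?_, ?_⟩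
        iterate 6 simp only [List.map_cons, List.sum_cons, List.length_cons, Node.extra] at *; omega
        · have h4 := he l c s hd (Language.append_mem_mul h3 (Language.append_mem_mul hc hs))
          have h5 := Language.append_mem_mul h1 (Language.append_mem_mul (hEp i h2)
            (Language.append_mem_mul h4 ht'))
          rw [← mul_assoc E, ← pow_succ', ← mul_assoc (E ^ i), ← pow_add] at h5
          have h6 : i + (i' + 1) = i + 1 + i' := by omega
          rw [h6] at h5
          simpa using h5
        · have h5 := Language.append_mem_mul (hG hg) (Language.append_mem_mul (hGp j ht) hr2)
          rw [← pow_add, ← pow_succ'] at h5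
          have h6 : j + j' + 1 = 1 + j + j' := by omega
          rw [h6] at h5
          simpa using h5
      | fin =>
        obtain ⟨rfl, rfl, rfl⟩ := hr
        rcases hy with hy | hy
        · obtain ⟨l, hy⟩ := mem_iSup_fam.1 hy
          obtain ⟨c, hy⟩ := mem_iSup_fam.1 hy
          obtain ⟨hd, hy⟩ := mem_iSup_fam.1 hy
          obtain ⟨_, ⟨⟨u1, h1, _, ⟨u2, h2, u3, h3, rfl⟩, rfl⟩, hg⟩, t, ⟨hc, ht⟩, rfl⟩ := hy
          refine ⟨i, j + 1, ⟨?_, ?_⟩, ⟨?_, ?_⟩, ?_, ?_, ?_, ?_⟩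
          iterate 6
            simp only [List.map_cons, List.sum_cons, List.length_cons, Node.extra] at *; omega
          · have h5 := Language.append_mem_mul h1 (Language.append_mem_mul (hEp i h2)
              (hb l c hd (Language.append_mem_mul h3 hc)))
            simpa using h5
          · have h5 := Language.append_mem_mul (hG hg) (hGp j ht)
            rw [← pow_succ'] at h5
            simpa using h5
        · obtain ⟨_, ⟨⟨u1, h1, _, ⟨u2, h2, u3, h3, rfl⟩, rfl⟩, hg⟩, t, ⟨hc, ht⟩, rfl⟩ := hy
          obtain rfl : t = [] := hc
          obtain hg : u1 ++ (u2 ++ u3) = [] := hg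
          refine ⟨i, j, ⟨?_, ?_⟩, ⟨?_, ?_⟩, ?_, ?_, ?_, ?_⟩
          iterate 6
            simp only [List.map_cons, List.sum_cons, List.length_cons, Node.extra] at *; omega
          · have h5 := Language.append_mem_mul h1 (Language.append_mem_mul (hEp i h2) (hB h3))
            simpa using h5
          · change u1 ++ (u2 ++ u3) ++ [] ++ [] ∈ _
            rw [hg]
            exact hGp j ht
      | init => exact hy.elim
    | fin => cases w <;> exact hy.elim

/-- Whole factors contained in `s` are split off until the next one reaches at least to the end of
what is left of `s`. This is the state in which a new step starts. -/
theorem exists_prefix_factors (xs : List (List α)) (s r : List α) (h : s ++ r = xs.flatten) :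
    ∃ xs1 xs2 s', xs = xs1 ++ xs2 ∧ s = xs1.flatten ++ s' ∧ s' ++ r = xs2.flatten ∧
      (xs2 = [] ∨ ∃ x xs3, xs2 = x :: xs3 ∧ s'.length ≤ x.length) := by
  induction xs generalizing s with
  | nil => exact ⟨[], [], s, rfl, rfl, h, .inl rfl⟩
  | cons x xs ih =>
    by_cases hx : s.length ≤ x.length
    · exact ⟨[], x :: xs, s, rfl, rfl, h, .inr ⟨x, xs, rfl, hx⟩⟩
    · rw [List.flatten_cons] at h
      obtain ⟨c, hc1, hc2⟩ | ⟨c, rfl, hc2⟩ := List.append_eq_append_iff.1 h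
      · rw [hc1, List.length_append] at hx
        omega
      · obtain ⟨xs1, xs2, s', rfl, rfl, h1, h2⟩ := ih c hc2.symm
        exact ⟨x :: xs1, xs2, s', rfl, by simp, h1, h2⟩

/-- Locates the end of `x`: inside one of the factors `ys` or inside the closing word `bw`. An end
on a boundary is attributed to a later factor, with `p` empty. -/
theorem exists_next_cut (ys : List (List α)) (s bw x t : List α)
    (h : s ++ (ys.flatten ++ bw) = x ++ t) (hx : s.length ≤ x.length) :
    (∃ ys1 y ys2 p s', ys = ys1 ++ y :: ys2 ∧ x = s ++ (ys1.flatten ++ p) ∧ y = p ++ s' ∧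
      s' ++ (ys2.flatten ++ bw) = t) ∨
    ∃ p s', x = s ++ (ys.flatten ++ p) ∧ bw = p ++ s' ∧ s' = t := by
  induction ys generalizing s with
  | nil =>
    right
    rw [List.flatten_nil, List.nil_append] at h
    obtain ⟨c, rfl, rfl⟩ | ⟨c, rfl, hc2⟩ := List.append_eq_append_iff.1 h
    · exact ⟨c, t, rfl, rfl, rfl⟩
    · have : c = [] := List.length_eq_zero_iff.1 (by rw [List.length_append] at hx; omega)
      subst this
      exact ⟨[], bw, by simp, by simp, by simpa using hc2.symm⟩
  | cons y ys ih =>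
    by_cases hy : (s ++ y).length ≤ x.length
    · rcases ih (s ++ y) (by simpa using h) hy with
        ⟨ys1, y', ys2, p, s', rfl, rfl, rfl, h1⟩ | ⟨p, s', rfl, rfl, h1⟩
      · exact .inl ⟨y :: ys1, _, ys2, p, s', rfl, by simp, rfl, h1⟩
      · exact .inr ⟨p, s', by simp, rfl, h1⟩
    · left
      rw [List.flatten_cons, List.append_assoc] at h
      obtain ⟨c, rfl, hc2⟩ | ⟨c, rfl, hc2⟩ := List.append_eq_append_iff.1 h
      · obtain ⟨d, rfl, hd2⟩ | ⟨d, rfl, rfl⟩ := List.append_eq_append_iff.1 hc2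
        · simp only [List.length_append] at hy
          omega
        · exact ⟨[], _, ys, c, d, rfl, by simp, rfl, rfl⟩
      · have : c = [] := List.length_eq_zero_iff.1 (by rw [List.length_append] at hx; omega)
        subst this
        exact ⟨[], y, ys, [], y, rfl, by simp, rfl, by simpa using hc2.symm⟩

theorem flatten_mem_pow {L : Language α} {xs : List (List α)} (h : ∀ x ∈ xs, x ∈ L) :
    xs.flatten ∈ L ^ xs.length := Language.mem_pow.2 ⟨xs, rfl, rfl, h⟩

/-- Greedy reading: the next factor of `f` ends in some factor of `e`, or in the closing word; then
all factors of `f` that fit into the rest of that factor of `e` are taken. Every step consumes a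
factor of `f`, unless none is left, so induction on a bound for their number terminates. -/
theorem Chain.complete_st {B E G : Language α} {N m : ℕ} (hE : E ≤ e N m) (hG : G ≤ f N m)
    (hB : B ≤ b N m)
    (he : ∀ u v w, u ++ (v ++ w) ∈ E → ∃ l c r : F, Dom (l.1 * (c.1 * r.1)) e ∧
      u ∈ l.1 N m ∧ v ∈ c.1 N m ∧ w ∈ r.1 N m)
    (hb : ∀ u v, u ++ v ∈ B → ∃ l c : F, Dom (l.1 * c.1) b ∧ u ∈ l.1 N m ∧ v ∈ c.1 N m)
    (n : ℕ) : ∀ (xs ys : List (List α)) (bw s : List α) (r : F), xs.length < n →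
      (∀ x ∈ xs, x ∈ G) → (∀ y ∈ ys, y ∈ E) → bw ∈ B → s ∈ r.1 N m →
      s ++ (ys.flatten ++ bw) = xs.flatten →
      (xs = [] ∨ ∃ x xs', xs = x :: xs' ∧ s.length ≤ x.length) →
      ∃ cs, Chain e f a b N m (.st r) cs xs.flatten ∧ Counts (cs.map Prod.fst) ys.length ∧
        Counts (cs.map Prod.snd) xs.length ∧ cs.length ≤ ys.length + 1 ∧
        cs.length ≤ xs.length + 1 := by
  have hEp : ∀ zs : List (List α), (∀ z ∈ zs, z ∈ E) → zs.flatten ∈ (e ^ zs.length) N m :=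
    fun zs h => flatten_mem_pow fun z hz => hE (h z hz)
  have hGp : ∀ zs : List (List α), (∀ z ∈ zs, z ∈ G) → zs.flatten ∈ (f ^ zs.length) N m :=
    fun zs h => flatten_mem_pow fun z hz => hG (h z hz)
  induction n with
  | zero => intro xs ys bw s r hn; omega
  | succ n ih =>
    intro xs ys bw s r hn hxs hys hbw hs heq hx
    rcases hx with rfl | ⟨x, xs, rfl, hx⟩
    · rw [List.flatten_nil] at heq
      -- No factor of `f` remains, so the rest of the word is empty; the second summand of the final
      -- step still accounts for the empty factors of `e`.
      refine ⟨[(ys.length, 0)], ?_, ⟨by simp, by simp⟩, ⟨by simp, by simp⟩, by simp, by simp⟩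
      refine Chain.cons (w := .fin) (y := []) (z := []) (.inr ⟨[], ⟨⟨s, hs, _, ⟨_, hEp ys hys, bw,
        hB hbw, rfl⟩, heq⟩, rfl⟩, [], ⟨rfl, rfl⟩, rfl⟩) Chain.nil
    · rw [List.flatten_cons] at heq
      obtain ⟨ys1, y, ys2, p, s', rfl, rfl, rfl, h1⟩ | ⟨p, s', rfl, rfl, rfl⟩ :=
        exists_next_cut ys s bw x xs.flatten heq hx
      · obtain ⟨xs1, xs2, s'', rfl, rfl, h2, h3⟩ := exists_prefix_factors xs _ _ h1
        obtain ⟨l, c, r', hd, hl, hc, hr⟩ := he p xs1.flatten s'' (hys _ (by simp))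
        simp only [List.length_cons, List.length_append] at hn
        obtain ⟨cs, hch, ci, cj, ni, nj⟩ := ih xs2 ys2 bw s'' r' (by omega)
          (fun x hx => hxs x (by simp [hx])) (fun y hy => hys y (by simp [hy])) hbw hr h2 h3
        refine ⟨(ys1.length, xs1.length) :: cs, ?_, ?_, ?_, ?_, ?_⟩
        · have hstep : (s ++ (ys1.flatten ++ p)) ++ xs1.flatten ∈
              step e f a b (.st r) (.st r') (e ^ ys1.length) (f ^ xs1.length) N m := by
            refine mem_iSup_fam.2 ⟨l, mem_iSup_fam.2 ⟨c, mem_iSup_fam.2 ⟨hd, _, ⟨⟨s, hs, _, ⟨_,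
              hEp ys1 (fun y hy => hys y (by simp [hy])), p, hl, rfl⟩, rfl⟩,
              hG (hxs _ (by simp))⟩, _, ⟨hc, hGp xs1 fun x hx => hxs x (by simp [hx])⟩, rfl⟩⟩⟩
          have := Chain.cons hstep hch
          simpa using this
        · obtain ⟨h4, h5⟩ := ci
          constructor <;> simp only [List.map_cons, List.sum_cons, List.length_cons,
            List.length_append] at * <;> omega
        · obtain ⟨h4, h5⟩ := cj
          constructor <;> simp only [List.map_cons, List.sum_cons, List.length_cons,
            List.length_append] at * <;> omega
        · simp only [List.length_cons, List.length_append] at *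
          omega
        · simp only [List.length_cons, List.length_append] at *
          omega
      · obtain ⟨l, c, hd, hl, hc⟩ := hb _ _ hbw
        refine ⟨[(ys.length, xs.length)], ?_, ⟨by simp, by simp⟩, ⟨by simp, by simp⟩, by simp,
          by simp⟩
        have hstep : (s ++ (ys.flatten ++ p)) ++ xs.flatten ∈
            step e f a b (.st r) .fin (e ^ ys.length) (f ^ xs.length) N m :=
          .inl (mem_iSup_fam.2 ⟨l, mem_iSup_fam.2 ⟨c, mem_iSup_fam.2 ⟨hd, _, ⟨⟨s, hs, _, ⟨_,
            hEp ys hys, p, hl, rfl⟩, rfl⟩,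
            hG (hxs _ (by simp))⟩, _, ⟨hc, hGp xs fun x hx => hxs x (by simp [hx])⟩, rfl⟩⟩⟩)
        have := Chain.cons hstep Chain.nil
        simpa using this

theorem Chain.complete_init {A B E G : Language α} {N m : ℕ} (hE : E ≤ e N m) (hG : G ≤ f N m)
    (hB : B ≤ b N m)
    (he : ∀ u v w, u ++ (v ++ w) ∈ E → ∃ l c r : F, Dom (l.1 * (c.1 * r.1)) e ∧
      u ∈ l.1 N m ∧ v ∈ c.1 N m ∧ w ∈ r.1 N m)
    (hb : ∀ u v, u ++ v ∈ B → ∃ l c : F, Dom (l.1 * c.1) b ∧ u ∈ l.1 N m ∧ v ∈ c.1 N m)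
    (ha : ∀ u v, u ++ v ∈ A → ∃ l c : F, Dom (l.1 * c.1) a ∧ u ∈ l.1 N m ∧ v ∈ c.1 N m)
    {i j : ℕ} {z : List α} (hz : z ∈ A * (E ^ i * B)) (hz' : z ∈ G ^ j) :
    ∃ cs, cs ≠ [] ∧ Chain (F := F) e f a b N m .init cs z ∧ Counts (cs.map Prod.fst) i ∧
      Counts (cs.map Prod.snd) j ∧ cs.length ≤ i + 2 ∧ cs.length ≤ j + 2 := by
  obtain ⟨aw, haw, _, ⟨_, hy, bw, hbw, rfl⟩, rfl⟩ := hz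
  obtain ⟨ys, rfl, rfl, hys⟩ := Language.mem_pow.1 hy
  obtain ⟨xs, heq, rfl, hxs⟩ := Language.mem_pow.1 hz'
  change aw ++ (ys.flatten ++ bw) = _ at heq
  obtain ⟨xs1, xs2, s, rfl, rfl, h1, h2⟩ := exists_prefix_factors xs _ _ heq
  obtain ⟨c, r, hd, hc, hr⟩ := ha _ _ haw
  obtain ⟨cs, hch, ⟨ci1, ci2⟩, ⟨cj1, cj2⟩, ni, nj⟩ := Chain.complete_st hE hG hB he hb _ xs2 ys bw s
    r (Nat.lt_succ_self _) (fun x hx => hxs x (by simp [hx])) hys hbw hr h1 h2 (a := a)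
  have hstep : xs1.flatten ++ [] ∈
      step e f a b .init (.st r) (e ^ 0) (f ^ xs1.length) N m :=
    mem_iSup_fam.2 ⟨c, mem_iSup_fam.2 ⟨hd, _, ⟨hc, flatten_mem_pow fun x hx =>
      hG (hxs x (by simp [hx]))⟩, [], ⟨rfl, rfl⟩, rfl⟩⟩
  refine ⟨(0, xs1.length) :: cs, by simp, ?_, ⟨?_, ?_⟩, ⟨?_, ?_⟩, ?_, ?_⟩
  · have := Chain.cons hstep hch
    change Chain e f a b N m _ _ (xs1.flatten ++ s ++ (ys.flatten ++ bw))
    rw [heq, List.flatten_append]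
    simpa using this
  all_goals simp only [List.map_cons, List.sum_cons, List.length_cons, List.length_append] at *; omega

end Powers

/-! ### Certificates for large numbers of factors -/

/-- The constraint that an exponent imposes on every single summand of a number of factors. -/
def Exp.weak : Exp → Exp
  | .unb => .star
  | x => x

/-- The constraint on a summand when a certificate is obtained in case `s` is false and `s'` true. -/
def Exp.at (x : Exp) (s s' : Bool) : Exp := if !s && s' then x else x.weak

theorem Exp.adm.weak {x : Exp} {N m k : ℕ} (h : x.adm N m k) : x.weak.adm N m k := by
  cases x
  exacts [trivial, h, h, trivial]

theorem Exp.adm.at_weak {x : Exp} {s s' : Bool} {N m k : ℕ} (h : (x.at s s').adm N m k) :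
    x.weak.adm N m k := by
  unfold Exp.at at h
  split_ifs at h
  exacts [h.weak, h]

theorem Exp.at_eq (x : Exp) (s s' : Bool) : x.at s s' = .star ∨ x.at s s' = x := by
  unfold Exp.at
  split_ifs
  · exact .inr rfl
  · cases x
    exacts [.inr rfl, .inr rfl, .inr rfl, .inl rfl]

/-- Passing from `s` to `s'` is certified by a member of the list. -/
def Certified (x : Exp) (N m : ℕ) (s s' : Bool) (l : List ℕ) : Prop :=
  s = s' ∨ (s = false ∧ s' = true ∧ ∃ i ∈ l, x.adm N m i)

/-- The Boolean flips exactly at the chosen certifying summand; all other steps need only the weak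
constraint. -/
theorem Certified.cons {x : Exp} {N m : ℕ} {s s' : Bool} {i : ℕ} {l : List ℕ}
    (h : Certified x N m s s' (i :: l)) (hi : x.weak.adm N m i) :
    ∃ s1, s ≤ s1 ∧ (x.at s s1).adm N m i ∧ Certified x N m s1 s' l := by
  rcases h with rfl | ⟨rfl, rfl, j, hj, ha⟩
  · refine ⟨s, le_rfl, ?_, .inl rfl⟩
    rw [show x.at s s = x.weak by cases s <;> rfl]
    exact hi
  · rcases List.mem_cons.1 hj with rfl | hj
    · exact ⟨true, by decide, ha, .inl rfl⟩
    · exact ⟨false, le_rfl, hi, .inr ⟨rfl, rfl, j, hj, ha⟩⟩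

theorem Exp.adm.certificate_cons {x : Exp} {N m i : ℕ} {s s1 s' : Bool} {l : List ℕ}
    (h : (x.at s s1).adm N m i) (hl : s1 = false → s' = true → ∃ j ∈ l, x.adm N m j) :
    s = false → s' = true → ∃ j ∈ i :: l, x.adm N m j := by
  rintro rfl rfl
  cases s1
  · obtain ⟨j, hj, ha⟩ := hl rfl rfl
    exact ⟨j, List.mem_cons_of_mem _ hj, ha⟩
  · exact ⟨i, List.mem_cons_self, h⟩

theorem List.sum_le_length_mul {l : List ℕ} {c : ℕ} (h : ∀ i ∈ l, i ≤ c) :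
    l.sum ≤ l.length * c := by
  have := List.sum_le_card_nsmul l c h
  simpa using this

/-- For `bdd`, at most `N` summands of size at most `N`, with a slack of one each, give `N * N + N`.
For `unb`, either a large summand lies below the sum, or many steps force many factors, up to the
two steps at the ends. -/
theorem Counts.adm {x : Exp} (hx : x ≠ .pos) {l : List ℕ} {n N m : ℕ} (h : Counts l n)
    (hn : l.length ≤ n + 2) (hw : ∀ i ∈ l, x.weak.adm N m i) (hb : x = .bdd → l.length ≤ N)
    (hu : x = .unb → m ≤ l.length ∨ ∃ i ∈ l, m ≤ i) : x.adm (N * N + N) (m - 2) n := by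
  obtain ⟨h1, h2⟩ := h
  cases x with
  | star => trivial
  | pos => exact (hx rfl).elim
  | bdd =>
    have h3 := List.sum_le_length_mul hw
    have h4 := hb rfl
    have h5 := Nat.mul_le_mul_right N h4
    simp only [Exp.adm]
    omega
  | unb =>
    simp only [Exp.adm]
    rcases hu rfl with h3 | ⟨i, hi, h3⟩
    · omega
    · have := List.le_sum_of_mem hi
      omega

/-- Fewer than `t` summands, each below `t`, total less than `t * t` even after adding one for every
step. So for `unb` there are `t` steps or a summand of size `t`. -/
theorem Counts.certificate {x : Exp} {l : List ℕ} (hl : l ≠ []) {n N m t : ℕ} (h : Counts l n)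
    (hn : l.length ≤ n + 2) (ha : x.adm N m n) (ht : t * t ≤ m) (hx : x ≠ .pos) :
    (∀ i ∈ l, x.weak.adm (N + 2) t i) ∧ (x = .bdd → l.length ≤ N + 2) ∧
      ((∃ i ∈ l, x.adm (N + 2) t i) ∨ (x = .unb ∧ t ≤ l.length)) := by
  obtain ⟨h1, h2⟩ := h
  obtain ⟨j, hj⟩ := List.exists_mem_of_ne_nil l hl
  cases x with
  | star => exact ⟨fun _ _ => trivial, by simp, .inl ⟨j, hj, trivial⟩⟩
  | pos => exact (hx rfl).elim
  | bdd =>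
    simp only [Exp.adm] at ha
    have h3 : ∀ i ∈ l, i ≤ N + 2 := fun i hi => by
      have := List.le_sum_of_mem hi
      omega
    exact ⟨h3, fun _ => by omega, .inl ⟨j, hj, h3 j hj⟩⟩
  | unb =>
    refine ⟨fun _ _ => trivial, by simp, ?_⟩
    simp only [Exp.adm] at ha
    by_contra! hc
    obtain ⟨h3, h4⟩ := hc
    have h4 := h4 rfl
    have h5 : l.sum ≤ l.length * (t - 1) := List.sum_le_length_mul fun i hi => by
      have := h3 i hi
      simp only [Exp.adm] at this
      omega
    obtain ⟨t, rfl⟩ : ∃ k, t = k + 1 := ⟨t - 1, by omega⟩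
    have h6 : l.length * (t + 1) < (t + 1) * (t + 1) := Nat.mul_lt_mul_of_pos_right h4 (by omega)
    simp only [Nat.add_sub_cancel] at h5
    rw [Nat.mul_add, Nat.mul_one] at h6
    omega

/-! ### The graph of steps -/

section Graph

variable {F : Set (Fam α)} {e f a b : Fam α} {x y : Exp} {hB hS : Prop}

open Classical in
/-- Steps between vertices that record whether certificates have been obtained. -/
noncomputable def edge (e f a b : Fam α) (x y : Exp) (v w : Node F × (Bool × Bool)) : Fam α :=
  if v.2 ≤ w.2 then step e f a b v.1 w.1 (e.pw (x.at v.2.1 w.2.1)) (f.pw (y.at v.2.2 w.2.2)) else 0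

theorem Chain.exists_path {N m : ℕ} {v : Node F} {cs : List (ℕ × ℕ)} {z : List α}
    (h : Chain e f a b N m v cs z) (hx : ∀ i ∈ cs.map Prod.fst, x.weak.adm N m i)
    (hy : ∀ j ∈ cs.map Prod.snd, y.weak.adm N m j) (s s' : Bool × Bool)
    (h1 : Certified x N m s.1 s'.1 (cs.map Prod.fst))
    (h2 : Certified y N m s.2 s'.2 (cs.map Prod.snd)) :
    ∃ t, IsPath (v, s) t (.fin, s') ∧ t.length = cs.length ∧
      z ∈ (t.map fun p => edge e f a b x y p.1 p.2 N m).prod := by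
  induction h generalizing s with
  | nil =>
    refine ⟨[], ?_, rfl, rfl⟩
    rcases h1 with h1 | ⟨-, -, i, hi, -⟩
    · rcases h2 with h2 | ⟨-, -, i, hi, -⟩
      · exact congrArg _ (Prod.ext h1 h2)
      · cases hi
    · cases hi
  | @cons v w i j cs u z hu hz ih =>
    obtain ⟨s1, hs1, a1, c1⟩ := h1.cons (hx i (by simp))
    obtain ⟨s2, hs2, a2, c2⟩ := h2.cons (hy j (by simp))
    obtain ⟨t, ht, hlen, hzt⟩ := ih (fun i hi => hx i (List.mem_cons_of_mem _ hi))
      (fun i hi => hy i (List.mem_cons_of_mem _ hi)) (s1, s2) c1 c2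
    refine ⟨((v, s), (w, (s1, s2))) :: t, ⟨rfl, ht⟩, by simp [hlen], ?_⟩
    rw [List.map_cons, List.prod_cons]
    refine Language.append_mem_mul ?_ hzt
    rw [edge, if_pos (show s ≤ (s1, s2) from ⟨hs1, hs2⟩)]
    exact step_mem_imp (fun z hz => ⟨i, a1, hz⟩) (fun z hz => ⟨j, a2, hz⟩) hu

theorem exists_chain_of_path {N m : ℕ} {v : Node F × (Bool × Bool)} {s' : Bool × Bool}
    {t : List ((Node F × (Bool × Bool)) × (Node F × (Bool × Bool)))} {z : List α}
    (ht : IsPath v t (.fin, s')) (hz : z ∈ (t.map fun p => edge e f a b x y p.1 p.2 N m).prod) :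
    ∃ cs, Chain e f a b N m v.1 cs z ∧ cs.length = t.length ∧
      (∀ i ∈ cs.map Prod.fst, x.weak.adm N m i) ∧ (∀ j ∈ cs.map Prod.snd, y.weak.adm N m j) ∧
      (v.2.1 = false → s'.1 = true → ∃ i ∈ cs.map Prod.fst, x.adm N m i) ∧
      (v.2.2 = false → s'.2 = true → ∃ j ∈ cs.map Prod.snd, y.adm N m j) := by
  induction t generalizing v z with
  | nil =>
    obtain rfl : v = _ := ht
    obtain rfl : z = [] := hz
    exact ⟨[], Chain.nil, rfl, by simp, by simp, by simp +contextual, by simp +contextual⟩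
  | cons p t ih =>
    obtain ⟨rfl, ht⟩ := ht
    rw [List.map_cons, List.prod_cons] at hz
    obtain ⟨u, hu, z, hz, rfl⟩ := hz
    obtain ⟨cs, hch, hlen, g1, g2, g3, g4⟩ := ih ht hz
    rw [edge] at hu
    split_ifs at hu with hle
    · obtain ⟨i, j, hi, hj, hu⟩ := exists_of_mem_step hu
      refine ⟨(i, j) :: cs, Chain.cons hu hch, by simp [hlen], ?_, ?_, ?_, ?_⟩
      · rw [List.map_cons, List.forall_mem_cons]
        exact ⟨hi.at_weak, g1⟩
      · rw [List.map_cons, List.forall_mem_cons]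
        exact ⟨hj.at_weak, g2⟩
      · exact hi.certificate_cons g3
      · exact hj.certificate_cons g4
    · exact (Language.notMem_zero _ hu).elim

/-- The exponent for the number of steps. -/
def Exp.steps : Exp → Exp → Exp
  | .bdd, _ | _, .bdd => .bdd
  | _, _ => .star

theorem Exp.steps_eq (x y : Exp) : x.steps y = .bdd ∧ (x = .bdd ∨ y = .bdd) ∨
    x.steps y = .star ∧ x ≠ .bdd ∧ y ≠ .bdd := by
  cases x <;> cases y <;> simp [Exp.steps]

/-- The words along the paths in the graph of steps. -/
noncomputable def stepsFam (F : Set (Fam α)) (e f a b : Fam α) (x y : Exp) : Fam α :=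
  pathFam (x.steps y) (edge e f a b x y) ((.init : Node F), (false, false)) (.fin, (true, true)) +
    ⨆ _ : x ≠ .bdd ∧ y ≠ .bdd ∧ (x = .unb ∨ y = .unb),
      pathFam .unb (edge e f a b x y) ((.init : Node F), (false, false)) (.fin, (false, false))

/-- Either both certificates were obtained, or the path itself has at least `m` edges. In the second
case both numbers of factors are large, and neither exponent demands a bound. -/
theorem stepsFam_dom (hF : SplitClosed F) (he : e ∈ F) (hb : b ∈ F) (hf : f.Mono)
    (hx : x ≠ .pos) (hy : y ≠ .pos) :
    Dom (stepsFam F e f a b x y) ((a * (e.pw x * b)) ⊓ f.pw y) := by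
  intro N
  have := hF.finite.to_subtype
  have hT : Tendsto (fun m => m - 2) atTop atTop := tendsto_sub_atTop_nat 2
  have E3 : ∀ᶠ p : Par in atTop, ∀ l c r : F, Dom (l.1 * (c.1 * r.1)) e →
      ∀ m, (l.1 * (c.1 * r.1)) N m ≤ e p.N (p.φ m) := by
    simp only [eventually_all]
    exact fun _ _ _ h => h N
  have E2 : ∀ q : Fam α, ∀ᶠ p : Par in atTop, ∀ l c : F, Dom (l.1 * c.1) q →
      ∀ m, (l.1 * c.1) N m ≤ q p.N (p.φ m) := by
    intro q
    simp only [eventually_all]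
    exact fun _ _ h => h N
  filter_upwards [E3, E2 a, E2 b, Par.eventually_le (N * N + N) hT, Par.eventually_id N] with
    p g1 g2 g3 g4 g5 m
  have key : ∀ s' : Bool × Bool, ∀ t z, IsPath ((.init : Node F), (false, false)) t (.fin, s') →
      z ∈ (t.map fun p => edge e f a b x y p.1 p.2 N m).prod →
      (x = .bdd ∨ y = .bdd → t.length ≤ N) →
      ((s'.1 = true ∧ s'.2 = true) ∨ m ≤ t.length) →
      z ∈ ((a * (e.pw x * b)) ⊓ f.pw y) p.N (p.φ m) := by
    intro s' t z ht hz hlen hs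
    obtain ⟨cs, hch, hcl, c1, c2, c3, c4⟩ := exists_chain_of_path ht hz
    obtain ⟨i, j, ci, cj, ni, nj, hr1, hr2⟩ := hch.sound (A := a p.N (p.φ m)) (B := b p.N (p.φ m))
      (E := e p.N (p.φ m)) (G := f p.N (p.φ m)) (hF.mono e he g5.1 (g5.2 m)) (hf g5.1 (g5.2 m))
      (hF.mono b hb g5.1 (g5.2 m)) (fun l c r h => g1 l c r h m) (fun l c h => g3 l c h m)
      (fun c r h => g2 c r h m)
    rw [← hcl] at hlen hs
    have hadm : ∀ {x' : Exp} {l : List ℕ} {n : ℕ}, x' ≠ .pos → Counts l n → l.length = cs.length →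
        cs.length ≤ n + 2 → (∀ i ∈ l, x'.weak.adm N m i) → (x' = .bdd → cs.length ≤ N) →
        (m ≤ cs.length ∨ ∃ i ∈ l, x'.adm N m i) → x'.adm p.N (p.φ m) n := by
      intro x' l n hx' hc hl hn hw hb' hu
      refine (hc.adm hx' (by omega) hw (by simpa [hl] using hb') ?_).mono g4.1 (g4.2 m)
      rintro rfl
      rw [hl]
      exact hu
    obtain ⟨u, hu, _, ⟨v, hv, w, hw, rfl⟩, rfl⟩ := hr1
    refine ⟨⟨u, hu, _, ⟨v, ⟨i, hadm hx ci (by simp) ni c1 (fun h => hlen (.inl h)) ?_, hv⟩,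
      w, hw, rfl⟩, rfl⟩, ⟨j, hadm hy cj (by simp) nj c2 (fun h => hlen (.inr h)) ?_, hr2⟩⟩
    · exact hs.symm.imp_right fun h => c3 rfl h.1
    · exact hs.symm.imp_right fun h => c4 rfl h.2
  rintro z (⟨t, ht, hadm, hz⟩ | hz)
  · refine key _ t z ht hz (fun h => ?_) (.inl ⟨rfl, rfl⟩)
    rcases Exp.steps_eq x y with ⟨h1, -⟩ | ⟨-, h1, h2⟩
    · rw [h1] at hadm
      exact hadm
    · exact (h.elim h1 h2).elim
  · obtain ⟨⟨h1, h2, -⟩, t, ht, hadm, hz⟩ := mem_iSup_fam.1 hz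
    exact key _ t z ht hz (fun h => (h.elim h1 h2).elim) (.inr hadm)

/-- If one exponent is `bdd`, the number of steps is bounded, so largeness for the other one must
show in a single summand and both certificates exist. Otherwise a missing certificate means that
there are many steps, which is the second summand of `stepsFam`. -/
theorem dom_stepsFam (hF : SplitClosed F) (he : e ∈ F) (ha : a ∈ F) (hb : b ∈ F) (hf : f.Mono)
    (hx : x ≠ .pos) (hy : y ≠ .pos) :
    Dom ((a * (e.pw x * b)) ⊓ f.pw y) (stepsFam F e f a b x y) := by
  intro N
  -- With at most `N + 2` steps, `√m` steps can occur only if `√m ≤ N + 2`. Subtracting `N + 2`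
  -- makes the threshold 0 there, so any summand is a certificate.
  have hT : Tendsto (fun m => Nat.sqrt m - (N + 2)) atTop atTop :=
    (tendsto_sub_atTop_nat (N + 2)).comp tendsto_sqrt
  filter_upwards [hF.complete N, hF.complete₃ N, Par.eventually_le (N + 2) hT,
    Par.eventually_id N] with p g2 g3 g4 g5 m
  rintro z ⟨⟨u, hu, _, ⟨v, ⟨i, hi, hv⟩, w, hw, rfl⟩, rfl⟩, ⟨j, hj, hz⟩⟩
  have split : ∀ q ∈ F, ∀ u v, u ++ v ∈ q N m → ∃ l c : F, Dom (l.1 * c.1) q ∧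
      u ∈ l.1 p.N (p.φ m) ∧ v ∈ c.1 p.N (p.φ m) := by
    intro q hq u v huv
    obtain ⟨l, hl, r, hr, h⟩ := g2 q hq m u v huv
    exact ⟨⟨l, hl⟩, ⟨r, hr⟩, h⟩
  obtain ⟨cs, hne, hch, ci, cj, ni, nj⟩ := Chain.complete_init (F := F) (a := a)
    (A := a N m) (B := b N m) (E := e N m) (G := f N m)
    (hF.mono e he g5.1 (g5.2 m)) (hf g5.1 (g5.2 m)) (hF.mono b hb g5.1 (g5.2 m)) (by
      intro u v w huvw
      obtain ⟨l, hl, c, hc, r, hr, h⟩ := g3 e he m u v w huvw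
      exact ⟨⟨l, hl⟩, ⟨c, hc⟩, ⟨r, hr⟩, h⟩) (split b hb) (split a ha)
    (Language.append_mem_mul hu (Language.append_mem_mul hv hw)) hz
  have hφ : p.φ m ≤ Nat.sqrt m - (N + 2) := g4.2 m
  have lift : ∀ {x' : Exp} {k : ℕ}, x'.adm (N + 2) (Nat.sqrt m) k → x'.adm p.N (p.φ m) k :=
    fun h => h.mono g4.1 (hφ.trans (Nat.sub_le _ _))
  have ht := Nat.sqrt_le m
  obtain ⟨wx, bx, cx⟩ := ci.certificate (by simpa using hne) (by simpa using ni) hi ht hx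
  obtain ⟨wy, by', cy⟩ := cj.certificate (by simpa using hne) (by simpa using nj) hj ht hy
  simp only [List.length_map] at bx by' cx cy
  have hpath := fun s' => hch.exists_path (fun i hi => lift (wx i hi))
    (fun i hi => lift (wy i hi)) (false, false) s' (x := x) (y := y)
  have left : (∃ i ∈ cs.map Prod.fst, x.adm p.N (p.φ m) i) →
      (∃ j ∈ cs.map Prod.snd, y.adm p.N (p.φ m) j) →
      u ++ (v ++ w) ∈ stepsFam F e f a b x y p.N (p.φ m) := by
    rintro ⟨i, hi, hi'⟩ ⟨j, hj, hj'⟩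
    obtain ⟨t, ht, hlen, hz⟩ := hpath (true, true) (.inr ⟨rfl, rfl, i, hi, hi'⟩)
      (.inr ⟨rfl, rfl, j, hj, hj'⟩)
    refine .inl ⟨t, ht, ?_, hz⟩
    rcases Exp.steps_eq x y with ⟨h1, h2⟩ | ⟨h1, -, -⟩
    · rw [h1, Exp.adm, hlen]
      exact (h2.elim bx by').trans g4.1
    · rw [h1]
      trivial
  by_cases hbd : x = .bdd ∨ y = .bdd
  · have hlen : cs.length ≤ N + 2 := hbd.elim bx by'
    have certify : ∀ {x' : Exp} {l : List ℕ}, l.length = cs.length →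
        ((∃ i ∈ l, x'.adm (N + 2) (Nat.sqrt m) i) ∨ (x' = .unb ∧ Nat.sqrt m ≤ cs.length)) →
        ∃ i ∈ l, x'.adm p.N (p.φ m) i := by
      rintro x' l hl (⟨i, hi, h⟩ | ⟨rfl, h⟩)
      · exact ⟨i, hi, lift h⟩
      · obtain ⟨k, hk⟩ := List.exists_mem_of_ne_nil l (by
          rintro rfl
          exact hne (List.length_eq_zero_iff.1 hl.symm))
        exact ⟨k, hk, by simp only [Exp.adm]; omega⟩
    exact left (certify (by simp) cx) (certify (by simp) cy)
  · push Not at hbd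
    rcases cx with cx | ⟨h1, h2⟩
    · rcases cy with cy | ⟨h1, h2⟩
      · exact left (cx.imp fun _ h => ⟨h.1, lift h.2⟩) (cy.imp fun _ h => ⟨h.1, lift h.2⟩)
      · obtain ⟨t, ht, hlen, hz⟩ := hpath (false, false) (.inl rfl) (.inl rfl)
        exact .inr (mem_iSup_fam.2 ⟨⟨hbd.1, hbd.2, .inr h1⟩, t, ht, (hφ.trans (Nat.sub_le _ _)).trans (h2.trans hlen.ge), hz⟩)
    · obtain ⟨t, ht, hlen, hz⟩ := hpath (false, false) (.inl rfl) (.inl rfl)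
      exact .inr (mem_iSup_fam.2 ⟨⟨hbd.1, hbd.2, .inl h1⟩, t, ht, (hφ.trans (Nat.sub_le _ _)).trans (h2.trans hlen.ge), hz⟩)

theorem definable_step (hF : F.Finite) (hb : b ∈ F) (hm : ∀ q ∈ F, q.Mono) (he : e.Mono)
    (hf : f.Mono) (hef : ∀ x', x' = .star ∨ x' = x → ∀ r ∈ F, ∀ l ∈ F,
      Definable hB hS ((r * (e.pw x' * l)) ⊓ f))
    (hff : ∀ y', y' = .star ∨ y' = y → ∀ c ∈ F, Definable hB hS (c ⊓ f.pw y'))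
    (v w : Node F) {x' y' : Exp} (hx' : x' = .star ∨ x' = x) (hy' : y' = .star ∨ y' = y) :
    Definable hB hS (step e f a b v w (e.pw x') (f.pw y')) := by
  have := hF.to_subtype
  have one : ∀ {q : Fam α}, q.Mono → Definable hB hS (1 ⊓ q) := fun hq =>
    definable_of_le_word (mono_one.inf hq) [] fun N m => inf_le_left
  cases v with
  | init =>
    cases w with
    | st r => exact Definable.iSup fun c => Definable.iSup_prop fun _ =>
        (hff y' hy' c c.2).mul (one (he.pw x'))
    | _ => exact definable_zero
  | st r =>
    cases w with
    | st s => exact Definable.iSup fun l => Definable.iSup fun c => Definable.iSup_prop fun _ =>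
        (hef x' hx' r r.2 l l.2).mul (hff y' hy' c c.2)
    | fin =>
      refine (Definable.iSup fun l : F => Definable.iSup fun c : F => Definable.iSup_prop fun _ =>
        (hef x' hx' r r.2 l l.2).mul (hff y' hy' c c.2)).add (Definable.mul ?_ (one (hf.pw y')))
      rw [inf_comm]
      exact one ((hm r r.2).mul ((he.pw x').mul (hm b hb)))
    | init => exact definable_zero
  | fin => cases w <;> exact definable_zero

/-- The labels of the graph intersect a power of `e` with a single factor of `f`, or a piece in `F`
with a power of `f`. These are the simpler intersections `hef` and `hff`, supplied by the induction.
-/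
theorem definable_inf_pw (hF : SplitClosed F) (he : e ∈ F) (ha : a ∈ F) (hb : b ∈ F) (hf : f.Mono)
    (hx : x ≠ .pos) (hy : y ≠ .pos) (hxo : x.Ok hB hS) (hyo : y.Ok hB hS)
    (hef : ∀ x', x' = .star ∨ x' = x → ∀ r ∈ F, ∀ l ∈ F,
      Definable hB hS ((r * (e.pw x' * l)) ⊓ f))
    (hff : ∀ y', y' = .star ∨ y' = y → ∀ c ∈ F, Definable hB hS (c ⊓ f.pw y')) :
    Definable hB hS ((a * (e.pw x * b)) ⊓ f.pw y) := by
  have := Node.finite hF.finite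
  have hedge : ∀ v w : Node F × (Bool × Bool), Definable hB hS (edge e f a b x y v w) := by
    intro v w
    rw [edge]
    split_ifs
    · exact definable_step hF.finite hb hF.mono (hF.mono e he) hf hef hff _ _ (x.at_eq _ _)
        (y.at_eq _ _)
    · exact definable_zero
  refine Definable.congr (p := stepsFam F e f a b x y) ?_
    (((hF.mono a ha).mul (((hF.mono e he).pw x).mul (hF.mono b hb))).inf (hf.pw y))
    (stepsFam_dom hF he hb hf hx hy) (dom_stepsFam hF he ha hb hf hx hy)
  refine (definable_pathFam hedge ?_ _ _).add (Definable.iSup_prop fun h =>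
    definable_pathFam hedge ?_ _ _)
  · rcases Exp.steps_eq x y with ⟨h, rfl | rfl⟩ | ⟨h, -⟩ <;> rw [h]
    exacts [hxo, hyo, trivial]
  · rcases h.2.2 with rfl | rfl
    exacts [hxo, hyo]

end Graph

/-! ### Intersections of expressions -/

section Inter

variable {hB hS : Prop}

/-- All families of pieces of words of the two expressions have definable intersections. -/
def Compatible (hB hS : Prop) (e f : BSExpr α) : Prop :=
  ∀ p ∈ e.fac, ∀ q ∈ f.fac, Definable hB hS (p ⊓ q)

theorem Compatible.symm {e f : BSExpr α} (h : Compatible hB hS e f) : Compatible hB hS f e :=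
  fun p hp q hq => by rw [inf_comm]; exact h q hq p hp

theorem compatible_of_le_word {e f : BSExpr α}
    (h : ∀ p ∈ e.fac, ∃ z, ∀ N m, p N m ≤ {z}) : Compatible hB hS e f := by
  intro p hp q hq
  obtain ⟨z, hz⟩ := h p hp
  exact definable_of_le_word ((e.fac_spec.1.mono p hp).inf (f.fac_spec.1.mono q hq)) z
    fun N m => inf_le_left.trans (hz N m)

theorem one_le_word (N m : ℕ) : (1 : Fam α) N m ≤ {[]} := le_rfl

theorem compatible_empty (f : BSExpr α) : Compatible hB hS .empty f := by
  refine compatible_of_le_word ?_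
  rintro _ (rfl | rfl)
  exacts [⟨[], fun N m => bot_le⟩, ⟨[], one_le_word⟩]

theorem compatible_eps (f : BSExpr α) : Compatible hB hS .eps f := by
  refine compatible_of_le_word ?_
  rintro _ rfl
  exact ⟨[], one_le_word⟩

theorem compatible_finEps (f : BSExpr α) : Compatible hB hS .finEps f := by
  refine compatible_of_le_word ?_
  rintro _ (rfl | rfl)
  · refine ⟨[], fun N m => ?_⟩
    simp only [BSExpr.fam]
    split_ifs
    exacts [one_le_word N m, bot_le]
  · exact ⟨[], one_le_word⟩

theorem compatible_letter (c : α) (f : BSExpr α) : Compatible hB hS (.letter c) f := by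
  refine compatible_of_le_word ?_
  rintro _ (rfl | rfl)
  exacts [⟨[c], fun N m => le_rfl⟩, ⟨[], one_le_word⟩]

theorem Compatible.comp {e e' f : BSExpr α} (h : Compatible hB hS e f)
    (h' : Compatible hB hS e' f) : Compatible hB hS (.comp e e') f := by
  rintro _ ⟨p, hp, p', hp', rfl⟩ q hq
  exact f.fac_spec.1.definable_mul_inf hq (e.fac_spec.1.mono p hp) (e'.fac_spec.1.mono p' hp')
    (fun l hl => h p hp l hl) (fun l hl => h' p' hp' l hl)

theorem Compatible.plus {e e' f : BSExpr α} (h : Compatible hB hS e f)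
    (h' : Compatible hB hS e' f) : Compatible hB hS (.plus e e') f := by
  rintro _ (rfl | hp | hp) q hq
  · have : (e.fam + e'.fam) ⊓ q = (e.fam ⊓ q) + (e'.fam ⊓ q) := by
      funext N m
      exact inf_sup_right (a := e.fam N m) (b := e'.fam N m) (c := q N m)
    rw [this]
    exact (h _ e.fac_spec.2 q hq).add (h' _ e'.fac_spec.2 q hq)
  · exact h _ hp q hq
  · exact h' _ hp q hq

/-- `e'` denotes the power of `e` with exponent `x`. -/
def BSExpr.IsPower (e : BSExpr α) (x : Exp) (e' : BSExpr α) : Prop :=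
  x ≠ .pos ∧ e'.fac = facPw e.fac e.fam x

/-- First a piece of `e'` meets a bare power of `f`, by the graph of steps. A general piece `c *
(f^y' * d)` of `f'` is then reduced to this by cutting the words of `e'` at its two boundaries. -/
theorem compatible_powers {e e' f f' : BSExpr α} {x y : Exp} (he : e.IsPower x e')
    (hf : f.IsPower y f') (hx : x.Ok hB hS) (hy : y.Ok hB hS) (h1 : Compatible hB hS e f')
    (h2 : Compatible hB hS e' f) : Compatible hB hS e' f' := by
  obtain ⟨hxp, hE⟩ := he
  obtain ⟨hyp, hF⟩ := hf
  have sE := e'.fac_spec.1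
  have sF := f'.fac_spec.1
  have okE : ∀ x', x' = .star ∨ x' = x → x' ≠ .pos ∧ x'.Ok hB hS := by
    rintro x' (rfl | rfl)
    exacts [⟨by simp, trivial⟩, ⟨hxp, hx⟩]
  have okF : ∀ y', y' = .star ∨ y' = y → y' ≠ .pos ∧ y'.Ok hB hS := by
    rintro y' (rfl | rfl)
    exacts [⟨by simp, trivial⟩, ⟨hyp, hy⟩]
  have power : ∀ y', y' = .star ∨ y' = y → f.fam.pw y' ∈ f'.fac := fun y' hy' => by
    rw [hF]
    exact .inr ⟨1, f.fac_spec.1.one_mem, y', hy', 1, f.fac_spec.1.one_mem, by simp⟩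
  have base : ∀ p ∈ e'.fac, ∀ y', y' = .star ∨ y' = y → Definable hB hS (p ⊓ f.fam.pw y') := by
    intro p hp y' hy'
    have hp' := hp
    rw [hE] at hp'
    rcases hp' with hp' | ⟨a, ha, x', hx', b, hb, rfl⟩
    · exact h1 p hp' _ (power y' hy')
    · refine definable_inf_pw e.fac_spec.1 e.fac_spec.2 ha hb f.mono_fam (okE x' hx').1
        (okF y' hy').1 (okE x' hx').2 (okF y' hy').2 ?_ ?_
      · intro x'' hx'' r hr l hl
        refine h2 _ ?_ _ f.fac_spec.2
        rw [hE]
        exact .inr ⟨r, hr, x'', hx''.elim .inl (· ▸ hx'), l, hl, rfl⟩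
      · exact fun y'' hy'' c hc => h1 c hc _ (power y'' (hy''.elim .inl (· ▸ hy')))
  intro p hp q hq
  have hq' := hq
  rw [hF] at hq'
  rcases hq' with hq' | ⟨c, hc, y', hy', d, hd, rfl⟩
  · exact h2 p hp q hq'
  · rw [inf_comm]
    have mc := f.fac_spec.1.mono c hc
    have md := f.fac_spec.1.mono d hd
    have my := f.mono_fam.pw y'
    refine sE.definable_mul_inf hp mc (my.mul md) (fun l hl => ?_) (fun l hl => ?_)
    · exact h2.symm c hc l hl
    · refine sE.definable_mul_inf hl my md (fun r hr => ?_) (fun r hr => ?_)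
      · rw [inf_comm]
        exact base r hr y' hy'
      · exact h2.symm d hd r hr

theorem BSExpr.Allowed.exponents {e : BSExpr α} :
    ((BSExpr.star e).Allowed hB hS → e.Allowed hB hS) ∧
    ((BSExpr.expB e).Allowed hB hS → e.Allowed hB hS ∧ hB) ∧
    ((BSExpr.expS e).Allowed hB hS → e.Allowed hB hS ∧ hS) := by
  simp only [BSExpr.Allowed, BSExpr.AvoidsB, BSExpr.AvoidsS]
  tauto

theorem BSExpr.Allowed.args {e f : BSExpr α} :
    ((BSExpr.comp e f).Allowed hB hS → e.Allowed hB hS ∧ f.Allowed hB hS) ∧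
    ((BSExpr.plus e f).Allowed hB hS → e.Allowed hB hS ∧ f.Allowed hB hS) := by
  simp only [BSExpr.Allowed, BSExpr.AvoidsB, BSExpr.AvoidsS]
  tauto

/-- The inner induction, on the second expression. In the case of two powers it supplies `e'`
against the base `f`, while `ih` supplies `e` against the power of `f`. -/
theorem compatible_power {e e' : BSExpr α} {x : Exp} (he : e.IsPower x e') (hx : x.Ok hB hS)
    (ih : ∀ f : BSExpr α, f.Allowed hB hS → Compatible hB hS e f) :
    ∀ f : BSExpr α, f.Allowed hB hS → Compatible hB hS e' f := by
  intro f hf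
  induction f with
  | empty => exact (compatible_empty e').symm
  | eps => exact (compatible_eps e').symm
  | finEps => exact (compatible_finEps e').symm
  | letter c => exact (compatible_letter c e').symm
  | comp f g ihf ihg =>
    obtain ⟨h1, h2⟩ := BSExpr.Allowed.args.1 hf
    exact ((ihf h1).symm.comp (ihg h2).symm).symm
  | plus f g ihf ihg =>
    obtain ⟨h1, h2⟩ := BSExpr.Allowed.args.2 hf
    exact ((ihf h1).symm.plus (ihg h2).symm).symm
  | star f ihf =>
    exact compatible_powers he (f := f) (y := .star) ⟨by simp, rfl⟩ hx trivial (ih _ hf)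
      (ihf (BSExpr.Allowed.exponents.1 hf))
  | expB f ihf =>
    obtain ⟨h1, h2⟩ := BSExpr.Allowed.exponents.2.1 hf
    exact compatible_powers he (f := f) (y := .bdd) ⟨by simp, rfl⟩ hx h2 (ih _ hf) (ihf h1)
  | expS f ihf =>
    obtain ⟨h1, h2⟩ := BSExpr.Allowed.exponents.2.2 hf
    exact compatible_powers he (f := f) (y := .unb) ⟨by simp, rfl⟩ hx h2 (ih _ hf) (ihf h1)

theorem compatible_of_allowed {e f : BSExpr α} (he : e.Allowed hB hS) (hf : f.Allowed hB hS) :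
    Compatible hB hS e f := by
  induction e generalizing f with
  | empty => exact compatible_empty f
  | eps => exact compatible_eps f
  | finEps => exact compatible_finEps f
  | letter c => exact compatible_letter c f
  | comp e e' ih ih' =>
    obtain ⟨h1, h2⟩ := BSExpr.Allowed.args.1 he
    exact (ih h1 hf).comp (ih' h2 hf)
  | plus e e' ih ih' =>
    obtain ⟨h1, h2⟩ := BSExpr.Allowed.args.2 he
    exact (ih h1 hf).plus (ih' h2 hf)
  | star e ih =>
    exact compatible_power (e := e) (x := .star) ⟨by simp, rfl⟩ trivial
      (fun f hf => ih (BSExpr.Allowed.exponents.1 he) hf) f hf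
  | expB e ih =>
    obtain ⟨h1, h2⟩ := BSExpr.Allowed.exponents.2.1 he
    exact compatible_power (e := e) (x := .bdd) ⟨by simp, rfl⟩ h2 (fun f hf => ih h1 hf) f hf
  | expS e ih =>
    obtain ⟨h1, h2⟩ := BSExpr.Allowed.exponents.2.2 he
    exact compatible_power (e := e) (x := .unb) ⟨by simp, rfl⟩ h2 (fun f hf => ih h1 hf) f hf

end Inter

/-! ### Word sequences of a family -/

/-- The word sequences whose words lie in the family for a fixed upper threshold and lower
thresholds that tend to infinity. -/
def Fam.seqs (q : Fam α) : Set (WordSeq α) :=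
  {w | ∃ (N : ℕ) (f : ℕ → ℕ), Tendsto f atTop atTop ∧
    ∀ i x, w.get? i = some x → x ∈ q N (f i)}

/-- Diagonal choice: `f i` is the greatest `M ≤ i` with `P i M`. -/
theorem exists_tendsto_of_eventually {P : ℕ → ℕ → Prop} (h0 : ∀ i, P i 0)
    (h : ∀ M, ∀ᶠ i in atTop, P i M) : ∃ f : ℕ → ℕ, Tendsto f atTop atTop ∧ ∀ i, P i (f i) := by
  classical
  refine ⟨fun i => Nat.findGreatest (P i) i, ?_, fun i =>
    Nat.findGreatest_spec (Nat.zero_le i) (h0 i)⟩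
  rw [tendsto_atTop]
  intro b
  filter_upwards [h b, eventually_ge_atTop b] with i h1 h2 using Nat.le_findGreatest h2 h1

open Classical in
/-- The sequence of the values of `F` on a downward closed set of indices. -/
noncomputable def seqOn {β : Type*} (p : ℕ → Prop) (hp : ∀ n, p (n + 1) → p n) (F : ℕ → β) :
    Stream'.Seq β :=
  ⟨fun n => if p n then some (F n) else none, fun {n} hn => by
    simp only [ite_eq_right_iff, reduceCtorEq, imp_false] at hn ⊢
    exact fun h => hn (hp n h)⟩

open Classical in
theorem get?_seqOn {β : Type*} (p : ℕ → Prop) (hp : ∀ n, p (n + 1) → p n) (F : ℕ → β) (n : ℕ) :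
    (seqOn p hp F).get? n = if p n then some (F n) else none := rfl

theorem get?_seqOn_eq_some {β : Type*} {p : ℕ → Prop} {hp : ∀ n, p (n + 1) → p n} {F : ℕ → β}
    {n : ℕ} {x : β} : (seqOn p hp F).get? n = some x ↔ p n ∧ F n = x := by
  rw [get?_seqOn]
  split_ifs with h <;> simp [h]

theorem get?_seqOn_eq_none {β : Type*} {p : ℕ → Prop} {hp : ∀ n, p (n + 1) → p n} {F : ℕ → β}
    {n : ℕ} : (seqOn p hp F).get? n = none ↔ ¬ p n := by
  rw [get?_seqOn]
  split_ifs with h <;> simp [h]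

theorem le_length'_iff {β : Type*} {s : Stream'.Seq β} {n : ℕ} :
    (n : ℕ∞) ≤ s.length' ↔ ∀ k < n, s.get? k ≠ none := by
  cases n with
  | zero => simp
  | succ n =>
    rw [show ((n + 1 : ℕ) : ℕ∞) ≤ s.length' ↔ (n : ℕ∞) < s.length' from
      (by rw [Nat.cast_add, Nat.cast_one]; exact ENat.add_one_le_iff (ENat.natCast_ne_top n)),
      ← not_le, Stream'.Seq.length'_le_iff]
    constructor
    · intro h k hk h'
      exact h (s.le_stable (by omega) h')
    · exact fun h => h n (Nat.lt_succ_self n)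

theorem length'_eq_of_get?_eq_none {β γ : Type*} {s : Stream'.Seq β} {t : Stream'.Seq γ}
    (h : ∀ n, s.get? n = none ↔ t.get? n = none) : s.length' = t.length' := by
  refine ENat.eq_of_forall_natCast_le_iff fun n => ?_
  simp only [le_length'_iff, ne_eq, h]

theorem seqs_zero : (0 : Fam α).seqs = {Stream'.Seq.nil} := by
  ext w
  constructor
  · rintro ⟨N, f, -, h⟩
    refine Stream'.Seq.ext fun n => ?_
    rw [Stream'.Seq.get?_nil]
    by_contra hn
    obtain ⟨x, hx⟩ := Option.ne_none_iff_exists'.1 hn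
    exact Language.notMem_zero _ (h n x hx)
  · rintro rfl
    exact ⟨0, id, tendsto_id, fun i x h => by simp at h⟩

theorem seqs_word (x : List α) : Fam.seqs (fun _ _ => ({x} : Language α)) = constSeqs x := by
  ext w
  exact ⟨fun ⟨N, f, _, h⟩ => h, fun h => ⟨0, id, tendsto_id, h⟩⟩

theorem seqs_finEps : (BSExpr.finEps : BSExpr α).fam.seqs =
    {w | w ∈ constSeqs [] ∧ w.Terminates} := by
  ext w
  constructor
  · rintro ⟨N, f, hf, h⟩
    have h' : ∀ i x, w.get? i = some x → f i = 0 ∧ x = [] := by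
      intro i x hx
      have h1 := h i x hx
      simp only [BSExpr.fam] at h1
      split_ifs at h1 with h0
      · exact ⟨h0, h1⟩
      · exact (Language.notMem_zero _ h1).elim
    refine ⟨fun i x hx => (h' i x hx).2, ?_⟩
    obtain ⟨n, hn⟩ := (tendsto_atTop.1 hf 1).exists
    refine ⟨n, ?_⟩
    change w.get? n = none
    by_contra hx
    obtain ⟨x, hx⟩ := Option.ne_none_iff_exists'.1 hx
    have := (h' n x hx).1
    omega
  · rintro ⟨h, n, hn⟩
    refine ⟨0, fun i => if i < n then 0 else i, ?_, fun i x hx => ?_⟩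
    · rw [tendsto_atTop]
      intro b
      filter_upwards [eventually_ge_atTop (max b n)] with m hm
      rw [if_neg (by omega)]
      omega
    · have hi : i < n := by
        by_contra hi
        have := w.le_stable (not_lt.1 hi) hn
        rw [hx] at this
        cases this
      simp only [BSExpr.fam, hi, if_true]
      exact h i x hx

theorem seqs_mul {p q : Fam α} (hp : p.Mono) (hq : q.Mono) :
    (p * q).seqs = concat p.seqs q.seqs := by
  ext w
  constructor
  · rintro ⟨N, f, hf, h⟩
    have : ∀ i, ∃ u v : List α, ∀ x, w.get? i = some x →
        u ∈ p N (f i) ∧ v ∈ q N (f i) ∧ u ++ v = x := by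
      intro i
      cases hx : w.get? i with
      | none => exact ⟨[], [], by simp⟩
      | some x =>
        obtain ⟨u, hu, v, hv, rfl⟩ := h i x hx
        exact ⟨u, v, fun y hy => by cases hy; exact ⟨hu, hv, rfl⟩⟩
    choose u v huv using this
    have hdom : ∀ n, w.get? (n + 1) ≠ none → w.get? n ≠ none :=
      fun n hn h' => hn (w.le_stable (Nat.le_succ n) h')
    refine ⟨seqOn (fun n => w.get? n ≠ none) hdom u, ⟨N, f, hf, ?_⟩, seqOn (fun n => w.get? n ≠ none) hdom v, ⟨N, f, hf, ?_⟩, ?_, ?_⟩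
    · intro i x hx
      obtain ⟨h1, rfl⟩ := get?_seqOn_eq_some.1 hx
      obtain ⟨y, hy⟩ := Option.ne_none_iff_exists'.1 h1
      exact (huv i y hy).1
    · intro i x hx
      obtain ⟨h1, rfl⟩ := get?_seqOn_eq_some.1 hx
      obtain ⟨y, hy⟩ := Option.ne_none_iff_exists'.1 h1
      exact (huv i y hy).2.1
    · exact length'_eq_of_get?_eq_none fun n => by simp only [get?_seqOn_eq_none]
    · refine Stream'.Seq.ext fun n => ?_
      rw [Stream'.Seq.get?_zipWith, get?_seqOn, get?_seqOn]
      split_ifs with hn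
      · obtain ⟨y, hy⟩ := Option.ne_none_iff_exists'.1 hn
        simp [hy, (huv n y hy).2.2]
      · simpa using hn
  · rintro ⟨u, ⟨N, f, hf, hu⟩, v, ⟨N', f', hf', hv⟩, -, rfl⟩
    refine ⟨max N N', fun i => min (f i) (f' i), tendsto_min hf hf', fun i x hx => ?_⟩
    rw [Stream'.Seq.get?_zipWith] at hx
    obtain ⟨y, z, hy, hz, rfl⟩ := Option.map₂_eq_some_iff.1 hx
    exact Language.append_mem_mul (hp (le_max_left _ _) (min_le_left _ _) (hu i y hy))
      (hq (le_max_right _ _) (min_le_right _ _) (hv i z hz))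

/-- Positions of `w` whose word does not belong to `q` are filled with the next word of `w` that
does; the sequence ends when there is none. Looking forward, never back, keeps the lower thresholds
tending to infinity and the length at most that of `w`. -/
theorem exists_padding {q : Fam α} {w : WordSeq α} {N : ℕ} {f : ℕ → ℕ}
    (hf : Tendsto f atTop atTop) : ∃ u ∈ q.seqs, (∀ i, u.get? i ≠ none → w.get? i ≠ none) ∧
      ∀ i x, w.get? i = some x → x ∈ q N (f i) → u.get? i = some x := by
  classical
  let p : ℕ → Prop := fun i => ∃ j, i ≤ j ∧ ∃ x, w.get? j = some x ∧ x ∈ q N (f j)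
  have hp : ∀ n, p (n + 1) → p n := fun n ⟨j, hj, h⟩ => ⟨j, by omega, h⟩
  let nxt : ℕ → ℕ := fun i => if h : p i then Nat.find h else i
  have hnxt : ∀ i, i ≤ nxt i := by
    intro i
    simp only [nxt]
    split_ifs with h
    exacts [(Nat.find_spec h).1, le_rfl]
  refine ⟨seqOn p hp fun i => (w.get? (nxt i)).getD [], ⟨N, f ∘ nxt, ?_, ?_⟩, ?_, ?_⟩
  · exact hf.comp (tendsto_atTop_mono hnxt tendsto_id)
  · intro i x hx
    obtain ⟨h1, rfl⟩ := get?_seqOn_eq_some.1 hx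
    obtain ⟨-, y, hy, hy'⟩ := Nat.find_spec h1
    have : nxt i = Nat.find h1 := dif_pos h1
    simp only [Function.comp, this, hy]
    exact hy'
  · intro i hi hi'
    rw [ne_eq, get?_seqOn_eq_none, not_not] at hi
    obtain ⟨j, hj, x, hx, -⟩ := hi
    rw [w.le_stable hj hi'] at hx
    cases hx
  · intro i x hx hq
    have h1 : p i := ⟨i, le_rfl, x, hx, hq⟩
    have h2 : nxt i = i := by
      have : nxt i = Nat.find h1 := dif_pos h1
      exact le_antisymm (this.trans_le (Nat.find_min' h1 ⟨le_rfl, x, hx, hq⟩)) (hnxt i)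
    rw [get?_seqOn_eq_some]
    simp [h1, h2, hx]

theorem seqs_add {p q : Fam α} (hp : p.Mono) (hq : q.Mono) :
    (p + q).seqs = mix p.seqs q.seqs := by
  ext w
  constructor
  · rintro ⟨N, f, hf, h⟩
    obtain ⟨u, hu, hu1, hu2⟩ := exists_padding (q := p) (w := w) (N := N) hf
    obtain ⟨v, hv, hv1, hv2⟩ := exists_padding (q := q) (w := w) (N := N) hf
    have key : ∀ i x, w.get? i = some x → u.get? i = some x ∨ v.get? i = some x :=
      fun i x hx => (h i x hx).imp (hu2 i x hx) (hv2 i x hx)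
    refine ⟨u, hu, v, hv, ?_, key⟩
    refine ENat.eq_of_forall_natCast_le_iff fun n => ?_
    rw [le_max_iff, le_length'_iff, le_length'_iff, le_length'_iff]
    constructor
    · intro h'
      cases n with
      | zero => simp
      | succ n =>
        obtain ⟨x, hx⟩ := Option.ne_none_iff_exists'.1 (h' n (Nat.lt_succ_self n))
        refine (key n x hx).imp ?_ ?_
        · intro h1 k hk h2
          rw [u.le_stable (Nat.lt_succ_iff.1 hk) h2] at h1
          cases h1
        · intro h1 k hk h2
          rw [v.le_stable (Nat.lt_succ_iff.1 hk) h2] at h1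
          cases h1
    · rintro (h' | h') k hk
      exacts [hu1 k (h' k hk), hv1 k (h' k hk)]
  · rintro ⟨u, ⟨N, f, hf, hu⟩, v, ⟨N', f', hf', hv⟩, -, h⟩
    refine ⟨max N N', fun i => min (f i) (f' i), tendsto_min hf hf', fun i x hx => ?_⟩
    exact (h i x hx).imp (fun h => hp (le_max_left _ _) (min_le_left _ _) (hu i x h))
      (fun h => hq (le_max_right _ _) (min_le_right _ _) (hv i x h))

/-! ### Groupings -/

/-- The condition that an exponent imposes on the differences of a grouping. -/
def Exp.Cond : Exp → NatSeq → Prop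
  | .bdd, g => g.diff.Bounded
  | .unb, g => g.diff.FiniteOrToInfinity
  | _, _ => True

/-- The groupings of members of a language permitted by an exponent. -/
def powExp (L : Set (WordSeq α)) (x : Exp) : Set (WordSeq α) :=
  {w | ∃ u ∈ L, ∃ g : NatSeq, g.Groups u ∧ x.Cond g ∧ w = u.group g}

theorem get?_group {u : WordSeq α} {g : NatSeq} {i : ℕ} {x : List α} :
    (u.group g).get? i = some x ↔ ∃ a n, (Stream'.Seq.cons 0 g).get? i = some a ∧
      g.get? i = some n ∧ u.block a n = x := by
  rw [WordSeq.group, Stream'.Seq.get?_zipWith, Option.map₂_eq_some_iff]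
  simp [Option.mem_def]

theorem get?_diff {g : NatSeq} {i d : ℕ} : g.diff.get? i = some d ↔
    ∃ m n, g.get? i = some m ∧ g.get? (i + 1) = some n ∧ n - m = d := by
  rw [NatSeq.diff, Stream'.Seq.get?_zipWith, Option.map₂_eq_some_iff]
  simp [Option.mem_def]

theorem block_mem_pow {u : WordSeq α} {L : Language α} {a n : ℕ}
    (h : ∀ k, a ≤ k → k < n → ∃ x, u.get? k = some x ∧ x ∈ L) : u.block a n ∈ L ^ (n - a) := by
  have key : ∀ d a, (∀ k, a ≤ k → k < a + d → ∃ x, u.get? k = some x ∧ x ∈ L) →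
      ((List.range' a d).filterMap u.get?).flatten ∈ L ^ d := by
    intro d
    induction d with
    | zero => intro a _; rw [pow_zero]; rfl
    | succ d ih =>
      intro a h
      obtain ⟨x, hx, hL⟩ := h a le_rfl (by omega)
      rw [List.range'_succ, List.filterMap_cons_some hx, List.flatten_cons, pow_succ']
      exact Language.append_mem_mul hL (ih (a + 1) fun k h1 h2 => h k (by omega) (by omega))
  exact key (n - a) a fun k h1 h2 => h k h1 (by omega)

theorem NatSeq.NonDecreasing.prev_le {g : NatSeq} (hg : g.NonDecreasing) {i j n a : ℕ}
    (hij : i < j) (hi : g.get? i = some n) (hj : (Stream'.Seq.cons 0 g).get? j = some a) :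
    n ≤ a := by
  obtain ⟨j, rfl⟩ : ∃ k, j = k + 1 := ⟨j - 1, by omega⟩
  rw [Stream'.Seq.get?_cons_succ] at hj
  exact hg i j n a (by omega) hi hj

/-- Either `g` exceeds every bound, so late blocks start late, or it is bounded, so late blocks are
empty. -/
theorem eventually_block {g : NatSeq} (hg : g.NonDecreasing) (K : ℕ) :
    ∀ᶠ i in atTop, ∀ a n, (Stream'.Seq.cons 0 g).get? i = some a → g.get? i = some n →
      n ≤ a ∨ K ≤ a := by
  induction K with
  | zero => exact Eventually.of_forall fun i a n _ _ => .inr (Nat.zero_le a)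
  | succ K ih =>
    by_cases h : ∃ i n, g.get? i = some n ∧ K + 1 ≤ n
    · obtain ⟨i, n, hi, hn⟩ := h
      filter_upwards [eventually_gt_atTop i] with j hj a n' ha _
      exact .inr (hn.trans (hg.prev_le hj hi ha))
    · push Not at h
      filter_upwards [ih] with i hi a n ha hn
      have h1 := h i n hn
      have h2 := hi a n ha hn
      omega

/-- A lower threshold `M` is met at late positions: the factors there have large thresholds by
`eventually_block`, and the block lengths are admissible by the condition on differences. -/
theorem powExp_subset_seqs {q : Fam α} (hq : q.Mono) {x : Exp} (hx : x ≠ .pos) :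
    powExp q.seqs x ⊆ (q.pw x).seqs := by
  rintro _ ⟨u, ⟨N, f, hf, hu⟩, g, ⟨hg, hgu⟩, hc, rfl⟩
  have factors : ∀ {i a n M N'}, (Stream'.Seq.cons 0 g).get? i = some a → g.get? i = some n →
      N ≤ N' → (∀ k, a ≤ k → k < n → M ≤ f k) → u.block a n ∈ q N' M ^ (n - a) := by
    intro i a n M N' ha hn hN h
    refine block_mem_pow fun k h1 h2 => ?_
    obtain ⟨y, hy⟩ := Option.ne_none_iff_exists'.1 (le_length'_iff.1 (hgu i n hn) k h2)
    exact ⟨y, hy, hq hN (h k h1 h2) (hu k y hy)⟩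
  have adm0 : ∃ N', N ≤ N' ∧ ∀ i a n, (Stream'.Seq.cons 0 g).get? i = some a →
      g.get? i = some n → x.adm N' 0 (n - a) := by
    cases x with
    | star => exact ⟨N, le_rfl, fun _ _ _ _ _ => trivial⟩
    | pos => exact (hx rfl).elim
    | unb => exact ⟨N, le_rfl, fun _ _ _ _ _ => Nat.zero_le _⟩
    | bdd =>
      obtain ⟨M, hM⟩ := hc
      -- The length `g 0` of the first block is not a difference of `g` and has to be bounded
      -- separately.
      refine ⟨max N (max M ((g.get? 0).getD 0)), le_max_left _ _, fun i a n ha hn => ?_⟩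
      cases i with
      | zero => simp [Exp.adm, hn]
      | succ i =>
        rw [Stream'.Seq.get?_cons_succ] at ha
        have := hM i (n - a) (get?_diff.2 ⟨a, n, ha, hn, rfl⟩)
        simp only [Exp.adm]
        omega
  obtain ⟨N', hN, h0⟩ := adm0
  have admM : ∀ M, ∀ᶠ i in atTop, ∀ a n, (Stream'.Seq.cons 0 g).get? i = some a →
      g.get? i = some n → x.adm N' M (n - a) := by
    intro M
    cases x with
    | star => exact Eventually.of_forall fun _ _ _ _ _ => trivial
    | pos => exact (hx rfl).elim
    | bdd => exact Eventually.of_forall h0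
    | unb =>
      obtain ⟨K, hK⟩ := hc M
      filter_upwards [eventually_gt_atTop K] with i hi a n ha hn
      obtain ⟨i, rfl⟩ : ∃ k, i = k + 1 := ⟨i - 1, by omega⟩
      rw [Stream'.Seq.get?_cons_succ] at ha
      exact hK i (n - a) (by omega) (get?_diff.2 ⟨a, n, ha, hn, rfl⟩)
  obtain ⟨f', hf', h⟩ := exists_tendsto_of_eventually
    (P := fun i M => ∀ y, (u.group g).get? i = some y → y ∈ q.pw x N' M) (by
      rintro i y hy
      obtain ⟨a, n, ha, hn, rfl⟩ := get?_group.1 hy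
      exact ⟨n - a, h0 i a n ha hn, factors ha hn hN fun _ _ _ => Nat.zero_le _⟩) (by
      intro M
      obtain ⟨K, hK⟩ := eventually_atTop.1 (tendsto_atTop.1 hf M)
      filter_upwards [eventually_block hg K, admM M] with i h1 h2 y hy
      obtain ⟨a, n, ha, hn, rfl⟩ := get?_group.1 hy
      refine ⟨n - a, h2 a n ha hn, factors ha hn hN fun k hk hk' => ?_⟩
      rcases h1 a n ha hn with h1 | h1
      · omega
      · exact hK k (h1.trans hk))
  exact ⟨N', f', hf', h⟩

/-- The total length of the lists up to an index. -/
def totalLength {β : Type*} (ls : ℕ → List β) (i : ℕ) : ℕ :=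
  ∑ j ∈ Finset.range i, (ls j).length

theorem totalLength_succ {β : Type*} (ls : ℕ → List β) (i : ℕ) :
    totalLength ls (i + 1) = totalLength ls i + (ls i).length := Finset.sum_range_succ _ _

theorem totalLength_mono {β : Type*} (ls : ℕ → List β) : Monotone (totalLength ls) :=
  monotone_nat_of_le_succ fun i => by rw [totalLength_succ]; omega

/-- Here `idx k` is the list that contributes the entry `k`. The total length may be finite; beyond
it the values of `u` are arbitrary. -/
theorem exists_concatenation {β : Type*} [Nonempty β] (ls : ℕ → List β) :
    ∃ (u : ℕ → β) (idx : ℕ → ℕ), (∀ k, (∃ i, k < totalLength ls i) →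
        k < totalLength ls (idx k + 1) ∧ u k ∈ ls (idx k)) ∧
      ∀ i k (h : k < (ls i).length), u (totalLength ls i + k) = (ls i)[k] := by
  classical
  obtain ⟨d⟩ := ‹Nonempty β›
  let idx : ℕ → ℕ := fun k =>
    if h : ∃ i, k < totalLength ls (i + 1) then Nat.find h else 0
  have hidx : ∀ i k, k < (ls i).length → idx (totalLength ls i + k) = i := by
    intro i k hk
    have h : ∃ j, totalLength ls i + k < totalLength ls (j + 1) :=
      ⟨i, by rw [totalLength_succ]; omega⟩
    rw [show idx _ = Nat.find h from dif_pos h, Nat.find_eq_iff]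
    refine ⟨by rw [totalLength_succ]; omega, fun j hj => ?_⟩
    have := totalLength_mono ls (show j + 1 ≤ i from hj)
    omega
  refine ⟨fun k => ((ls (idx k))[k - totalLength ls (idx k)]?).getD d, idx, ?_, ?_⟩
  · rintro k ⟨i, hi⟩
    have h : ∃ j, k < totalLength ls (j + 1) :=
      ⟨i, hi.trans_le (totalLength_mono ls (Nat.le_succ i))⟩
    have h1 : idx k = Nat.find h := dif_pos h
    have h2 := Nat.find_spec h
    rw [← h1] at h2
    refine ⟨h2, ?_⟩
    have h3 : totalLength ls (idx k) ≤ k := by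
      cases hj : idx k with
      | zero => simp [totalLength]
      | succ j => exact not_lt.1 (Nat.find_min h (m := j) (by omega))
    rw [totalLength_succ] at h2
    have h4 : k - totalLength ls (idx k) < (ls (idx k)).length := by omega
    simp only [List.getElem?_eq_getElem h4, Option.getD_some]
    exact List.getElem_mem h4
  · intro i k hk
    simp only [hidx i k hk, Nat.add_sub_cancel_left, List.getElem?_eq_getElem hk, Option.getD_some]

/-- Factor every word of `w`, line up all factors as one sequence `u`, and let `g` mark where the
words of `w` end. The differences of `g` are then the numbers of factors. -/
theorem seqs_subset_powExp {q : Fam α} {x : Exp} (hx : x ≠ .pos) :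
    (q.pw x).seqs ⊆ powExp q.seqs x := by
  rintro w ⟨N, f, hf, h⟩
  have : ∀ i, ∃ l : List (List α), (∀ y ∈ l, y ∈ q N (f i)) ∧ (w.get? i = none → l = []) ∧
      ∀ z, w.get? i = some z → l.flatten = z ∧ x.adm N (f i) l.length := by
    intro i
    cases hz : w.get? i with
    | none => exact ⟨[], by simp, by simp, by simp⟩
    | some z =>
      obtain ⟨k, hk, hz'⟩ := h i z hz
      obtain ⟨l, rfl, rfl, hl⟩ := Language.mem_pow.1 hz'
      refine ⟨l, hl, by simp, ?_⟩
      rintro _ ⟨⟩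
      exact ⟨rfl, hk⟩
  choose ls hls hnone hsome using this
  obtain ⟨u, idx, hu, hget⟩ := exists_concatenation ls
  let p : ℕ → Prop := fun k => ∃ i, k < totalLength ls i
  have hp : ∀ n, p (n + 1) → p n := fun n ⟨i, hi⟩ => ⟨i, by omega⟩
  have hdom : ∀ n, w.get? (n + 1) ≠ none → w.get? n ≠ none :=
    fun n hn h' => hn (w.le_stable (Nat.le_succ n) h')
  classical
  let g : NatSeq := seqOn (fun n => w.get? n ≠ none) hdom fun i => totalLength ls (i + 1)
  have hgsome : ∀ {i n}, g.get? i = some n ↔ w.get? i ≠ none ∧ totalLength ls (i + 1) = n :=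
    get?_seqOn_eq_some
  have hblock : ∀ i, WordSeq.block (seqOn p hp u) (totalLength ls i) (totalLength ls (i + 1)) =
      (ls i).flatten := by
    intro i
    have h1 : ∀ k, k < (ls i).length → (seqOn p hp u).get? (totalLength ls i + k) = (ls i)[k]? := by
      intro k hk
      rw [List.getElem?_eq_getElem hk, get?_seqOn_eq_some]
      exact ⟨⟨i + 1, by rw [totalLength_succ]; omega⟩, hget i k hk⟩
    rw [WordSeq.block, totalLength_succ, Nat.add_sub_cancel_left]
    congr 1
    have key : ∀ (l : List (List α)) (a : ℕ),
        (∀ k, k < l.length → (seqOn p hp u).get? (a + k) = l[k]?) →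
        (List.range' a l.length).filterMap (seqOn p hp u).get? = l := by
      intro l
      induction l with
      | nil => intro a _; rfl
      | cons y l ih =>
        intro a h
        have h0 : (seqOn p hp u).get? a = some y := by simpa using h 0 (by simp)
        rw [List.length_cons, List.range'_succ, List.filterMap_cons_some h0]
        congr 1
        refine ih (a + 1) fun k hk => ?_
        have := h (k + 1) (by simpa using hk)
        rw [List.getElem?_cons_succ] at this
        rw [← this]
        congr 1
        omega
    exact key (ls i) _ h1
  -- A factor inherits the lower threshold of its group. Past the end of `u` the value is
  -- irrelevant, but it must tend to infinity.
  refine ⟨seqOn p hp u, ⟨N, fun k => if p k then f (idx k) else k, ?_, ?_⟩, g, ⟨?_, ?_⟩, ?_, ?_⟩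
  · rw [tendsto_atTop]
    intro b
    obtain ⟨i0, hi0⟩ := eventually_atTop.1 (tendsto_atTop.1 hf b)
    filter_upwards [eventually_ge_atTop (totalLength ls i0), eventually_ge_atTop b] with k h1 h2
    split_ifs with hk
    · refine hi0 _ ?_
      by_contra hlt
      have := totalLength_mono ls (show idx k + 1 ≤ i0 by omega)
      have := (hu k hk).1
      omega
    · exact h2
  · intro k z hz
    obtain ⟨hk, rfl⟩ := get?_seqOn_eq_some.1 hz
    simp only [hk, if_true]
    exact hls _ _ (hu k hk).2
  · intro i j m n hij hi hj
    obtain ⟨-, rfl⟩ := hgsome.1 hi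
    obtain ⟨-, rfl⟩ := hgsome.1 hj
    exact totalLength_mono ls (by omega)
  · intro i n hi
    obtain ⟨-, rfl⟩ := hgsome.1 hi
    rw [le_length'_iff]
    intro k hk
    rw [ne_eq, get?_seqOn_eq_none, not_not]
    exact ⟨i + 1, hk⟩
  · have hdiff : ∀ i d, g.diff.get? i = some d → x.adm N (f (i + 1)) d := by
      intro i d hd
      obtain ⟨m, n, hm, hn, rfl⟩ := get?_diff.1 hd
      obtain ⟨-, rfl⟩ := hgsome.1 hm
      obtain ⟨h1, rfl⟩ := hgsome.1 hn
      obtain ⟨z, hz⟩ := Option.ne_none_iff_exists'.1 h1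
      rw [totalLength_succ ls (i + 1), Nat.add_sub_cancel_left]
      exact (hsome _ z hz).2
    cases x with
    | star => trivial
    | pos => exact (hx rfl).elim
    | bdd => exact ⟨N, hdiff⟩
    | unb =>
      intro M
      obtain ⟨K, hK⟩ := eventually_atTop.1 (tendsto_atTop.1 hf M)
      exact ⟨K, fun i d hi hd => (hK (i + 1) (by omega)).trans (hdiff i d hd)⟩
  · have hprev : ∀ i, w.get? i ≠ none →
        (Stream'.Seq.cons 0 g).get? i = some (totalLength ls i) := by
      intro i hi
      cases i with
      | zero => simp [totalLength]
      | succ i =>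
        rw [Stream'.Seq.get?_cons_succ]
        exact hgsome.2 ⟨hdom i hi, rfl⟩
    refine Stream'.Seq.ext fun i => ?_
    cases hz : w.get? i with
    | some z =>
      have hi : w.get? i ≠ none := by simp [hz]
      refine (get?_group.2 ⟨_, _, hprev i hi, hgsome.2 ⟨hi, rfl⟩, ?_⟩).symm
      rw [hblock i]
      exact (hsome i z hz).1
    | none =>
      symm
      by_contra hne
      obtain ⟨z, hz'⟩ := Option.ne_none_iff_exists'.1 hne
      obtain ⟨a, n, -, hn, -⟩ := get?_group.1 hz'
      exact (hgsome.1 hn).1 hz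

theorem seqs_pw {q : Fam α} (hq : q.Mono) {x : Exp} (hx : x ≠ .pos) :
    (q.pw x).seqs = powExp q.seqs x :=
  (seqs_subset_powExp hx).antisymm (powExp_subset_seqs hq hx)

theorem BSExpr.sem_eq_seqs (e : BSExpr α) : e.sem = e.fam.seqs := by
  induction e with
  | empty => exact seqs_zero.symm
  | eps => exact (seqs_word []).symm
  | finEps => exact seqs_finEps.symm
  | letter a => exact (seqs_word [a]).symm
  | comp e f he hf =>
    rw [BSExpr.sem, he, hf]
    exact (seqs_mul e.mono_fam f.mono_fam).symm
  | plus e f he hf =>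
    rw [BSExpr.sem, he, hf]
    exact (seqs_add e.mono_fam f.mono_fam).symm
  | star e he =>
    rw [BSExpr.sem, he, BSExpr.fam, seqs_pw e.mono_fam (by simp)]
    simp [starExp, powExp, Exp.Cond]
  | expB e he =>
    rw [BSExpr.sem, he, BSExpr.fam, seqs_pw e.mono_fam (by simp)]
    rfl
  | expS e he =>
    rw [BSExpr.sem, he, BSExpr.fam, seqs_pw e.mono_fam (by simp)]
    rfl

/-! ### Regular languages of finite words -/

/-- A regular expression as a `BS`-regular expression. -/
def BSExpr.ofRegular : RegularExpression α → BSExpr α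
  | .zero => .empty
  | .epsilon => .eps
  | .char a => .letter a
  | .plus r s => .plus (ofRegular r) (ofRegular s)
  | .comp r s => .comp (ofRegular r) (ofRegular s)
  | .star r => .star (ofRegular r)

theorem BSExpr.allowed_ofRegular {hB hS : Prop} (r : RegularExpression α) :
    (ofRegular r).Allowed hB hS := by
  have : (ofRegular r).AvoidsB ∧ (ofRegular r).AvoidsS := by
    induction r with
    | zero => exact ⟨trivial, trivial⟩
    | epsilon => exact ⟨trivial, trivial⟩
    | char a => exact ⟨trivial, trivial⟩
    | plus r s hr hs => exact ⟨⟨hr.1, hs.1⟩, ⟨hr.2, hs.2⟩⟩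
    | comp r s hr hs => exact ⟨⟨hr.1, hs.1⟩, ⟨hr.2, hs.2⟩⟩
    | star r hr => exact hr
  exact ⟨.inr this.1, .inr this.2⟩

theorem mem_kstar_iff_pow {L : Language α} {z : List α} : z ∈ L∗ ↔ ∃ k, z ∈ L ^ k := by
  rw [Language.kstar_eq_iSup_pow, Language.mem_iSup]

theorem BSExpr.fam_ofRegular (r : RegularExpression α) (N m : ℕ) :
    (ofRegular r).fam N m = r.matches' := by
  induction r with
  | zero => rfl
  | epsilon => rfl
  | char a => rfl
  | plus r s hr hs =>
    change (ofRegular r).fam N m + (ofRegular s).fam N m = r.matches' + s.matches'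
    rw [hr, hs]
  | comp r s hr hs =>
    change (ofRegular r).fam N m * (ofRegular s).fam N m = r.matches' * s.matches'
    rw [hr, hs]
  | star r hr =>
    ext z
    change (∃ k, True ∧ z ∈ (ofRegular r).fam N m ^ k) ↔ z ∈ r.matches'∗
    rw [hr, mem_kstar_iff_pow]
    simp

/-! ### Families without thresholds: the regular language of all words -/

/-- All words of a family. -/
def Fam.words (q : Fam α) : Language α := {z | ∃ N, z ∈ q N 0}

theorem Dom.words_le {q q' : Fam α} (h : Dom q q') (hq' : q'.Mono) : q.words ≤ q'.words := by
  rintro z ⟨N, hz⟩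
  obtain ⟨N', ψ, -, h⟩ := h.exists N
  exact ⟨N', hq' le_rfl (Nat.zero_le _) (h 0 hz)⟩

theorem words_add (p q : Fam α) : (p + q).words = p.words + q.words := by
  ext z
  constructor
  · rintro ⟨N, h | h⟩
    exacts [.inl ⟨N, h⟩, .inr ⟨N, h⟩]
  · rintro (⟨N, h⟩ | ⟨N, h⟩)
    exacts [⟨N, .inl h⟩, ⟨N, .inr h⟩]

theorem words_mul {p q : Fam α} (hp : p.Mono) (hq : q.Mono) :
    (p * q).words = p.words * q.words := by
  ext z
  constructor
  · rintro ⟨N, u, hu, v, hv, rfl⟩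
    exact ⟨u, ⟨N, hu⟩, v, ⟨N, hv⟩, rfl⟩
  · rintro ⟨u, ⟨N, hu⟩, v, ⟨N', hv⟩, rfl⟩
    exact ⟨max N N', u, hp (le_max_left _ _) le_rfl hu, v, hq (le_max_right _ _) le_rfl hv, rfl⟩

theorem words_pw {q : Fam α} (hq : q.Mono) {x : Exp} (hx : x ≠ .pos) :
    (q.pw x).words = q.words∗ := by
  ext z
  rw [mem_kstar_iff_pow]
  constructor
  · rintro ⟨N, k, -, hz⟩
    exact ⟨k, pow_le_pow_left' (show q N 0 ≤ q.words from fun z hz => ⟨N, hz⟩) k hz⟩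
  · rintro ⟨k, hz⟩
    have key : ∃ N, z ∈ q N 0 ^ k := by
      induction k generalizing z with
      | zero => exact ⟨0, hz⟩
      | succ k ih =>
        rw [pow_succ'] at hz
        obtain ⟨u, ⟨N, hu⟩, v, hv, rfl⟩ := hz
        obtain ⟨N', hv⟩ := ih v hv
        refine ⟨max N N', ?_⟩
        rw [pow_succ']
        exact ⟨u, hq (le_max_left _ _) le_rfl hu, v,
          pow_le_pow_left' (hq (le_max_right _ _) le_rfl) k hv, rfl⟩
    obtain ⟨N, hz⟩ := key
    refine ⟨max N k, k, ?_, pow_le_pow_left' (hq (le_max_left _ _) le_rfl) k hz⟩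
    cases x with
    | star => trivial
    | pos => exact (hx rfl).elim
    | bdd => exact le_max_right _ _
    | unb => exact Nat.zero_le _

/-- A regular expression for the words of a `BS`-regular expression. -/
def BSExpr.toRegular : BSExpr α → RegularExpression α
  | .empty => .zero
  | .eps => .epsilon
  | .finEps => .epsilon
  | .letter a => .char a
  | .comp e f => .comp e.toRegular f.toRegular
  | .plus e f => .plus e.toRegular f.toRegular
  | .star e => .star e.toRegular
  | .expB e => .star e.toRegular
  | .expS e => .star e.toRegular

theorem words_const (L : Language α) : Fam.words (fun _ _ => L) = L := by
  ext z
  exact ⟨fun ⟨_, h⟩ => h, fun h => ⟨0, h⟩⟩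

theorem BSExpr.matches'_toRegular (e : BSExpr α) : e.toRegular.matches' = e.fam.words := by
  induction e with
  | empty => exact (words_const _).symm
  | eps => exact (words_const _).symm
  | finEps =>
    ext z
    exact ⟨fun h => ⟨0, h⟩, fun ⟨_, h⟩ => h⟩
  | letter a => exact (words_const _).symm
  | comp e f he hf =>
    change e.toRegular.matches' * f.toRegular.matches' = _
    rw [he, hf, BSExpr.fam, words_mul e.mono_fam f.mono_fam]
  | plus e f he hf =>
    change e.toRegular.matches' + f.toRegular.matches' = _
    rw [he, hf, BSExpr.fam, words_add]
  | star e he | expB e he | expS e he =>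
    change e.toRegular.matches'∗ = _
    rw [he, BSExpr.fam, words_pw e.mono_fam (by simp)]

/-! ### Segments of ω-words -/

/-- The segment of `w` from position `a` to position `b`. -/
def seg (w : Stream' α) (a b : ℕ) : List α := (w.drop a).take (b - a)

theorem length_seg (w : Stream' α) (a b : ℕ) : (seg w a b).length = b - a :=
  Stream'.length_take _ _

theorem take_add (w : Stream' α) (m n : ℕ) : w.take (m + n) = w.take m ++ (w.drop m).take n := by
  induction m generalizing w with
  | zero => simp
  | succ m ih =>
    rw [show m + 1 + n = (m + n) + 1 by omega, Stream'.take_succ, ih, Stream'.take_succ,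
      List.cons_append]
    rfl

theorem seg_append {w : Stream' α} {a b c : ℕ} (hab : a ≤ b) (hbc : b ≤ c) :
    seg w a b ++ seg w b c = seg w a c := by
  unfold seg
  rw [show c - a = (b - a) + (c - b) by omega, take_add, Stream'.drop_drop,
    show a + (b - a) = b by omega]

theorem seg_self (w : Stream' α) (a : ℕ) : seg w a a = [] :=
  List.length_eq_zero_iff.1 (by rw [length_seg, Nat.sub_self])

theorem seg_eq_append {w : Stream' α} {a b : ℕ} {x y : List α} (hab : a ≤ b)
    (h : seg w a b = x ++ y) :
    a + x.length ≤ b ∧ seg w a (a + x.length) = x ∧ seg w (a + x.length) b = y := by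
  have h1 : b - a = x.length + y.length := by rw [← length_seg w, h, List.length_append]
  have h2 : a + x.length ≤ b := by omega
  have h3 := seg_append (w := w) (Nat.le_add_right a x.length) h2
  rw [h] at h3
  obtain ⟨h4, h5⟩ := List.append_inj h3 (by rw [length_seg]; omega)
  exact ⟨h2, h4, h5⟩

theorem exists_of_seg_mem_mul {w : Stream' α} {a b : ℕ} (hab : a ≤ b) {L L' : Language α}
    (h : seg w a b ∈ L * L') :
    ∃ c, a ≤ c ∧ c ≤ b ∧ seg w a c ∈ L ∧ seg w c b ∈ L' := by
  obtain ⟨x, hx, y, hy, hxy⟩ := h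
  obtain ⟨h1, h2, h3⟩ := seg_eq_append hab hxy.symm
  exact ⟨a + x.length, by omega, h1, by rw [h2]; exact hx, by rw [h3]; exact hy⟩

theorem seg_mem_mul {w : Stream' α} {a b c : ℕ} (hab : a ≤ b) (hbc : b ≤ c) {L L' : Language α}
    (h : seg w a b ∈ L) (h' : seg w b c ∈ L') : seg w a c ∈ L * L' := by
  rw [← seg_append hab hbc]
  exact Language.append_mem_mul h h'

theorem seg_mem_pow {w : Stream' α} {c : ℕ → ℕ} (hc : Monotone c) {L : Language α} {i j : ℕ}
    (hij : i ≤ j) (h : ∀ k, i ≤ k → k < j → seg w (c k) (c (k + 1)) ∈ L) :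
    seg w (c i) (c j) ∈ L ^ (j - i) := by
  induction j, hij using Nat.le_induction with
  | base => rw [seg_self, Nat.sub_self, pow_zero]; rfl
  | succ j hij ih =>
    rw [show j + 1 - i = (j - i) + 1 by omega, pow_succ]
    exact seg_mem_mul (hc hij) (hc (Nat.le_succ j)) (ih fun k h1 h2 => h k h1 (by omega))
      (h j hij (Nat.lt_succ_self j))

/-! ### Infinite factorizations of ω-words -/

/-- From position `s` on, `w` is cut into infinitely many words of `q`. -/
def IsCut (q : Fam α) (w : Stream' α) (s : ℕ) : Prop :=
  ∃ (N : ℕ) (f c : ℕ → ℕ), Tendsto f atTop atTop ∧ Monotone c ∧ Tendsto c atTop atTop ∧ c 0 = s ∧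
    ∀ i, seg w (c i) (c (i + 1)) ∈ q N (f i)

theorem IsCut.of_dom {q q' : Fam α} (h : Dom q q') {w : Stream' α} {s : ℕ} (hw : IsCut q w s) :
    IsCut q' w s := by
  obtain ⟨N, f, c, hf, hc, hc', h0, hq⟩ := hw
  obtain ⟨N', ψ, hψ, h⟩ := h.exists N
  exact ⟨N', ψ ∘ f, c, hψ.comp hf, hc, hc', h0, fun i => h _ (hq i)⟩

theorem tendsto_of_frequently_lt {c : ℕ → ℕ} (hc : Monotone c)
    (h : ∀ n, ∃ i ≥ n, c i < c (i + 1)) : Tendsto c atTop atTop := by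
  refine tendsto_atTop_atTop_of_monotone hc fun b => ?_
  induction b with
  | zero => exact ⟨0, Nat.zero_le _⟩
  | succ b ih =>
    obtain ⟨a, ha⟩ := ih
    obtain ⟨i, hi, hlt⟩ := h a
    exact ⟨i + 1, (Nat.succ_le_succ (ha.trans (hc hi))).trans hlt⟩

theorem frequently_lt_of_tendsto {c : ℕ → ℕ} (hc : Tendsto c atTop atTop) (n : ℕ) : ∃ i ≥ n, c i < c (i + 1) := by
  by_contra! h
  have h1 : ∀ i ≥ n, c i ≤ c n := by
    intro i hi
    induction i, hi using Nat.le_induction with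
    | base => exact le_rfl
    | succ i hi ih => exact (h i hi).trans ih
  obtain ⟨i, hi1, hi2⟩ := ((tendsto_atTop.1 hc (c n + 1)).and (eventually_ge_atTop n)).exists
  have := h1 i hi2
  omega

theorem block_succ {u : WordSeq α} {n : ℕ} {x : List α} (h : u.get? n = some x) :
    u.block 0 (n + 1) = u.block 0 n ++ x := by
  simp only [WordSeq.block, Nat.sub_zero, List.range'_1_concat, Nat.zero_add]
  rw [List.filterMap_append, List.flatten_append]
  simp [h]

/-- Infinitely many nonempty words means exactly that the cut positions tend to infinity. -/
theorem mem_omegaPower {q : Fam α} {w : Stream' α} :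
    w ∈ omegaPower q.seqs ↔ IsCut q w 0 := by
  constructor
  · rintro ⟨u, ⟨N, f, hf, hu⟩, h1, h2⟩
    have hsome : ∀ i, ∃ x, u.get? i = some x := by
      intro i
      obtain ⟨j, hj, x, hx, -⟩ := h1 i
      refine Option.ne_none_iff_exists'.1 fun h => ?_
      rw [u.le_stable hj h] at hx
      cases hx
    choose x hx using hsome
    have hlen : ∀ i, (u.block 0 (i + 1)).length = (u.block 0 i).length + (x i).length := fun i => by
      rw [block_succ (hx i), List.length_append]
    have hmono : Monotone fun i => (u.block 0 i).length := monotone_nat_of_le_succ fun i => by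
      rw [hlen]; omega
    refine ⟨N, f, fun i => (u.block 0 i).length, hf, hmono, ?_, rfl, fun i => ?_⟩
    · refine tendsto_of_frequently_lt hmono fun n => ?_
      obtain ⟨i, hi, y, hy, hne⟩ := h1 n
      rw [hx i] at hy
      cases hy
      have := List.length_pos_of_ne_nil hne
      have := hlen i
      exact ⟨i, hi, by omega⟩
    · have h3 := h2 (i + 1)
      rw [hlen, take_add, h2 i, block_succ (hx i)] at h3
      have h4 := List.append_cancel_left h3
      have h5 := hlen i
      simp only [seg]
      rw [show (u.block 0 (i + 1)).length - (u.block 0 i).length = (x i).length by omega, h4]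
      exact hu i _ (hx i)
  · rintro ⟨N, f, c, hf, hc, hc', h0, hq⟩
    let u : WordSeq α := seqOn (fun _ => True) (fun _ _ => trivial) fun i => seg w (c i) (c (i + 1))
    have hu : ∀ i, u.get? i = some (seg w (c i) (c (i + 1))) :=
      fun i => get?_seqOn_eq_some.2 ⟨trivial, rfl⟩
    have hblock : ∀ n, u.block 0 n = seg w 0 (c n) := by
      intro n
      induction n with
      | zero => rw [h0, seg_self]; rfl
      | succ n ih => rw [block_succ (hu n), ih, seg_append (Nat.zero_le _) (hc (Nat.le_succ n))]
    refine ⟨u, ⟨N, f, hf, fun i x hx => ?_⟩, fun n => ?_, fun n => ?_⟩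
    · rw [hu i] at hx
      cases hx
      exact hq i
    · obtain ⟨i, hi, hlt⟩ := frequently_lt_of_tendsto hc' n
      refine ⟨i, hi, _, hu i, fun h => ?_⟩
      have := length_seg w (c i) (c (i + 1))
      rw [h, List.length_nil] at this
      omega
    · rw [hblock, length_seg, Nat.sub_zero]
      rfl

theorem isCut_drop {q : Fam α} {w : Stream' α} {s : ℕ} : IsCut q (w.drop s) 0 ↔ IsCut q w s := by
  have hseg : ∀ a b, seg (w.drop s) a b = seg w (s + a) (s + b) := fun a b => by
    simp only [seg, Stream'.drop_drop, Nat.add_sub_add_left]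
  constructor
  · rintro ⟨N, f, c, hf, hc, hc', h0, hq⟩
    refine ⟨N, f, fun i => s + c i, hf, fun i j h => Nat.add_le_add_left (hc h) s,
      tendsto_atTop_mono (fun i => Nat.le_add_left _ _) hc', by simp [h0], fun i => ?_⟩
    rw [← hseg]
    exact hq i
  · rintro ⟨N, f, c, hf, hc, hc', h0, hq⟩
    have hs : ∀ i, s ≤ c i := fun i => h0 ▸ hc (Nat.zero_le i)
    refine ⟨N, f, fun i => c i - s, hf, fun i j h => Nat.sub_le_sub_right (hc h) s,
      (tendsto_sub_atTop_nat s).comp hc', by simp [h0], fun i => ?_⟩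
    rw [hseg, Nat.add_sub_cancel' (hs i), Nat.add_sub_cancel' (hs (i + 1))]
    exact hq i

/-- The ω-words consisting of a word of `M` and infinitely many words of `q`. -/
def omegaLang (M : Language α) (q : Fam α) : Set (Stream' α) :=
  {w | ∃ s, seg w 0 s ∈ M ∧ IsCut q w s}

theorem mem_omegaLang {M : Language α} {e : BSExpr α} {w : Stream' α} :
    w ∈ omegaLang M e.fam ↔ ∃ x ∈ M, ∃ y ∈ omegaPower e.sem, w = x ++ₛ y := by
  rw [BSExpr.sem_eq_seqs]
  constructor
  · rintro ⟨s, hs, hq⟩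
    exact ⟨_, hs, w.drop s, mem_omegaPower.2 (isCut_drop.2 hq),
      (Stream'.append_take_drop s w).symm⟩
  · rintro ⟨x, hx, y, hy, rfl⟩
    refine ⟨x.length, ?_, ?_⟩
    · simp only [seg, Nat.sub_zero, Stream'.drop_zero]
      rw [Stream'.take_append_of_le_length _ _ _ le_rfl, List.take_length]
      exact hx
    · rw [← isCut_drop, Stream'.drop_append_stream]
      exact mem_omegaPower.1 hy

theorem omegaLang_mono {M M' : Language α} {q q' : Fam α} (hM : M ≤ M') (hq : Dom q q') :
    omegaLang M q ⊆ omegaLang M' q' :=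
  fun _ ⟨s, hs, h⟩ => ⟨s, hM hs, h.of_dom hq⟩

/-- One more word in front costs a larger upper threshold; its lower threshold may be 0, since only
the limit matters. -/
theorem IsCut.prepend {q : Fam α} (hq : q.Mono) {w : Stream' α} {a b : ℕ} (hab : a ≤ b)
    (ha : seg w a b ∈ q.words) (h : IsCut q w b) : IsCut q w a := by
  obtain ⟨N', ha⟩ := ha
  obtain ⟨N, f, c, hf, hc, hc', rfl, h⟩ := h
  refine ⟨max N N', fun n => Nat.casesOn n 0 f, fun n => Nat.casesOn n a c,
    (tendsto_add_atTop_iff_nat 1).1 hf, ?_, (tendsto_add_atTop_iff_nat 1).1 hc', rfl, ?_⟩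
  · refine monotone_nat_of_le_succ fun n => ?_
    cases n with
    | zero => exact hab
    | succ n => exact hc (Nat.le_succ n)
  · intro i
    cases i with
    | zero => exact hq (le_max_right _ _) le_rfl ha
    | succ i => exact hq (le_max_left _ _) le_rfl (h i)

theorem IsCut.prepend_pow {q : Fam α} (hq : q.Mono) {w : Stream' α} {a b k : ℕ} (hab : a ≤ b)
    (ha : seg w a b ∈ q.words ^ k) (h : IsCut q w b) : IsCut q w a := by
  induction k generalizing a with
  | zero =>
    rw [pow_zero] at ha
    have h1 := length_seg w a b
    have h2 : seg w a b = [] := ha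
    rw [h2, List.length_nil] at h1
    obtain rfl : a = b := by omega
    exact h
  | succ k ih =>
    rw [pow_succ'] at ha
    obtain ⟨c, h1, h2, h3, h4⟩ := exists_of_seg_mem_mul hab ha
    exact (ih h2 h4).prepend hq h1 h3

/-- Every group is refined into its factors, which inherit the thresholds of the group. Infinitely
many groups are nonempty, so there are infinitely many factors, and each group contains only
finitely many of them, so the inherited thresholds still tend to infinity. -/
theorem IsCut.of_star {q : Fam α} {w : Stream' α} {s : ℕ} (h : IsCut (q.pw .star) w s) :
    IsCut q w s := by
  obtain ⟨N, f, c, hf, hc, hc', h0, hq⟩ := h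
  have : ∀ i, ∃ l : List (List α), seg w (c i) (c (i + 1)) = l.flatten ∧
      ∀ y ∈ l, y ∈ q N (f i) := by
    intro i
    obtain ⟨k, -, hk⟩ := hq i
    obtain ⟨l, h1, -, h2⟩ := Language.mem_pow.1 hk
    exact ⟨l, h1, h2⟩
  choose ls hflat hls using this
  obtain ⟨u, -, -, hget⟩ := exists_concatenation ls
  have hG := totalLength_mono ls
  have hGtop : Tendsto (totalLength ls) atTop atTop := by
    refine tendsto_of_frequently_lt hG fun n => ?_
    obtain ⟨i, hi, hlt⟩ := frequently_lt_of_tendsto hc' n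
    refine ⟨i, hi, ?_⟩
    rw [totalLength_succ]
    have h1 := length_seg w (c i) (c (i + 1))
    rw [hflat i] at h1
    have : ls i ≠ [] := by
      intro h
      rw [h, List.flatten_nil, List.length_nil] at h1
      omega
    have := List.length_pos_of_ne_nil this
    omega
  have hpos : ∀ K, ∃ i k, K = totalLength ls i + k ∧ k < (ls i).length := by
    classical
    intro K
    have hex : ∃ i, K < totalLength ls (i + 1) := by
      obtain ⟨i, hi⟩ := (tendsto_atTop.1 hGtop (K + 1)).exists
      exact ⟨i, lt_of_lt_of_le (Nat.lt_succ_self K) (hi.trans (hG (Nat.le_succ i)))⟩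
    have h1 := Nat.find_spec hex
    rw [totalLength_succ] at h1
    have h2 : totalLength ls (Nat.find hex) ≤ K := by
      rcases Nat.eq_zero_or_eq_succ_pred (Nat.find hex) with h | h
      · rw [h]; simp [totalLength]
      · rw [h]
        exact not_lt.1 (Nat.find_min hex (m := (Nat.find hex).pred) (by omega))
    exact ⟨Nat.find hex, K - totalLength ls (Nat.find hex), by omega, by omega⟩
  choose idx off hidx hoff using hpos
  let C : ℕ → ℕ := fun k => s + ∑ j ∈ Finset.range k, (u j).length
  have hCs : ∀ k, C (k + 1) = C k + (u k).length := fun k => by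
    simp only [C, Finset.sum_range_succ]; omega
  have hC0 : C 0 = s := by simp [C]
  -- The refined cut positions `C` agree with `c` at the ends of groups; inside a group they advance
  -- by the lengths of its factors.
  have inner : ∀ i, C (totalLength ls i) = c i → ∀ k ≤ (ls i).length,
      C (totalLength ls i + k) = c i + ((ls i).take k).flatten.length := by
    intro i hi k
    induction k with
    | zero => simp [hi]
    | succ k ih =>
      intro hk
      rw [← Nat.add_assoc, hCs, ih (by omega), hget i k hk, List.take_add_one,
        List.getElem?_eq_getElem hk]
      simp only [Option.toList_some, List.flatten_append, List.length_append, List.flatten_cons,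
        List.flatten_nil, List.append_nil]
      omega
  have outer : ∀ i, C (totalLength ls i) = c i := by
    intro i
    induction i with
    | zero => simp [totalLength, hC0, h0]
    | succ i ih =>
      rw [totalLength_succ, inner i ih _ le_rfl, List.take_length, ← hflat, length_seg]
      have : c i ≤ c (i + 1) := hc (Nat.le_succ i)
      omega
  have hCm : Monotone C := monotone_nat_of_le_succ fun k => by rw [hCs]; omega
  refine ⟨N, f ∘ idx, C, hf.comp ?_, hCm, ?_, hC0, fun K => ?_⟩
  · rw [tendsto_atTop]
    intro b
    filter_upwards [eventually_ge_atTop (totalLength ls b)] with K hK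
    by_contra hlt
    have h1 := hG (show idx K + 1 ≤ b by omega)
    rw [totalLength_succ] at h1
    have := hidx K
    have := hoff K
    omega
  · refine tendsto_atTop_atTop_of_monotone hCm fun b => ?_
    obtain ⟨i, hi⟩ := (tendsto_atTop.1 hc' b).exists
    exact ⟨totalLength ls i, by rw [outer]; exact hi⟩
  · have h1 := hidx K
    have h2 := hoff K
    change _ ∈ q N (f (idx K))
    generalize idx K = i at *
    generalize off K = k at *
    subst h1
    have hsplit : (ls i).flatten = ((ls i).take k).flatten ++ ((ls i)[k] ++
        ((ls i).drop (k + 1)).flatten) := by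
      conv_lhs => rw [← List.take_append_drop k (ls i), List.drop_eq_getElem_cons h2]
      rw [List.flatten_append, List.flatten_cons]
    have hle := hc (Nat.le_succ i)
    obtain ⟨g1, -, g3⟩ := seg_eq_append hle ((hflat i).trans hsplit)
    obtain ⟨-, g4, -⟩ := seg_eq_append g1 g3
    rw [hCs, inner i (outer i) k h2.le, hget i k h2, g4]
    exact hls i _ (List.getElem_mem h2)

/-! ### Intersections of ω-languages -/

/-- When the words from index `i` on are merged into blocks, one lower threshold has to serve all of
them. -/
theorem exists_tendsto_minorant {f : ℕ → ℕ} (hf : Tendsto f atTop atTop) :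
    ∃ g : ℕ → ℕ, Tendsto g atTop atTop ∧ ∀ i k, i ≤ k → g i ≤ f k := by
  obtain ⟨g, hg, h⟩ := exists_tendsto_of_eventually (P := fun i M => ∀ k, i ≤ k → M ≤ f k)
    (fun _ _ _ => Nat.zero_le _) fun M => by
      obtain ⟨K, hK⟩ := eventually_atTop.1 (tendsto_atTop.1 hf M)
      filter_upwards [eventually_ge_atTop K] with i hi k hk using hK k (hi.trans hk)
  exact ⟨g, hg, h⟩

theorem exists_mem_interval {c : ℕ → ℕ} (hc : Tendsto c atTop atTop) {n : ℕ} (hn : c 0 ≤ n) :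
    ∃ i, c i ≤ n ∧ n ≤ c (i + 1) := by
  classical
  have hex : ∃ i, n ≤ c (i + 1) := by
    obtain ⟨i, hi1, hi2⟩ := ((tendsto_atTop.1 hc n).and (eventually_ge_atTop 1)).exists
    exact ⟨i - 1, by rwa [Nat.sub_add_cancel hi2]⟩
  refine ⟨Nat.find hex, ?_, Nat.find_spec hex⟩
  cases h : Nat.find hex with
  | zero => exact hn
  | succ i =>
    have := Nat.find_min hex (m := i) (by omega)
    omega

/-- Prefixes of an intersection of ω-languages: they end in a position where a word of the first
language is cut after a piece in `l`. -/
def interPrefix (M M' : Language α) (p q l : Fam α) : Fam α :=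
  ((fun _ _ => M) * (p.pw .star * l)) ⊓ ((fun _ _ => M') * q.pw .star)

/-- Factors of an intersection of ω-languages. -/
def interFactor (p q l r : Fam α) : Fam α := (r * (p.pw .star * l)) ⊓ q.pw .star

/-- Almost every position `d j` lies inside some word of the first factorization and cuts it into
pieces from `F`. There are finitely many pairs of families, so one pair `(l, r)` occurs for
infinitely many `j`. Between two chosen positions the first factorization reads a piece in `r`,
whole words and a piece in `l`; the second reads whole words. -/
theorem exists_of_mem_inter_omegaLang {F : Set (Fam α)} (hF : SplitClosed F) {M M' : Language α}
    {p q : Fam α} (hp : p.Mono) (hq : q.Mono) (hpF : p ∈ F) {w : Stream' α}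
    (hw : w ∈ omegaLang M p) (hw' : w ∈ omegaLang M' q) :
    ∃ l ∈ F, ∃ r ∈ F, Dom (l * r) p ∧
      w ∈ omegaLang (interPrefix M M' p q l).words (interFactor p q l r) := by
  obtain ⟨s, hs, N, f, c, hf, hc, hc', h0, h⟩ := hw
  obtain ⟨s', hs', N', f', d, hf', hd, hd', h0', h'⟩ := hw'
  obtain ⟨P, hP⟩ := (hF.complete N).exists
  have hbound : ∀ᶠ j in atTop, c 0 ≤ d j := tendsto_atTop.1 hd' _
  have : ∀ j, ∃ i, c 0 ≤ d j → c i ≤ d j ∧ d j ≤ c (i + 1) := fun j => by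
    by_cases hj : c 0 ≤ d j
    · obtain ⟨i, hi⟩ := exists_mem_interval hc' hj
      exact ⟨i, fun _ => hi⟩
    · exact ⟨0, fun h => (hj h).elim⟩
  choose i hi using this
  have hitop : Tendsto i atTop atTop := by
    rw [tendsto_atTop]
    intro b
    filter_upwards [hbound, tendsto_atTop.1 hd' (c b + 1)] with j h1 h2
    by_contra hlt
    have h3 := (hi j h1).2
    have h4 : c (i j + 1) ≤ c b := hc (by omega)
    omega
  let Q : Fam α × Fam α → ℕ → Prop := fun x j => c 0 ≤ d j ∧ Dom (x.1 * x.2) p ∧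
    seg w (c (i j)) (d j) ∈ x.1 P.N (P.φ (f (i j))) ∧
    seg w (d j) (c (i j + 1)) ∈ x.2 P.N (P.φ (f (i j)))
  obtain ⟨⟨l, r⟩, ⟨hl, hr⟩, hlr⟩ : ∃ x ∈ F ×ˢ F, ∃ᶠ j in atTop, Q x j := by
    by_contra! hcon
    have h1 := (eventually_all_finite (hF.finite.prod hF.finite)).2
      hcon
    obtain ⟨j, hj1, hj2⟩ := (h1.and hbound).exists
    obtain ⟨h3, h4⟩ := hi j hj2
    have h5 := h (i j)
    rw [← seg_append h3 h4] at h5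
    obtain ⟨l, hl, r, hr, hdom, h6, h7⟩ := hP p hpF _ _ _ h5
    exact hj1 (l, r) ⟨hl, hr⟩ ⟨hj2, hdom, h6, h7⟩
  obtain ⟨φ, hφ, hφQ⟩ := extraction_of_frequently_atTop hlr
  -- A second extraction puts the chosen positions into different words of the first factorization,
  -- so that the piece in `r` ends before the next piece in `l` starts.
  obtain ⟨χ, hχ, hχi⟩ := strictMono_subseq_of_tendsto_atTop (hitop.comp hφ.tendsto_atTop)
  have hφχ := hφ.comp hχ
  set J : ℕ → ℕ := φ ∘ χ with hJ
  set I : ℕ → ℕ := fun t => i (J t) with hI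
  have hIm : StrictMono I := hχi
  have hQ : ∀ t, Q (l, r) (J t) := fun t => hφQ (χ t)
  have hle : ∀ t, c (I t) ≤ d (J t) ∧ d (J t) ≤ c (I t + 1) := fun t => hi _ (hQ t).1
  have hle' : ∀ t, c (I t + 1) ≤ c (I (t + 1)) := fun t => hc (hIm (Nat.lt_succ_self t))
  obtain ⟨g1, hg1, hg1'⟩ := exists_tendsto_minorant hf
  obtain ⟨g2, hg2, hg2'⟩ := exists_tendsto_minorant hf'
  obtain ⟨g3, hg3, hg3'⟩ := exists_tendsto_minorant (P.tendsto.comp hf)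
  have hlm := hF.mono l hl
  have hrm := hF.mono r hr
  -- The three minorants serve the whole words of `q`, the whole words of `p` and the pieces, whose
  -- thresholds were changed by `P`.
  refine ⟨l, hl, r, hr, (hQ 0).2.1, d (J 0), ⟨max N (max N' P.N), ?_, ?_⟩, max N (max N' P.N),
    fun t => min (g2 (J t)) (min (g1 (I t)) (g3 (I t))), fun t => d (J t),
    tendsto_min (hg2.comp hφχ.tendsto_atTop) (tendsto_min (hg1.comp hIm.tendsto_atTop)
      (hg3.comp hIm.tendsto_atTop)), hd.comp hφχ.monotone, hd'.comp hφχ.tendsto_atTop, rfl,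
    fun t => ⟨?_, ?_⟩⟩
  · refine seg_mem_mul (Nat.zero_le s) (by have := (hQ 0).1; omega) hs ?_
    rw [← h0]
    refine seg_mem_mul (hc (Nat.zero_le (I 0))) (hle 0).1 ⟨I 0 - 0, trivial, ?_⟩
      (hlm (by omega) (Nat.zero_le _) (hQ 0).2.2.1)
    exact seg_mem_pow hc (Nat.zero_le _) fun k _ _ => hp (le_max_left _ _) (Nat.zero_le _) (h k)
  · refine seg_mem_mul (Nat.zero_le s') (h0' ▸ hd (Nat.zero_le _)) hs' ?_
    rw [← h0']
    refine ⟨J 0 - 0, trivial, seg_mem_pow hd (Nat.zero_le _) fun k _ _ =>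
      hq (by omega) (Nat.zero_le _) (h' k)⟩
  · refine seg_mem_mul (hle t).2 ((hle' t).trans (hle (t + 1)).1) ?_ (seg_mem_mul (hle' t)
      (hle (t + 1)).1 ⟨I (t + 1) - (I t + 1), trivial, ?_⟩ ?_)
    · refine hrm (by omega) ?_ (hQ t).2.2.2
      exact ((min_le_right _ _).trans (min_le_right _ _)).trans (hg3' (I t) (I t) le_rfl)
    · refine seg_mem_pow hc (hIm (Nat.lt_succ_self t)) fun k h1 _ => hp (le_max_left _ _) ?_ (h k)
      exact ((min_le_right _ _).trans (min_le_left _ _)).trans (hg1' (I t) k (by omega))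
    · refine hlm (by omega) ?_ (hQ (t + 1)).2.2.1
      exact ((min_le_right _ _).trans (min_le_right _ _)).trans
        (hg3' (I t) (I (t + 1)) (hIm (Nat.lt_succ_self t)).le)
  · refine ⟨J (t + 1) - J t, trivial, seg_mem_pow hd (hφχ (Nat.lt_succ_self t)).le fun k h1 _ =>
      hq (by omega) ?_ (h' k)⟩
    exact (min_le_left _ _).trans (hg2' (J t) k h1)

theorem IsCut.prepend_star {q : Fam α} (hq : q.Mono) {w : Stream' α} {a b N : ℕ} (hab : a ≤ b)
    (ha : seg w a b ∈ q.pw .star N 0) (h : IsCut (q.pw .star) w b) : IsCut q w a := by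
  obtain ⟨k, -, hk⟩ := ha
  exact h.of_star.prepend_pow hq hab
    (pow_le_pow_left' (show q N 0 ≤ q.words from fun z hz => ⟨N, hz⟩) k hk)

/-- For `p`, shift the grouping so that each `l` joins the `r` that follows it: `l * r * p^*` is
dominated by `p^*`, and the ω-power absorbs the star. For `q` the absorption applies directly. -/
theorem omegaLang_interFactor_subset {M M' : Language α} {p q l r : Fam α} (hp : p.Mono)
    (hq : q.Mono) (hl : l.Mono) (hr : r.Mono) (hlr : Dom (l * r) p) :
    omegaLang (interPrefix M M' p q l).words (interFactor p q l r) ⊆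
      omegaLang M p ∩ omegaLang M' q := by
  rintro w ⟨s, ⟨K, hK, hK'⟩, N, f, D, hf, hD, hD', h0, h⟩
  constructor
  · obtain ⟨s1, -, h1, hM, hK⟩ := exists_of_seg_mem_mul (Nat.zero_le s) hK
    obtain ⟨s2, h2, h3, hstar, hK⟩ := exists_of_seg_mem_mul h1 hK
    refine ⟨s1, hM, IsCut.prepend_star hp h2 hstar ?_⟩
    have : ∀ t, ∃ b b', D t ≤ b ∧ b ≤ b' ∧ b' ≤ D (t + 1) ∧ seg w (D t) b ∈ r N (f t) ∧
        seg w b b' ∈ p.pw .star N (f t) ∧ seg w b' (D (t + 1)) ∈ l N (f t) := by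
      intro t
      obtain ⟨b, h4, h5, h6, h7⟩ := exists_of_seg_mem_mul (hD (Nat.le_succ t)) (h t).1
      obtain ⟨b', h8, h9, h10, h11⟩ := exists_of_seg_mem_mul h5 h7
      exact ⟨b, b', h4, h8, h9, h6, h10, h11⟩
    choose b b' hb1 hb2 hb3 hb4 hb5 hb6 using this
    -- `B t` is the start of the piece in `l` that ends at `D t`. The first of these pieces belongs
    -- to the prefix, where only the lower threshold 0 is known.
    let B : ℕ → ℕ := fun t => Nat.casesOn t s2 b'
    let g : ℕ → ℕ := fun t => Nat.casesOn t 0 f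
    have hBD : ∀ t, B t ≤ D t := by
      rintro (_ | t)
      · exact h0 ▸ h3
      · exact hb3 t
    have hBl : ∀ t, seg w (B t) (D t) ∈ l (max N K) (g t) := by
      rintro (_ | t)
      · rw [h0]
        exact hl (le_max_right _ _) le_rfl hK
      · exact hl (le_max_left _ _) le_rfl (hb6 t)
    have hB : IsCut (l * (r * p.pw .star)) w s2 := by
      refine ⟨max N K, fun t => min (g t) (f t), B,
        tendsto_min ((tendsto_add_atTop_iff_nat 1).1 hf) hf,
        monotone_nat_of_le_succ fun t => (hBD t).trans ((hb1 t).trans (hb2 t)),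
        (tendsto_add_atTop_iff_nat 1).1 (tendsto_atTop_mono (fun t => (hb1 t).trans (hb2 t)) hD'),
        rfl, fun t => ?_⟩
      refine seg_mem_mul (hBD t) ((hb1 t).trans (hb2 t)) (hl le_rfl (min_le_left _ _) (hBl t))
        (seg_mem_mul (hb1 t) (hb2 t) (hr (le_max_left _ _) (min_le_right _ _) (hb4 t)) ?_)
      exact (hp.pw _) (le_max_left _ _) (min_le_right _ _) (hb5 t)
    refine hB.of_dom ?_
    rw [← mul_assoc]
    refine (hlr.mul (.refl (hp.pw .star))).trans ?_ (hp.pw .star)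
    rw [← pw_pos_eq]
    exact Dom.of_le' (hp.pw .star) fun _ _ _ ⟨k, _, hk⟩ => ⟨k, trivial, hk⟩
  · obtain ⟨s1, -, h1, hM, hstar⟩ := exists_of_seg_mem_mul (Nat.zero_le s) hK'
    exact ⟨s1, hM, IsCut.prepend_star hq h1 hstar ⟨N, f, D, hf, hD, hD', h0, fun t => (h t).2⟩⟩

/-! ### Regularity -/

/-- The language is that of an `ωBS`-regular expression with permitted exponents. -/
def IsOmegaRegular (hB hS : Prop) (L : Set (Stream' α)) : Prop :=
  ∃ e : OmegaExpr α, (∀ t ∈ e, t.2.Allowed hB hS) ∧ e.sem = L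

theorem OmegaExpr.sem_eq (e : OmegaExpr α) :
    e.sem = ⋃ t ∈ {t | t ∈ e}, omegaLang t.1.matches' t.2.fam := by
  ext w
  simp only [Set.mem_iUnion₂, mem_omegaLang, exists_prop]
  rfl

section IsOmegaRegular

variable {hB hS : Prop}

theorem isOmegaRegular_biUnion {ι : Type*} {s : Set ι} (hs : s.Finite) {L : ι → Set (Stream' α)}
    (h : ∀ i ∈ s, IsOmegaRegular hB hS (L i)) : IsOmegaRegular hB hS (⋃ i ∈ s, L i) := by
  induction s, hs using Set.Finite.induction_on with
  | empty => exact ⟨[], by simp, by simp [OmegaExpr.sem]⟩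
  | @insert a s _ _ ih =>
    obtain ⟨e, he, h1⟩ := h a (Set.mem_insert a s)
    obtain ⟨e', he', h2⟩ := ih fun i hi => h i (Set.mem_insert_of_mem a hi)
    refine ⟨e ++ e', fun t ht => (List.mem_append.1 ht).elim (he t) (he' t), ?_⟩
    rw [Set.biUnion_insert, ← h1, ← h2]
    ext w
    simp only [OmegaExpr.sem, List.mem_append, Set.mem_ofPred_eq, Set.mem_union, or_and_right,
      exists_or]

theorem Definable.isOmegaRegular {p q : Fam α} (hp : Definable hB hS p) (hq : Definable hB hS q) :
    IsOmegaRegular hB hS (omegaLang p.words q) := by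
  obtain ⟨hp, e, -, h1, h2⟩ := hp
  obtain ⟨hq, f, hf, h3, h4⟩ := hq
  refine ⟨[(e.toRegular, f)], by simpa using hf, ?_⟩
  have : OmegaExpr.sem [(e.toRegular, f)] = omegaLang e.fam.words f.fam := by
    rw [OmegaExpr.sem_eq]
    simp [BSExpr.matches'_toRegular]
  rw [this]
  exact (omegaLang_mono (h2.words_le hp) h4).antisymm (omegaLang_mono (h1.words_le e.mono_fam) h3)

/-- Prefixes and factors are intersections of pieces: of `M · e^*` with `M' · f^*`, and of `e^*`
with `f^*`. So both are definable by `compatible_of_allowed`, and the union over the pairs `(l, r)`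
is finite. -/
theorem isOmegaRegular_inter_omegaLang {e f : BSExpr α} (he : e.Allowed hB hS)
    (hf : f.Allowed hB hS) (M M' : RegularExpression α) :
    IsOmegaRegular hB hS (omegaLang M.matches' e.fam ∩ omegaLang M'.matches' f.fam) := by
  obtain ⟨hF, heF⟩ := e.fac_spec
  have hM : ∀ M : RegularExpression α, (fun _ _ => M.matches') = (BSExpr.ofRegular M).fam :=
    fun M => funext₂ fun N m => (BSExpr.fam_ofRegular M N m).symm
  have hstar : ∀ {e : BSExpr α}, e.Allowed hB hS → (BSExpr.star e).Allowed hB hS := fun h => h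
  have : omegaLang M.matches' e.fam ∩ omegaLang M'.matches' f.fam =
      ⋃ x ∈ {x : Fam α × Fam α | x ∈ e.fac ×ˢ e.fac ∧ Dom (x.1 * x.2) e.fam},
        omegaLang (interPrefix M.matches' M'.matches' e.fam f.fam x.1).words
          (interFactor e.fam f.fam x.1 x.2) := by
    apply Set.Subset.antisymm
    · rintro w ⟨h1, h2⟩
      obtain ⟨l, hl, r, hr, hlr, h⟩ := exists_of_mem_inter_omegaLang hF e.mono_fam f.mono_fam heF
        h1 h2
      exact Set.mem_iUnion₂.2 ⟨(l, r), ⟨⟨hl, hr⟩, hlr⟩, h⟩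
    · refine Set.iUnion₂_subset fun x hx => ?_
      exact omegaLang_interFactor_subset e.mono_fam f.mono_fam (hF.mono _ hx.1.1)
        (hF.mono _ hx.1.2) hx.2
  rw [this]
  refine isOmegaRegular_biUnion ((hF.finite.prod hF.finite).subset fun x hx => hx.1) ?_
  rintro ⟨l, r⟩ ⟨⟨hl, hr⟩, -⟩
  refine Definable.isOmegaRegular ?_ ?_
  · rw [interPrefix, hM, hM]
    refine compatible_of_allowed (e := .comp (.ofRegular M) (.star e))
      (f := .comp (.ofRegular M') (.star f)) ((BSExpr.allowed_ofRegular M).comp (hstar he))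
      ((BSExpr.allowed_ofRegular M').comp (hstar hf)) _ ?_ _ (BSExpr.fac_spec _).2
    refine ⟨_, (BSExpr.fac_spec _).2, e.fam.pw .star * l, .inr ⟨1, hF.one_mem, .star, .inl rfl, l, hl,
      (one_mul _).symm⟩, rfl⟩
  · exact compatible_of_allowed (e := .star e) (f := .star f) (hstar he) (hstar hf) _
      (.inr ⟨r, hr, .star, .inl rfl, l, hl, rfl⟩) _ (BSExpr.fac_spec (.star f)).2

theorem IsOmegaRegular.inter {K L : Set (Stream' α)} (hK : IsOmegaRegular hB hS K)
    (hL : IsOmegaRegular hB hS L) : IsOmegaRegular hB hS (K ∩ L) := by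
  obtain ⟨e, he, rfl⟩ := hK
  obtain ⟨f, hf, rfl⟩ := hL
  rw [OmegaExpr.sem_eq, OmegaExpr.sem_eq]
  simp only [Set.inter_iUnion₂, Set.iUnion₂_inter]
  exact isOmegaRegular_biUnion (List.finite_toSet f) fun t' ht' =>
    isOmegaRegular_biUnion (List.finite_toSet e) fun t ht =>
      isOmegaRegular_inter_omegaLang (he t ht) (hf t' ht') t.1 t'.1

end IsOmegaRegular

theorem isOmegaBSRegular_iff {L : Set (Stream' α)} :
    IsOmegaBSRegular L ↔ IsOmegaRegular True True L := by
  simp [IsOmegaBSRegular, IsOmegaRegular, BSExpr.Allowed]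

theorem isOmegaBRegular_iff {L : Set (Stream' α)} :
    IsOmegaBRegular L ↔ IsOmegaRegular True False L := by
  simp [IsOmegaBRegular, IsOmegaRegular, BSExpr.Allowed]

theorem isOmegaSRegular_iff {L : Set (Stream' α)} :
    IsOmegaSRegular L ↔ IsOmegaRegular False True L := by
  simp [IsOmegaSRegular, IsOmegaRegular, BSExpr.Allowed]

end OmegaBS

theorem corollary3p2 {α : Type*} [Finite α] (K L : Set (Stream' α)) :
    (OmegaBS.IsOmegaBSRegular K → OmegaBS.IsOmegaBSRegular L →
      OmegaBS.IsOmegaBSRegular (K ∩ L)) ∧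
    (OmegaBS.IsOmegaBRegular K → OmegaBS.IsOmegaBRegular L →
      OmegaBS.IsOmegaBRegular (K ∩ L)) ∧
    (OmegaBS.IsOmegaSRegular K → OmegaBS.IsOmegaSRegular L →
      OmegaBS.IsOmegaSRegular (K ∩ L)) := by
  simp only [OmegaBS.isOmegaBSRegular_iff, OmegaBS.isOmegaBRegular_iff,
    OmegaBS.isOmegaSRegular_iff]
  exact ⟨.inter, .inter, .inter⟩
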